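/- **Theorem (Fractional integrals on the sphere).** Let $n\ge 3$, let $\mathbb S^{n-1}\subset\mathbb R^n$ be the unit sphere with surface measure $\mathcal H^{n-1}$ and area $\omega_{n-1}=2\pi^{n/2}/\Gamma(n/2)$, and put $\nu=\frac{n-2}{2}$, $\lambda_k=k(k+n-2)$, $d(x,y)=\arccos(x\cdot y)$. For each $k\ge 0$ let $\{Y_{k,l}\}_{l}$ be any real $L^2(\mathbb S^{n-1})$-orthonormal basis of the space of spherical harmonics of degree $k$ (restrictions to $\mathbb S^{n-1}$ of harmonic homogeneous polynomials of degree $k$). For $s>0$ and $u\in C^\infty(\mathbb S^{n-1})$ real-valued with $\int_{\mathbb S^{n-1}}u\,d\mathcal H^{n-1}=0$, the negative power of the Laplacian on the sphere is defined by $$(-\Delta_{\mathbb S^{n-1}})^{-s}u(x)=\sum_{k=1}^\infty\lambda_k^{-s}\sum_l\Big(\int_{\mathbb S^{n-1}}u\,Y_{k,l}\,d\mathcal H^{n-1}\Big)Y_{k,l}(x).$$ Let $C_k^\nu$ be the Gegenbauer polynomials, let $$P_r(\tau)=\frac{1-r^2}{\omega_{n-1}(1-2r\tau+r^2)^{n/2}},\qquad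 \mathcal I_\rho(z)=\sum_{m=0}^\infty\frac{(z/2)^{2m+\rho}}{\Gamma(m+1)\Gamma(m+\rho+1)}$$ be the Poisson kernel of the unit ball and the modified Bessel function of the first kind. For $-1\le\tau<1$ the Minakshisundaram zeta function $\sigma\mapsto K_{-\sigma}(\tau)$ is the function that is holomorphic on $\operatorname{Re}\sigma>0$ and is given for $\operatorname{Re}\sigma>\frac{n-1}{2}$ by the absolutely convergent series $$K_{-\sigma}(\tau)=\frac1{\omega_{n-1}}\sum_{k=1}^\infty\lambda_k^{-\sigma}\,\frac{k+\nu}{\nu}\,C_k^\nu(\tau);$$ for $\tau=1$ and $\operatorname{Re}\sigma>\frac{n-1}2$ it is defined by the same series. Fix $s>0$. The zeta function above exists and the kernel $K_{-s}$ has the following properties. 1. (Integral representation.) For $-1\le\tau<1$, and also for $\tau=1$ if $s>\frac{n-1}{2}$, $$K_{-s}(\tau)=\Big(\frac4{n-2}\Big)^{s-1/2}\frac{\Gamma(s+\frac12)}{\Gamma(2s)}\int_0^\infty e^{-t\frac{n-2}{2}}\Big(P_{e^{-t}}(\tau)-\frac1{\omega_{n-1}}\Big)\,\mathcal I_{s-1/2}\Big(\frac{n-2}{2}t\Big)\,\frac{dt}{t^{1/2-s}},$$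 where the integral converges absolutely. 2. (Estimates.) There is a constant $c_{n,s}>0$, depending only on $n$ and $s$, such that for all $x,y\in\mathbb S^{n-1}$ with $x\ne y$, $$|K_{-s}(x\cdot y)|\le c_{n,s}\begin{cases}1/d(x,y)^{(n-1)-2s},& s<\frac{n-1}{2},\\[2pt] \ln\big(1+(1-x\cdot y)^{-n/2}\big),& s=\frac{n-1}{2},\\[2pt] 1,& s>\frac{n-1}{2}.\end{cases}$$ 3. (Spherical convolution.) For every real $u\in C^\infty(\mathbb S^{n-1})$ with mean zero and every $x\in\mathbb S^{n-1}$, the sum over $k$ defining $(-\Delta_{\mathbb S^{n-1}})^{-s}u(x)$ converges absolutely, the function $y\mapsto K_{-s}(x\cdot y)u(y)$ is integrable on $\mathbb S^{n-1}$, and $$(-\Delta_{\mathbb S^{n-1}})^{-s}u(x)=\int_{\mathbb S^{n-1}}K_{-s}(x\cdot y)\,u(y)\,d\mathcal H^{n-1}(y).$$ -/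

import Mathlib

open MeasureTheory Set

noncomputable section

namespace FracSphere

/-- The unit sphere of `ℝⁿ`, of dimension `n - 1`. -/
abbrev Sph (n : ℕ) : Type := Metric.sphere (0 : EuclideanSpace ℝ (Fin n)) 1

/-- The surface measure of the unit sphere: the measure for which Lebesgue measure is
`r ^ (n - 1) dr dσ` in polar coordinates. It is the `(n - 1)`-dimensional Hausdorff measure
(in its Euclidean normalization) of the sphere. -/
def surf (n : ℕ) : Measure (Sph n) :=
  (volume : Measure (EuclideanSpace ℝ (Fin n))).toSphere

/-- The surface area `2 π ^ (n / 2) / Γ(n / 2)` of the unit sphere of `ℝⁿ`. -/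
def area (n : ℕ) : ℝ := 2 * Real.pi ^ ((n : ℝ) / 2) / Real.Gamma ((n : ℝ) / 2)

/-- The cosine `x · y` of the angle between two points of the sphere. -/
def dot {n : ℕ} (x y : Sph n) : ℝ :=
  inner ℝ (x : EuclideanSpace ℝ (Fin n)) (y : EuclideanSpace ℝ (Fin n))

/-- The geodesic distance on the sphere. -/
def geoDist {n : ℕ} (x y : Sph n) : ℝ := Real.arccos (dot x y)

open Classical in
/-- The extension of a function on the sphere to `ℝⁿ \ {0}` that is constant along the rays from
the origin (with the irrelevant value `0` at the origin). -/
def radialExt {n : ℕ} (u : Sph n → ℝ) (X : EuclideanSpace ℝ (Fin n)) : ℝ :=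
  if h : X = 0 then 0
  else u ⟨‖X‖⁻¹ • X, by
    rw [mem_sphere_zero_iff_norm, norm_smul, norm_inv, norm_norm,
      inv_mul_cancel₀ (norm_ne_zero_iff.mpr h)]⟩

/-- A smooth function on the sphere: its extension along rays is smooth away from the origin. -/
def SmoothOnSphere {n : ℕ} (u : Sph n → ℝ) : Prop :=
  ContDiffOn ℝ (⊤ : ℕ∞) (radialExt u) {0}ᶜ

/-! ### Spherical harmonics and the spectral definition of the negative powers -/

/-- The Laplacian on real polynomials in `n` variables. -/
def polyLaplacian (n : ℕ) : MvPolynomial (Fin n) ℝ →ₗ[ℝ] MvPolynomial (Fin n) ℝ :=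
  ∑ i : Fin n, (MvPolynomial.pderiv (R := ℝ) i).toLinearMap ∘ₗ
    (MvPolynomial.pderiv (R := ℝ) i).toLinearMap

/-- Restriction of a polynomial to the sphere. -/
def restrictPoly (n : ℕ) : MvPolynomial (Fin n) ℝ →ₗ[ℝ] (Sph n → ℝ) where
  toFun p x := MvPolynomial.eval (fun i => (x : EuclideanSpace ℝ (Fin n)) i) p
  map_add' p q := by ext x; simp
  map_smul' c p := by ext x; simp

/-- The space of (real) spherical harmonics of degree `k`: the restrictions to the sphere of the
harmonic homogeneous polynomials of degree `k`. -/
def SH (n k : ℕ) : Submodule ℝ (Sph n → ℝ) :=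
  (MvPolynomial.homogeneousSubmodule (Fin n) ℝ k ⊓ LinearMap.ker (polyLaplacian n)).map
    (restrictPoly n)

/-- `Y` is an orthonormal basis of the space of spherical harmonics of degree `k`, for the inner
product of `L²` of the sphere. -/
structure IsONB (n k : ℕ) {d : ℕ} (Y : Fin d → Sph n → ℝ) : Prop where
  orthonormal : ∀ l m, ∫ y, Y l y * Y m y ∂(surf n) = if l = m then 1 else 0
  span_eq : Submodule.span ℝ (range Y) = SH n k

/-- The coefficient of `u` along a spherical harmonic. -/
def coeff {n : ℕ} (Y : Sph n → ℝ) (u : Sph n → ℝ) : ℝ := ∫ y, u y * Y y ∂(surf n)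

/-- The projection of `u` onto the space spanned by the orthonormal family `Y`. -/
def proj {n d : ℕ} (Y : Fin d → Sph n → ℝ) (u : Sph n → ℝ) (x : Sph n) : ℝ :=
  ∑ l, coeff (Y l) u * Y l x

/-- The eigenvalue `k (k + n - 2)` of minus the spherical Laplacian (used for `n ≥ 2`). -/
def eigen (n k : ℕ) : ℝ := (k : ℝ) * ((k : ℝ) + (n : ℝ) - 2)

/-- The term of degree `k + 1` in the spectral series of `(-Δ) ^ (-s) u` at `x`. -/
def negPowTerm {n : ℕ} {d : ℕ → ℕ} (Y : ∀ k, Fin (d k) → Sph n → ℝ) (s : ℝ)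
    (u : Sph n → ℝ) (x : Sph n) (k : ℕ) : ℝ :=
  (eigen n (k + 1)) ^ (-s) * proj (Y (k + 1)) u x

/-- The negative power `(-Δ) ^ (-s) u` of the spherical Laplacian at `x`, for `u` with mean zero:
the sum over `k ≥ 1` of `λ_k ^ (-s)` times the projection of `u` onto the spherical harmonics
of degree `k`. -/
def negPow {n : ℕ} {d : ℕ → ℕ} (Y : ∀ k, Fin (d k) → Sph n → ℝ) (s : ℝ)
    (u : Sph n → ℝ) (x : Sph n) : ℝ :=
  ∑' k, negPowTerm Y s u x k

/-! ### The Minakshisundaram zeta function -/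

/-- The Gegenbauer (ultraspherical) polynomials `C_k^ν`, through their three-term recurrence
(`∑ C_k^ν(τ) r ^ k = (1 - 2 τ r + r²) ^ (-ν)`). -/
def gegenbauer (ν τ : ℝ) : ℕ → ℝ
  | 0 => 1
  | 1 => 2 * ν * τ
  | k + 2 => (2 * τ * ((k : ℝ) + 1 + ν) * gegenbauer ν τ (k + 1)
      - ((k : ℝ) + 2 * ν) * gegenbauer ν τ k) / ((k : ℝ) + 2)

/-- The parameter `ν = (n - 2) / 2`. -/
def nu (n : ℕ) : ℝ := ((n : ℝ) - 2) / 2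

/-- The term of degree `k + 1` of the Dirichlet series of the Minakshisundaram zeta function. -/
def zetaTerm (n : ℕ) (τ : ℝ) (σ : ℂ) (k : ℕ) : ℂ :=
  ((1 / area n : ℝ) : ℂ) * ((eigen n (k + 1) : ℝ) : ℂ) ^ (-σ) *
    (((((k + 1 : ℕ) : ℝ) + nu n) / nu n * gegenbauer (nu n) τ (k + 1) : ℝ) : ℂ)

/-- `Z` is the Minakshisundaram zeta function `σ ↦ K_{-σ}(τ)` on the half plane `Re σ > 0`:
it is given by the Dirichlet series for `Re σ > (n - 1) / 2` and is holomorphic for `Re σ > 0`.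
These two conditions determine the values of `Z` on `Re σ > 0`. -/
structure IsMinakZeta (n : ℕ) (τ : ℝ) (Z : ℂ → ℂ) : Prop where
  hasSum : ∀ σ : ℂ, ((n : ℝ) - 1) / 2 < σ.re → HasSum (zetaTerm n τ σ) (Z σ)
  holo : DifferentiableOn ℂ Z {σ : ℂ | 0 < σ.re}

/-- The Poisson kernel `P_r(τ)` of the unit ball of `ℝⁿ`. -/
def poisson (n : ℕ) (r τ : ℝ) : ℝ :=
  (1 - r ^ 2) / (area n * (1 - 2 * r * τ + r ^ 2) ^ ((n : ℝ) / 2))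

/-- The modified Bessel function of the first kind `I_ρ(z)` (for `z > 0`). -/
def besselI (ρ z : ℝ) : ℝ :=
  ∑' m : ℕ, (z / 2) ^ (2 * (m : ℝ) + ρ) / (Real.Gamma ((m : ℝ) + 1) * Real.Gamma ((m : ℝ) + ρ + 1))

/-- The integrand, on `t > 0`, of the integral representation of the kernel. -/
def kernelIntegrand (n : ℕ) (s τ t : ℝ) : ℝ :=
  Real.exp (-t * nu n) * (poisson n (Real.exp (-t)) τ - 1 / area n) *
    besselI (s - 1 / 2) (nu n * t) * t ^ (s - 1 / 2)

/-- The right-hand side of the estimate for the kernel (without the constant). -/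
def kernelBound (n : ℕ) (s : ℝ) (x y : Sph n) : ℝ :=
  if s < ((n : ℝ) - 1) / 2 then 1 / geoDist x y ^ (((n : ℝ) - 1) - 2 * s)
  else if s = ((n : ℝ) - 1) / 2 then Real.log (1 + (1 - dot x y) ^ (-(n : ℝ) / 2))
  else 1

/-! ### Orthonormal bases of spherical harmonics exist -/

theorem continuous_of_mem_SH {n k : ℕ} {f : Sph n → ℝ} (hf : f ∈ SH n k) : Continuous f := by
  obtain ⟨p, -, rfl⟩ := hf
  change Continuous fun x : Sph n => MvPolynomial.eval (fun i => (x : EuclideanSpace ℝ (Fin n)) i) p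
  exact (MvPolynomial.continuous_eval p).comp (by fun_prop)

instance (n k : ℕ) : FiniteDimensional ℝ (SH n k) := by
  have h : FiniteDimensional ℝ (MvPolynomial.homogeneousSubmodule (Fin n) ℝ k) :=
    Module.Finite.iff_fg.mpr (MvPolynomial.homogeneousSubmodule_fg (Fin n) ℝ k)
  have h2 := Submodule.finiteDimensional_inf_left
    (MvPolynomial.homogeneousSubmodule (Fin n) ℝ k) (LinearMap.ker (polyLaplacian n))
  unfold SH
  infer_instance

theorem integrable_of_continuous {n : ℕ} {f : Sph n → ℝ} (hf : Continuous f) :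
    Integrable f (surf n) := by
  have : IsFiniteMeasure (surf n) := by unfold surf; infer_instance
  exact hf.integrable_of_hasCompactSupport (HasCompactSupport.of_compactSpace f)

theorem exists_isONB (n k : ℕ) : ∃ (d : ℕ) (Y : Fin d → Sph n → ℝ), IsONB n k Y := by
  have hpos : (surf n).IsOpenPosMeasure := by unfold surf; infer_instance
  let c : InnerProductSpace.Core ℝ (SH n k) :=
    { inner := fun f g => ∫ y, f.1 y * g.1 y ∂(surf n)
      conj_inner_symm := fun f g => by simp [mul_comm]
      re_inner_nonneg := fun f => by
        simpa using integral_nonneg (fun y => mul_self_nonneg (f.1 y))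
      add_left := fun f g h => by
        have hf := continuous_of_mem_SH f.2
        have hg := continuous_of_mem_SH g.2
        have hh := continuous_of_mem_SH h.2
        simp only [Submodule.coe_add, Pi.add_apply, add_mul]
        exact integral_add (integrable_of_continuous (hf.mul hh))
          (integrable_of_continuous (hg.mul hh))
      smul_left := fun f g r => by
        simp [mul_assoc, integral_const_mul]
      definite := fun f hf => by
        have hc := continuous_of_mem_SH f.2
        have h1 := (integral_eq_zero_iff_of_nonneg (fun y => mul_self_nonneg (f.1 y))
          (integrable_of_continuous (hc.mul hc))).mp hf
        have h2 := Continuous.ae_eq_iff_eq (surf n) (hc.mul hc) continuous_const |>.mp h1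
        ext y
        exact mul_self_eq_zero.mp (congrFun h2 y) }
  let _ : NormedAddCommGroup (SH n k) := c.toNormedAddCommGroup
  let _ : InnerProductSpace ℝ (SH n k) := InnerProductSpace.ofCore c.toCore
  let b := stdOrthonormalBasis ℝ (SH n k)
  refine ⟨_, fun l => (b l : Sph n → ℝ), ⟨fun l m => ?_, ?_⟩⟩
  · exact orthonormal_iff_ite.mp b.orthonormal l m
  · have h := b.toBasis.span_eq
    have h2 := congrArg (Submodule.map (SH n k).subtype) h
    rw [Submodule.map_span, ← range_comp] at h2
    simpa [Function.comp_def] using h2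

end FracSphere

end

open MeasureTheory Set

noncomputable section

namespace FracSphere

/-! ### Binomial series and Gegenbauer polynomials -/

/-! The proof is a subordination argument. With ν = (n-2)/2, completing the square gives λ_k =
(k+ν)² - ν², and p ↦ (p² - ν²)^(-σ) is the Laplace transform of an explicit density `subord ν σ`.
For real σ = s this density is a constant times t^(s-1/2) I_(s-1/2)(νt) (`integral_exp_mul_subord`,
`subord_ofReal`). On the other side, the Poisson kernel is the generating function of the zonal
harmonics, so e^(-νt) (P_(e^(-t))(τ) - 1/ω) is the sum over k ≥ 1 of zonal terms times e^(-(k+ν)t)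
(`hasSum_kerPoisson`). Integrating this expansion termwise against the density produces the
Dirichlet series when Re σ > (n-1)/2 (`hasSum_zetaTerm`). If τ < 1 the Poisson difference stays
bounded at t = 0 and decays exponentially, so the same integral is holomorphic on all of Re σ > 0
(`isMinakZeta_integral`). It is therefore the continuation, and its value at s is the integral
representation.

For the estimates, the density is at most a constant times t^(2s-1) e^(νt), and the Poisson
difference is controlled by e^(-t) plus t (t² + 1 - τ)^(-n/2) on (0, 1]. The resulting integral is
split at t = d = √(1 - τ), which is comparable to the geodesic distance. Beyond d the integrand is
at most t^(2s-n), and the sign of 2s - n + 1 decides between a power, a logarithm and a constant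
(`exists_abs_kernel_le_kernelBound`).

For the convolution, integrating over the sphere first tames the singularity: the L¹ norm of the
Poisson difference is O(e^(-t)) uniformly in x, so Fubini applies for every s > 0
(`integrable_prod_kerPoisson`). It remains to see that convolution with zonal harmonics is spectral
projection (`proj_eq_zonalProj`). Orthogonality of distinct degrees comes from a Laplacian built
from infinitesimal rotations, symmetric because the surface measure is rotation invariant. The
reproducing property comes from the Poisson kernel being an approximate identity. The same symmetry
gives rapid decay of the components of a smooth function (`summable_abs_zonalProj`), which justifies
the last termwise integration. -/

/-- The coefficient `(z)_m / m!` of the binomial series of `(1 - x) ^ (-z)`. -/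
def binomCoef (z : ℂ) (m : ℕ) : ℂ := (∏ i ∈ Finset.range m, (z + i)) / (m.factorial : ℂ)

theorem binomCoef_zero (z : ℂ) : binomCoef z 0 = 1 := by simp [binomCoef]

theorem binomCoef_succ (z : ℂ) (m : ℕ) :
    ((m : ℂ) + 1) * binomCoef z (m + 1) = (z + m) * binomCoef z m := by
  have h1 : ((m : ℂ) + 1) ≠ 0 := by exact_mod_cast m.succ_ne_zero
  have h2 : (m.factorial : ℂ) ≠ 0 := by exact_mod_cast m.factorial_ne_zero
  simp only [binomCoef, Finset.prod_range_succ, Nat.factorial_succ, Nat.cast_mul, Nat.cast_succ]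
  field_simp

theorem binomCoef_shift (z : ℂ) (m : ℕ) :
    ((m : ℂ) + 1) * binomCoef z (m + 1) = z * binomCoef (z + 1) m := by
  have h1 : ((m : ℂ) + 1) ≠ 0 := by exact_mod_cast m.succ_ne_zero
  have h2 : (m.factorial : ℂ) ≠ 0 := by exact_mod_cast m.factorial_ne_zero
  simp only [binomCoef, Finset.prod_range_succ', Nat.factorial_succ, Nat.cast_mul, Nat.cast_succ]
  have : ∀ i : ℕ, z + ((i : ℂ) + 1) = z + 1 + i := fun i => by ring
  simp only [this]
  field_simp
  simp [mul_comm]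

/-- Coefficient form of (1 - x) (1 - x)^(-(z+1)) = (1 - x)^(-z). -/
theorem binomCoef_pascal (z : ℂ) (m : ℕ) :
    binomCoef (z + 1) (m + 1) - binomCoef (z + 1) m = binomCoef z (m + 1) := by
  have h1 : ((m : ℂ) + 1) ≠ 0 := by exact_mod_cast m.succ_ne_zero
  apply mul_left_cancel₀ h1
  rw [mul_sub, binomCoef_succ, binomCoef_shift]
  ring

theorem binomCoef_eq_choose (z : ℂ) (m : ℕ) :
    binomCoef z m = Ring.choose (z + m - 1) m := by
  have h2 : (m.factorial : ℂ) ≠ 0 := by exact_mod_cast m.factorial_ne_zero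
  have h := Ring.factorial_nsmul_multichoose_eq_ascPochhammer z m
  have h3 : Ring.choose (z + m - 1) m = Ring.multichoose z m := by
    rw [Ring.choose]
    congr 1
    ring
  have h4 : ∀ m : ℕ, Polynomial.smeval (ascPochhammer ℕ m) z = ∏ i ∈ Finset.range m, (z + i) := by
    intro m
    induction m with
    | zero => simp
    | succ m ih =>
      rw [ascPochhammer_succ_right, Polynomial.smeval_mul, ih, Finset.prod_range_succ]
      simp [Polynomial.smeval_add, Polynomial.smeval_X, Polynomial.smeval_natCast]
  rw [h3, binomCoef, ← h4, ← h, nsmul_eq_mul]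
  field_simp

theorem hasSum_binomCoef (z : ℂ) {x : ℂ} (hx : ‖x‖ < 1) :
    HasSum (fun m => binomCoef z m * x ^ m) ((1 - x) ^ (-z)) := by
  have h := (Complex.one_div_one_sub_cpow_hasFPowerSeriesOnBall_zero z).hasSum (y := x)
    (by simpa [enorm_eq_nnnorm] using (by exact_mod_cast hx : ‖x‖₊ < 1))
  simp only [FormalMultilinearSeries.ofScalars_apply_eq, zero_add, ← binomCoef_eq_choose,
    smul_eq_mul] at h
  rwa [Complex.cpow_neg, ← one_div]

/-- Since |z + i| ≤ |z| + i, the series with parameter |z|, whose coefficients are nonnegative, is a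
majorant; absolute convergence is read off from it. -/
theorem norm_binomCoef_le (z : ℂ) (m : ℕ) : ‖binomCoef z m‖ ≤ ‖binomCoef ((‖z‖ : ℝ) : ℂ) m‖ := by
  simp only [binomCoef, norm_div, norm_prod]
  gcongr with i
  have : ‖((‖z‖ : ℝ) : ℂ) + i‖ = ‖z‖ + i := by
    rw [← Complex.ofReal_natCast, ← Complex.ofReal_add, Complex.norm_real,
      Real.norm_of_nonneg (by positivity)]
  rw [this]
  exact (norm_add_le _ _).trans (by simp)

theorem norm_binomCoef_ofReal {z : ℝ} (hz : 0 ≤ z) (m : ℕ) :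
    ((‖binomCoef z m‖ : ℝ) : ℂ) = binomCoef z m := by
  have : binomCoef z m = ((∏ i ∈ Finset.range m, (z + i)) / (m.factorial : ℝ) : ℝ) := by
    simp [binomCoef]
  rw [this, Complex.norm_real, Real.norm_of_nonneg (by positivity)]

theorem summable_norm_binomCoef (z : ℂ) {x : ℂ} (hx : ‖x‖ < 1) :
    Summable (fun m => ‖binomCoef z m * x ^ m‖) := by
  have h := (hasSum_binomCoef ((‖z‖ : ℝ) : ℂ) (x := ((‖x‖ : ℝ) : ℂ)) (by simpa using hx)).summable
  have h' : Summable (fun m => ‖binomCoef ((‖z‖ : ℝ) : ℂ) m‖ * ‖x‖ ^ m) := by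
    rw [← Complex.summable_ofReal]
    refine h.congr fun m => ?_
    push_cast
    rw [norm_binomCoef_ofReal (norm_nonneg z)]
  refine Summable.of_nonneg_of_le (fun _ => norm_nonneg _) (fun m => ?_) h'
  rw [norm_mul, norm_pow]
  gcongr
  exact norm_binomCoef_le z m

/-! ### Formal binomial series and the Gegenbauer generating series -/

open PowerSeries in
/-- The power series of `(1 - a X) ^ (-z)`. -/
def binomPS (z a : ℂ) : PowerSeries ℂ := PowerSeries.mk fun m => binomCoef z m * a ^ m

open PowerSeries in
theorem binomPS_deriv (z a : ℂ) :
    d⁄dX ℂ (binomPS z a) = C (z * a) * binomPS (z + 1) a := by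
  ext m
  simp only [binomPS, coeff_derivative, coeff_mk, coeff_C_mul]
  linear_combination (a ^ (m + 1)) * binomCoef_shift z m

open PowerSeries in
theorem binomPS_succ (z a : ℂ) :
    binomPS z a = binomPS (z + 1) a - C a * (X * binomPS (z + 1) a) := by
  ext m
  cases m with
  | zero => simp [binomPS, binomCoef_zero]
  | succ m =>
    simp only [binomPS, map_sub, coeff_C_mul, coeff_succ_X_mul, coeff_mk]
    linear_combination -(a ^ (m + 1)) * binomCoef_pascal z m

/-- The generating series of the Gegenbauer polynomials at `cos θ`, for `a = exp (i θ)`. -/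
def gegPS (z a : ℂ) : PowerSeries ℂ := binomPS z a * binomPS z a⁻¹

-- Raising the exponent by one costs the factor (1 - aX)(1 - a⁻¹X) = 1 - (a + a⁻¹)X + X².
open PowerSeries in
theorem gegPS_succ (z : ℂ) {a : ℂ} (ha : a ≠ 0) :
    gegPS z a = gegPS (z + 1) a - C (a + a⁻¹) * (X * gegPS (z + 1) a)
      + X * (X * gegPS (z + 1) a) := by
  have h : (C a : PowerSeries ℂ) * C a⁻¹ = 1 := by rw [← map_mul, mul_inv_cancel₀ ha, map_one]
  rw [gegPS, binomPS_succ, binomPS_succ z a⁻¹, gegPS, map_add]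
  linear_combination X * X * binomPS (z + 1) a * binomPS (z + 1) a⁻¹ * h

open PowerSeries in
theorem gegPS_deriv (z : ℂ) {a : ℂ} (ha : a ≠ 0) :
    d⁄dX ℂ (gegPS z a) = C (z * (a + a⁻¹)) * gegPS (z + 1) a
      - C (2 * z) * (X * gegPS (z + 1) a) := by
  have h : (C a : PowerSeries ℂ) * C a⁻¹ = 1 := by rw [← map_mul, mul_inv_cancel₀ ha, map_one]
  have h2 : (C 2 : PowerSeries ℂ) = 2 := map_ofNat C 2
  rw [gegPS, Derivation.leibniz, smul_eq_mul, smul_eq_mul, binomPS_deriv, binomPS_deriv,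
    binomPS_succ z a, binomPS_succ z a⁻¹, gegPS]
  simp only [map_mul, map_add, h2]
  linear_combination -2 * C z * X * binomPS (z + 1) a * binomPS (z + 1) a⁻¹ * h

open PowerSeries in
theorem gegPS_coeff_zero (z a : ℂ) : PowerSeries.coeff 0 (gegPS z a) = 1 := by
  simp [gegPS, binomPS, binomCoef_zero]

open PowerSeries in
theorem gegPS_coeff_one (z a : ℂ) : PowerSeries.coeff 1 (gegPS z a) = z * (a + a⁻¹) := by
  have h := binomCoef_succ z 0
  simp only [binomCoef_zero, Nat.cast_zero, zero_add, one_mul, add_zero, mul_one] at h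
  simp [gegPS, binomPS, coeff_mul, Finset.Nat.antidiagonal_succ, binomCoef_zero, h]
  ring

-- The series G satisfies (1 - (a + a⁻¹)X + X²) G' = z((a + a⁻¹) - 2X) G; the recurrence is the
-- coefficient of X^(k+1).
open PowerSeries in
theorem gegPS_rec (z : ℂ) {a : ℂ} (ha : a ≠ 0) (k : ℕ) :
    ((k : ℂ) + 2) * PowerSeries.coeff (k + 2) (gegPS z a) =
      (a + a⁻¹) * ((k : ℂ) + 1 + z) * PowerSeries.coeff (k + 1) (gegPS z a)
      - ((k : ℂ) + 2 * z) * PowerSeries.coeff k (gegPS z a) := by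
  have h : d⁄dX ℂ (gegPS z a) - C (a + a⁻¹) * (X * d⁄dX ℂ (gegPS z a))
      + X * (X * d⁄dX ℂ (gegPS z a)) = C (z * (a + a⁻¹)) * gegPS z a
        - C (2 * z) * (X * gegPS z a) := by
    rw [gegPS_deriv z ha, gegPS_succ z ha]
    simp only [map_mul]
    ring
  have h2 := congrArg (PowerSeries.coeff (k + 1)) h
  rw [map_add, map_sub, map_sub] at h2
  simp only [coeff_C_mul, coeff_succ_X_mul, coeff_derivative] at h2
  have h3 : PowerSeries.coeff k (X * d⁄dX ℂ (gegPS z a)) = k * PowerSeries.coeff k (gegPS z a) := by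
    cases k with
    | zero => simp
    | succ k => 
      rw [coeff_succ_X_mul, coeff_derivative]
      push_cast
      ring
  rw [h3] at h2
  push_cast at h2
  linear_combination h2

/-! ### Gegenbauer polynomials on [-1, 1] and their growth -/

/-- The point of the unit circle with real part `τ`. -/
def circ (τ : ℝ) : ℂ := ⟨τ, √(1 - τ ^ 2)⟩

theorem norm_circ {τ : ℝ} (hτ : τ ∈ Icc (-1 : ℝ) 1) : ‖circ τ‖ = 1 := by
  have : 0 ≤ 1 - τ ^ 2 := by nlinarith [hτ.1, hτ.2]
  rw [← sq_eq_sq₀ (norm_nonneg _) zero_le_one, Complex.sq_norm, Complex.normSq_apply, circ]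
  simp only
  rw [Real.mul_self_sqrt this]
  ring

theorem circ_ne_zero {τ : ℝ} (hτ : τ ∈ Icc (-1 : ℝ) 1) : circ τ ≠ 0 := by
  rw [← norm_ne_zero_iff, norm_circ hτ]
  exact one_ne_zero

theorem inv_circ {τ : ℝ} (hτ : τ ∈ Icc (-1 : ℝ) 1) :
    (circ τ)⁻¹ = (starRingEnd ℂ) (circ τ) := Complex.inv_eq_conj (norm_circ hτ)

theorem circ_add_inv {τ : ℝ} (hτ : τ ∈ Icc (-1 : ℝ) 1) :
    circ τ + (circ τ)⁻¹ = 2 * τ := by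
  rw [inv_circ hτ, Complex.add_conj]
  simp [circ]

open PowerSeries in
theorem gegPS_coeff {ν τ : ℝ} (hτ : τ ∈ Icc (-1 : ℝ) 1) (k : ℕ) :
    PowerSeries.coeff k (gegPS ν (circ τ)) = (gegenbauer ν τ k : ℝ) := by
  induction k using Nat.twoStepInduction with
  | zero => simp [gegPS_coeff_zero, gegenbauer]
  | one => 
    rw [gegPS_coeff_one, circ_add_inv hτ, gegenbauer]
    push_cast
    ring
  | more k ih1 ih2 =>
    have hk : ((k : ℂ) + 2) ≠ 0 := by exact_mod_cast (by omega : k + 2 ≠ 0)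
    have h := gegPS_rec (ν : ℂ) (circ_ne_zero hτ) k
    rw [ih1, ih2, circ_add_inv hτ] at h
    rw [gegenbauer]
    push_cast
    rw [eq_div_iff hk]
    linear_combination h

/-- The zonal coefficient `(k + ν) / ν * C_k^ν(τ)`. -/
def zonal (ν τ : ℝ) (k : ℕ) : ℝ := (k + ν) / ν * gegenbauer ν τ k

-- The factor k + ν is the action of ν + X d/dX on the generating series G_ν, and νG_ν + X G_ν' =
-- ν(1 - X²) G_(ν+1). This is the algebra that turns the Gegenbauer generating function into the
-- Poisson kernel.
open PowerSeries in
theorem zonal_eq_coeff {ν τ : ℝ} (hν : ν ≠ 0) (hτ : τ ∈ Icc (-1 : ℝ) 1) (k : ℕ) :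
    (zonal ν τ k : ℂ) = PowerSeries.coeff k ((1 - X * X) * gegPS ((ν + 1 : ℝ) : ℂ) (circ τ)) := by
  have hν' : (ν : ℂ) ≠ 0 := by exact_mod_cast hν
  have h : C (ν : ℂ) * gegPS ν (circ τ) + X * d⁄dX ℂ (gegPS (ν : ℂ) (circ τ))
      = C (ν : ℂ) * ((1 - X * X) * gegPS ((ν : ℂ) + 1) (circ τ)) := by
    have h2 : (C 2 : PowerSeries ℂ) = 2 := map_ofNat C 2
    rw [gegPS_deriv _ (circ_ne_zero hτ), gegPS_succ _ (circ_ne_zero hτ)]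
    simp only [map_mul, h2]
    ring
  have h3 : PowerSeries.coeff k (X * d⁄dX ℂ (gegPS (ν : ℂ) (circ τ))) =
      k * PowerSeries.coeff k (gegPS (ν : ℂ) (circ τ)) := by
    cases k with
    | zero => simp
    | succ k => 
      rw [coeff_succ_X_mul, coeff_derivative]
      push_cast
      ring
  have h2 := congrArg (PowerSeries.coeff k) h
  rw [map_add, coeff_C_mul, coeff_C_mul, h3, gegPS_coeff hτ] at h2
  push_cast
  apply mul_left_cancel₀ hν'
  rw [← h2, zonal]
  push_cast
  field_simp
  ring

theorem gegenbauer_one_succ (ν : ℝ) (k : ℕ) :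
    ((k : ℝ) + 1) * gegenbauer ν 1 (k + 1) = (k + 2 * ν) * gegenbauer ν 1 k := by
  induction k with
  | zero => simp [gegenbauer]
  | succ k ih =>
    have hk : ((k : ℝ) + 2) ≠ 0 := by positivity
    rw [gegenbauer]
    push_cast
    field_simp
    linear_combination (k + 1 + 1 : ℝ) * ih

theorem gegenbauer_one_pos {ν : ℝ} (hν : 0 < ν) (k : ℕ) : 0 < gegenbauer ν 1 k := by
  induction k with
  | zero => simp [gegenbauer]
  | succ k ih =>
    have h := gegenbauer_one_succ ν k
    have h2 : 0 < (k + 2 * ν) * gegenbauer ν 1 k := by positivity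
    rw [← h] at h2
    exact pos_of_mul_pos_right h2 (by positivity)

theorem circ_one : circ 1 = 1 := by
  apply Complex.ext <;> simp [circ]

-- At τ = cos θ the polynomial is a combination of powers e^(i(p-q)θ) with p + q = k and nonnegative
-- coefficients, so its modulus is largest at θ = 0.
open PowerSeries in
theorem abs_gegenbauer_le {ν τ : ℝ} (hν : 0 < ν) (hτ : τ ∈ Icc (-1 : ℝ) 1) (k : ℕ) :
    |gegenbauer ν τ k| ≤ gegenbauer ν 1 k := by
  have h1 : (1 : ℝ) ∈ Icc (-1 : ℝ) 1 := by norm_num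
  have e1 := gegPS_coeff (ν := ν) hτ k
  have e2 := gegPS_coeff (ν := ν) h1 k
  rw [gegPS, coeff_mul] at e1 e2
  simp only [binomPS, coeff_mk, circ_one, inv_one, one_pow, mul_one] at e1 e2
  have e3 : ((∑ p ∈ Finset.HasAntidiagonal.antidiagonal k,
      ‖binomCoef ν p.1‖ * ‖binomCoef ν p.2‖ : ℝ) : ℂ) =
      (gegenbauer ν 1 k : ℝ) := by
    rw [← e2]
    push_cast
    exact Finset.sum_congr rfl fun p _ => by
      rw [norm_binomCoef_ofReal hν.le, norm_binomCoef_ofReal hν.le]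
  rw [← Complex.ofReal_inj.mp e3, ← Real.norm_eq_abs, ← Complex.norm_real, ← e1]
  refine (norm_sum_le _ _).trans (Finset.sum_le_sum fun p _ => ?_)
  simp [norm_circ hτ]

theorem hasSum_gegenbauer {ν τ r : ℝ} (hτ : τ ∈ Icc (-1 : ℝ) 1) (hr : r ∈ Ico (0 : ℝ) 1) :
    HasSum (fun k => gegenbauer ν τ k * r ^ k) ((1 - 2 * r * τ + r ^ 2) ^ (-ν)) ∧
      Summable fun k => |gegenbauer ν τ k * r ^ k| := by
  have hn1 : ‖circ τ * r‖ < 1 := by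
    rw [norm_mul, norm_circ hτ, one_mul, Complex.norm_real, Real.norm_of_nonneg hr.1]
    exact hr.2
  have hn2 : ‖(circ τ)⁻¹ * r‖ < 1 := by
    rw [norm_mul, norm_inv, norm_circ hτ, inv_one, one_mul, Complex.norm_real,
      Real.norm_of_nonneg hr.1]
    exact hr.2
  have s1 := summable_norm_binomCoef (ν : ℂ) hn1
  have s2 := summable_norm_binomCoef (ν : ℂ) hn2
  have s3 := summable_norm_sum_mul_antidiagonal_of_summable_norm s1 s2
  have e : ∀ k, ∑ kl ∈ Finset.HasAntidiagonal.antidiagonal k, binomCoef ν kl.1 * (circ τ * r) ^ kl.1 *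
      (binomCoef ν kl.2 * ((circ τ)⁻¹ * r) ^ kl.2) = ((gegenbauer ν τ k * r ^ k : ℝ) : ℂ) := by
    intro k
    rw [Complex.ofReal_mul, ← gegPS_coeff hτ, gegPS, PowerSeries.coeff_mul, Finset.sum_mul]
    refine Finset.sum_congr rfl fun p hp => ?_
    rw [← Finset.HasAntidiagonal.mem_antidiagonal.mp hp]
    simp only [binomPS, PowerSeries.coeff_mk]
    push_cast
    ring
  simp only [e] at s3
  have h3 := tsum_mul_tsum_eq_tsum_sum_antidiagonal_of_summable_norm s1 s2
  simp only [e] at h3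
  -- The two factors (1 - ar)^(-ν) and (1 - a⁻¹r)^(-ν) are complex conjugates, so the product is |1
  -- - ar|^(-2ν). The real part of 1 - ar is positive, which keeps the power away from the branch
  -- cut.
  rw [(hasSum_binomCoef (ν : ℂ) hn1).tsum_eq, (hasSum_binomCoef (ν : ℂ) hn2).tsum_eq] at h3
  have hw : (1 : ℂ) - (circ τ)⁻¹ * r = (starRingEnd ℂ) (1 - circ τ * r) := by
    simp [inv_circ hτ]
  have hre : 0 < (1 - circ τ * r).re := by
    have := (Complex.abs_re_le_norm (circ τ * r)).trans_lt hn1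
    rw [Complex.sub_re, Complex.one_re]
    linarith [(abs_lt.mp this).2]
  have harg : (1 - circ τ * r).arg ≠ Real.pi := by
    intro h
    rw [Complex.arg_eq_pi_iff] at h
    linarith [h.1]
  have hne : (1 - circ τ * r) ≠ 0 := by
    intro h
    simp [h] at hre
  have hsq : ‖1 - circ τ * r‖ ^ 2 = 1 - 2 * r * τ + r ^ 2 := by
    have h0 : 0 ≤ 1 - τ ^ 2 := by nlinarith [hτ.1, hτ.2]
    rw [Complex.sq_norm, Complex.normSq_apply]
    simp only [circ, Complex.sub_re, Complex.sub_im, Complex.mul_re, Complex.mul_im,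
      Complex.one_re, Complex.one_im, Complex.ofReal_re, Complex.ofReal_im]
    linear_combination r ^ 2 * Real.sq_sqrt h0
  have hv : (1 - circ τ * r) ^ (-(ν : ℂ)) * (1 - (circ τ)⁻¹ * r) ^ (-(ν : ℂ)) =
      (((1 - 2 * r * τ + r ^ 2) ^ (-ν) : ℝ) : ℂ) := by
    rw [hw, Complex.conj_cpow _ _ harg, ← Complex.ofReal_neg, Complex.conj_ofReal, Complex.mul_conj,
      Complex.normSq_eq_norm_sq, Complex.norm_cpow_real, ← hsq, ← Real.rpow_mul_natCast
      (norm_nonneg _), ← Real.rpow_natCast, ← Real.rpow_mul (norm_nonneg _), mul_comm (-ν)]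
  rw [hv] at h3
  have s4 : Summable fun k => |gegenbauer ν τ k * r ^ k| := by
    refine s3.congr fun k => ?_
    rw [Complex.norm_real, Real.norm_eq_abs]
  refine ⟨?_, s4⟩
  rw [← Complex.hasSum_ofReal, h3]
  exact s3.of_norm.hasSum

/-- The zonal coefficient is C_k^(ν+1) - C_(k-2)^(ν+1), so the sum is (1 - r²) times the generating
function with parameter ν + 1. Degrees 0 and 1 have no second term and are separated off. -/
theorem hasSum_zonal {ν τ r : ℝ} (hν : ν ≠ 0) (hτ : τ ∈ Icc (-1 : ℝ) 1) (hr : r ∈ Ico (0 : ℝ) 1) :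
    HasSum (fun k => zonal ν τ k * r ^ k)
      ((1 - r ^ 2) * (1 - 2 * r * τ + r ^ 2) ^ (-(ν + 1))) := by
  obtain ⟨h, -⟩ := hasSum_gegenbauer (ν := ν + 1) hτ hr
  have e0 : zonal ν τ 0 = gegenbauer (ν + 1) τ 0 := by
    have h := zonal_eq_coeff hν hτ 0
    rw [sub_mul, map_sub, one_mul, gegPS_coeff hτ] at h
    rw [mul_assoc, PowerSeries.coeff_zero_X_mul, sub_zero] at h
    exact_mod_cast h
  have e1 : zonal ν τ 1 = gegenbauer (ν + 1) τ 1 := by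
    have h := zonal_eq_coeff hν hτ 1
    rw [sub_mul, map_sub, one_mul, gegPS_coeff hτ, mul_assoc, PowerSeries.coeff_succ_X_mul] at h
    rw [PowerSeries.coeff_zero_X_mul, sub_zero] at h
    exact_mod_cast h
  have e2 : ∀ k, zonal ν τ (k + 2) = gegenbauer (ν + 1) τ (k + 2) - gegenbauer (ν + 1) τ k := by
    intro k
    have h := zonal_eq_coeff hν hτ (k + 2)
    rw [sub_mul, map_sub, one_mul, gegPS_coeff hτ, mul_assoc, PowerSeries.coeff_succ_X_mul,
      PowerSeries.coeff_succ_X_mul, gegPS_coeff hτ] at h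
    exact_mod_cast h
  have h2 := (hasSum_nat_add_iff' 2).mpr h
  have h3 := h2.sub (h.mul_left (r ^ 2))
  rw [← hasSum_nat_add_iff' 2]
  convert h3 using 1
  · ext k
    rw [e2, pow_add]
    ring
  · simp only [Finset.sum_range_succ, Finset.sum_range_zero, e0, e1]
    ring

/-- With 2ν = m + 1, the ratio of consecutive values at 1 is 1 + m/(k+1), which by Bernoulli is at
most ((k+2)/(k+1))^m. -/
theorem gegenbauer_one_le {m : ℕ} (k : ℕ) :
    gegenbauer (((m : ℝ) + 1) / 2) 1 k ≤ ((k : ℝ) + 1) ^ m := by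
  induction k with
  | zero => simp [gegenbauer]
  | succ k ih =>
    have h := gegenbauer_one_succ (((m : ℝ) + 1) / 2) k
    have hk : (0 : ℝ) < k + 1 := by positivity
    have hb := one_add_mul_le_pow (a := 1 / ((k : ℝ) + 1)) (by
      have : 0 < 1 / ((k : ℝ) + 1) := by positivity
      linarith) m
    rw [← mul_le_mul_iff_right₀ hk, h]
    have e : ((k : ℝ) + 2 * (((m : ℝ) + 1) / 2)) = (k + 1) * (1 + m * (1 / ((k : ℝ) + 1))) := by
      field_simp
      ring
    have e2 : (((k + 1 : ℕ) : ℝ) + 1) ^ m = (1 + 1 / ((k : ℝ) + 1)) ^ m * ((k : ℝ) + 1) ^ m := by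
      rw [← mul_pow]
      push_cast
      congr 1
      field_simp
    have h0 := (gegenbauer_one_pos (show 0 < ((m : ℝ) + 1) / 2 by positivity) k).le
    rw [e, e2, mul_assoc]
    gcongr

theorem abs_zonal_le {n : ℕ} (hn : 3 ≤ n) {τ : ℝ} (hτ : τ ∈ Icc (-1 : ℝ) 1) (k : ℕ) :
    |zonal (nu n) τ k| ≤ 2 * ((k : ℝ) + 1) ^ (n - 2) := by
  obtain ⟨m, rfl⟩ : ∃ m, n = m + 3 := ⟨n - 3, by omega⟩
  have hν : nu (m + 3) = ((m : ℝ) + 1) / 2 := by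
    rw [nu]
    push_cast
    ring
  have hν2 : (1 : ℝ) / 2 ≤ ((m : ℝ) + 1) / 2 := by
    have : (0 : ℝ) ≤ m := by positivity
    linarith
  rw [hν, zonal, abs_mul, show m + 3 - 2 = m + 1 by omega, pow_succ']
  set ν := ((m : ℝ) + 1) / 2 with hνd
  have h1 : |gegenbauer ν τ k| ≤ ((k : ℝ) + 1) ^ m :=
    (abs_gegenbauer_le (by linarith) hτ k).trans (gegenbauer_one_le k)
  have h2 : |((k : ℝ) + ν) / ν| ≤ 2 * ((k : ℝ) + 1) := by
    rw [abs_of_nonneg (by positivity), div_le_iff₀ (by linarith)]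
    have : (0 : ℝ) ≤ k := by positivity
    nlinarith
  calc _ ≤ (2 * ((k : ℝ) + 1)) * ((k : ℝ) + 1) ^ m := by gcongr
    _ = _ := by ring

theorem zonal_zero {ν : ℝ} (hν : ν ≠ 0) (τ : ℝ) : zonal ν τ 0 = 1 := by
  simp [zonal, gegenbauer, hν]

theorem zonal_one_nonneg {ν : ℝ} (hν : 0 < ν) (k : ℕ) : 0 ≤ zonal ν 1 k := by
  have := gegenbauer_one_pos hν k
  unfold zonal
  positivity

theorem abs_zonal_le_one {ν τ : ℝ} (hν : 0 < ν) (hτ : τ ∈ Icc (-1 : ℝ) 1) (k : ℕ) :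
    |zonal ν τ k| ≤ zonal ν 1 k := by
  unfold zonal
  rw [abs_mul, abs_of_nonneg (by positivity)]
  gcongr
  exact abs_gegenbauer_le hν hτ k

/-! ### The subordination density -/

theorem integrableOn_rpow_mul_exp {a r : ℝ} (ha : 0 < a) (hr : 0 < r) :
    IntegrableOn (fun t : ℝ => t ^ (a - 1) * Real.exp (-(r * t))) (Ioi 0) := by
  have := integrableOn_rpow_mul_exp_neg_mul_rpow (p := 1) (s := a - 1) (by linarith) one_pos hr
  simpa using this

/-- The case σ = 0 of the product in `besselCoef`. It identifies the extremal Bessel-type series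
with that of cosh. -/
theorem two_mul_factorial_eq (m : ℕ) :
    ((2 * m).factorial : ℝ) = 4 ^ m * (m.factorial * ∏ i ∈ Finset.range m, (1 / 2 + (i : ℝ))) := by
  induction m with
  | zero => simp
  | succ m ih =>
    rw [show 2 * (m + 1) = 2 * m + 1 + 1 by ring, Nat.factorial_succ, Nat.factorial_succ,
      Nat.cast_mul, Nat.cast_mul, ih, Finset.prod_range_succ, Nat.factorial_succ]
    push_cast
    ring

/-- The coefficients of the power series of the modified Bessel functions. -/
def besselCoef (σ : ℂ) (m : ℕ) : ℂ :=
  ((m.factorial : ℂ) * ∏ i ∈ Finset.range m, (σ + 1 / 2 + i))⁻¹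

theorem half_add_ne_zero {σ : ℂ} (hσ : 0 < σ.re) (i : ℕ) : σ + 1 / 2 + (i : ℂ) ≠ 0 := by
  intro h
  have := congrArg Complex.re h
  simp at this
  have h2 : (0 : ℝ) ≤ i := i.cast_nonneg
  linarith

/-- Each factor satisfies |σ + 1/2 + i| ≥ 1/2 + i when Re σ > 0. Hence the density is dominated by a
cosh series, uniformly in Im σ apart from the Gamma prefactor. -/
theorem norm_besselCoef_le {σ : ℂ} (hσ : 0 < σ.re) (m : ℕ) :
    ‖besselCoef σ m‖ ≤ 4 ^ m / ((2 * m).factorial : ℝ) := by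
  have hP : 0 < ∏ i ∈ Finset.range m, (1 / 2 + (i : ℝ)) := Finset.prod_pos fun i _ => by positivity
  have hm : (0 : ℝ) < m.factorial := by exact_mod_cast m.factorial_pos
  rw [two_mul_factorial_eq, besselCoef, norm_inv, norm_mul, norm_prod, Complex.norm_natCast,
    div_mul_eq_div_div, div_self (by positivity), one_div (_ * _)]
  refine inv_anti₀ (by positivity) ?_
  refine mul_le_mul_of_nonneg_left (Finset.prod_le_prod (fun i _ => by positivity)
    fun i _ => le_trans ?_ (Complex.re_le_norm _)) hm.le
  simp
  linarith

theorem differentiableOn_besselCoef (m : ℕ) :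
    DifferentiableOn ℂ (fun σ => besselCoef σ m) {σ : ℂ | 0 < σ.re} := by
  intro σ hσ
  apply DifferentiableAt.differentiableWithinAt
  unfold besselCoef
  have : DifferentiableAt ℂ (fun σ : ℂ => ∏ i ∈ Finset.range m, (σ + 1 / 2 + (i : ℂ))) σ := by
    apply DifferentiableAt.fun_finsetProd
    intro i _
    fun_prop
  refine (this.const_mul _).inv ?_
  refine mul_ne_zero (by exact_mod_cast m.factorial_ne_zero) ?_
  exact Finset.prod_ne_zero_iff.mpr fun i _ => half_add_ne_zero hσ i

theorem Gamma_add_natCast {z : ℂ} (hz : 0 < z.re) (m : ℕ) :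
    Complex.Gamma (z + m) = (∏ i ∈ Finset.range m, (z + i)) * Complex.Gamma z := by
  induction m with
  | zero => simp
  | succ m ih =>
    have h : z + (m : ℂ) ≠ 0 := by
      intro h
      have := congrArg Complex.re h
      simp at this
      have h2 : (0 : ℝ) ≤ m := m.cast_nonneg
      linarith
    rw [Nat.cast_succ, ← add_assoc, Complex.Gamma_add_one _ h, ih, Finset.prod_range_succ]
    ring

theorem prod_range_two_mul (z : ℂ) (m : ℕ) :
    ∏ i ∈ Finset.range (2 * m), (2 * z + i) =
      4 ^ m * (∏ i ∈ Finset.range m, (z + i)) * ∏ i ∈ Finset.range m, (z + 1 / 2 + i) := by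
  induction m with
  | zero => simp
  | succ m ih =>
    rw [show 2 * (m + 1) = 2 * m + 1 + 1 by ring, Finset.prod_range_succ, Finset.prod_range_succ, ih,
      Finset.prod_range_succ, Finset.prod_range_succ]
    push_cast
    ring

/-- The duplication (2σ)_(2m) = 4^m (σ)_m (σ + 1/2)_m cancels the Bessel denominator and leaves a
binomial coefficient. This is why the Laplace transform of the density is a binomial series. -/
theorem Gamma_mul_besselCoef {σ : ℂ} (hσ : 0 < σ.re) (m : ℕ) :
    Complex.Gamma (2 * σ + (2 * m : ℕ)) * besselCoef σ m =
      Complex.Gamma (2 * σ) * (4 ^ m * binomCoef σ m) := by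
  have h1 : ∏ i ∈ Finset.range m, (σ + 1 / 2 + (i : ℂ)) ≠ 0 :=
    Finset.prod_ne_zero_iff.mpr fun i _ => half_add_ne_zero hσ i
  have h2 : (m.factorial : ℂ) ≠ 0 := by exact_mod_cast m.factorial_ne_zero
  rw [Gamma_add_natCast (by simpa using hσ), prod_range_two_mul, besselCoef, binomCoef]
  generalize ∏ i ∈ Finset.range m, (σ + 1 / 2 + (i : ℂ)) = q at h1 ⊢
  field_simp

/-- The `m`-th term of the series of `Gamma (2 * σ) * subord ν σ t`. -/
def subordTerm (ν : ℝ) (σ : ℂ) (m : ℕ) (t : ℝ) : ℂ :=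
  (t : ℂ) ^ (2 * σ - 1) * (besselCoef σ m * ((ν * t / 2 : ℝ) : ℂ) ^ (2 * m))

/-- The density whose Laplace transform at `p > ν` is `(p ^ 2 - ν ^ 2) ^ (-σ)`. -/
def subord (ν : ℝ) (σ : ℂ) (t : ℝ) : ℂ :=
  (Complex.Gamma (2 * σ))⁻¹ * ∑' m, subordTerm ν σ m t

theorem norm_subordTerm_le {ν : ℝ} {σ : ℂ} (hσ : 0 < σ.re) (m : ℕ) {t : ℝ} (ht : 0 < t) :
    ‖subordTerm ν σ m t‖ ≤ t ^ (2 * σ.re - 1) * ((ν * t) ^ (2 * m) / ((2 * m).factorial : ℝ)) := by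
  rw [subordTerm, norm_mul, norm_mul, Complex.norm_cpow_eq_rpow_re_of_pos ht, norm_pow,
    Complex.norm_real]
  have e : (2 * σ - 1).re = 2 * σ.re - 1 := by simp
  have h0 : (0 : ℝ) < (2 * m).factorial := by exact_mod_cast (2 * m).factorial_pos
  rw [e]
  gcongr
  calc _ ≤ 4 ^ m / ((2 * m).factorial : ℝ) * ‖ν * t / 2‖ ^ (2 * m) := by
        gcongr
        exact norm_besselCoef_le hσ m
    _ = _ := by
        rw [pow_mul, Real.norm_eq_abs, sq_abs, pow_mul, div_mul_eq_mul_div, ← mul_pow]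
        congr 2
        ring

theorem summable_subordTerm {ν : ℝ} {σ : ℂ} (hσ : 0 < σ.re) {t : ℝ} (ht : 0 < t) :
    Summable fun m => subordTerm ν σ m t :=
  Summable.of_norm_bounded ((Real.hasSum_cosh (ν * t)).summable.mul_left _)
    fun m => norm_subordTerm_le hσ m ht

theorem measurable_subordTerm (ν : ℝ) (σ : ℂ) (m : ℕ) : Measurable (subordTerm ν σ m) := by
  unfold subordTerm
  fun_prop

theorem measurable_subord (ν : ℝ) (σ : ℂ) : Measurable (subord ν σ) :=
  (Measurable.tsum fun m => measurable_subordTerm ν σ m).const_mul _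

theorem cosh_le_exp {x : ℝ} (hx : 0 ≤ x) : Real.cosh x ≤ Real.exp x := by
  rw [Real.cosh_eq]
  have : Real.exp (-x) ≤ Real.exp x := Real.exp_le_exp.mpr (by linarith)
  linarith

theorem norm_subord_le {ν : ℝ} (hν : 0 ≤ ν) {σ : ℂ} (hσ : 0 < σ.re) {t : ℝ} (ht : 0 < t) :
    ‖subord ν σ t‖ ≤ ‖Complex.Gamma (2 * σ)‖⁻¹ * (t ^ (2 * σ.re - 1) * Real.exp (ν * t)) := by
  rw [subord, norm_mul, norm_inv]
  gcongr
  have h := (Real.hasSum_cosh (ν * t)).mul_left (t ^ (2 * σ.re - 1))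
  refine (tsum_of_norm_bounded h fun m => norm_subordTerm_le hσ m ht).trans ?_
  gcongr
  exact cosh_le_exp (by positivity)

theorem Gamma_two_mul_ne_zero {σ : ℂ} (hσ : 0 < σ.re) : Complex.Gamma (2 * σ) ≠ 0 :=
  Complex.Gamma_ne_zero_of_re_pos (by simpa using hσ)

/-- Dominated convergence with the cosh series as majorant: only integrability of `f` against t^(2
Re σ - 1) e^(νt) is needed. It serves both the Laplace transform and holomorphy in σ. -/
theorem hasSum_integral_mul_subordTerm {ν : ℝ} (hν : 0 ≤ ν) {σ : ℂ} (hσ : 0 < σ.re) {f : ℝ → ℂ}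
    (hf : AEStronglyMeasurable f (volume.restrict (Ioi 0)))
    (hi : IntegrableOn (fun t => ‖f t‖ * (t ^ (2 * σ.re - 1) * Real.exp (ν * t))) (Ioi 0)) :
    HasSum (fun m => ∫ t in Ioi (0 : ℝ), f t * subordTerm ν σ m t)
      (Complex.Gamma (2 * σ) * ∫ t in Ioi (0 : ℝ), f t * subord ν σ t) := by
  rw [← integral_const_mul]
  have hc : ∀ t : ℝ, HasSum (fun m : ℕ => ‖f t‖ * (t ^ (2 * σ.re - 1) *
      ((ν * t) ^ (2 * m) / ((2 * m).factorial : ℝ))))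
      (‖f t‖ * (t ^ (2 * σ.re - 1) * Real.cosh (ν * t))) := fun t =>
    ((Real.hasSum_cosh (ν * t)).mul_left _).mul_left _
  refine hasSum_integral_of_dominated_convergence (fun m t => ‖f t‖ * (t ^ (2 * σ.re - 1) *
      ((ν * t) ^ (2 * m) / ((2 * m).factorial : ℝ)))) ?_ ?_ ?_ ?_ ?_
  · exact fun m => hf.mul (measurable_subordTerm ν σ m).aestronglyMeasurable
  · intro m
    filter_upwards [ae_restrict_mem measurableSet_Ioi] with t ht
    rw [norm_mul]
    gcongr
    exact norm_subordTerm_le hσ m ht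
  · exact Filter.Eventually.of_forall fun t => (hc t).summable
  · simp only [(hc _).tsum_eq]
    refine Integrable.mono' hi (hf.norm.mul (by fun_prop)) ?_
    filter_upwards [ae_restrict_mem measurableSet_Ioi] with t ht
    have ht' : (0 : ℝ) < t := ht
    rw [Real.norm_of_nonneg (by positivity)]
    gcongr
    exact cosh_le_exp (by positivity)
  · filter_upwards [ae_restrict_mem measurableSet_Ioi] with t ht
    have h := (summable_subordTerm (ν := ν) hσ ht).hasSum.mul_left (f t)
    have hG := Gamma_two_mul_ne_zero hσ
    have e : Complex.Gamma (2 * σ) * (f t * subord ν σ t) = f t * ∑' m, subordTerm ν σ m t := by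
      unfold subord
      field_simp
    change HasSum _ (Complex.Gamma (2 * σ) * (f t * subord ν σ t))
    rw [e]
    exact h

theorem integrableOn_mul_subord {ν : ℝ} (hν : 0 ≤ ν) {σ : ℂ} (hσ : 0 < σ.re) {f : ℝ → ℂ}
    (hf : AEStronglyMeasurable f (volume.restrict (Ioi 0)))
    (hi : IntegrableOn (fun t => ‖f t‖ * (t ^ (2 * σ.re - 1) * Real.exp (ν * t))) (Ioi 0)) :
    IntegrableOn (fun t => f t * subord ν σ t) (Ioi 0) := by
  refine Integrable.mono' (hi.const_mul ‖Complex.Gamma (2 * σ)‖⁻¹)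
    (hf.mul (measurable_subord ν σ).aestronglyMeasurable) ?_
  filter_upwards [ae_restrict_mem measurableSet_Ioi] with t ht
  rw [norm_mul, mul_left_comm]
  gcongr
  exact norm_subord_le hν hσ ht

theorem integrableOn_exp_mul_weight {ν p x : ℝ} (hp : ν < p) (hx : 0 < x) :
    IntegrableOn (fun t => ‖((Real.exp (-(p * t)) : ℝ) : ℂ)‖ *
      (t ^ (2 * x - 1) * Real.exp (ν * t))) (Ioi 0) := by
  refine (integrableOn_rpow_mul_exp (a := 2 * x) (r := p - ν) (by linarith) (by linarith)).congr_fun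
    (fun t _ => ?_) measurableSet_Ioi
  simp only [Complex.norm_real, Real.norm_eq_abs, Real.abs_exp]
  rw [mul_left_comm, ← Real.exp_add]
  congr 2
  ring

theorem integrableOn_exp_mul_subord {ν p : ℝ} (hν : 0 ≤ ν) (hp : ν < p) {σ : ℂ} (hσ : 0 < σ.re) :
    IntegrableOn (fun t => ((Real.exp (-(p * t)) : ℝ) : ℂ) * subord ν σ t) (Ioi 0) :=
  integrableOn_mul_subord hν hσ (Measurable.aestronglyMeasurable (by fun_prop))
    (integrableOn_exp_mul_weight hp hσ)

/-- Termwise, Euler's integral yields Γ(2σ + 2m) p^(-2σ-2m), and the sum is p^(-2σ) times the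
binomial series of (1 - ν²/p²)^(-σ). The condition p > ν gives both integrability and convergence of
that series. -/
theorem integral_exp_mul_subord {ν p : ℝ} (hν : 0 ≤ ν) (hp : ν < p) {σ : ℂ} (hσ : 0 < σ.re) :
    ∫ t in Ioi (0 : ℝ), ((Real.exp (-(p * t)) : ℝ) : ℂ) * subord ν σ t =
      ((p ^ 2 - ν ^ 2 : ℝ) : ℂ) ^ (-σ) := by
  have hp0 : 0 < p := by linarith
  have hpc : (p : ℂ) ≠ 0 := by exact_mod_cast hp0.ne'
  have h := hasSum_integral_mul_subordTerm hν hσ (f := fun t => ((Real.exp (-(p * t)) : ℝ) : ℂ))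
    (Measurable.aestronglyMeasurable (by fun_prop)) (integrableOn_exp_mul_weight hp hσ)
  have hx : ‖((ν ^ 2 / p ^ 2 : ℝ) : ℂ)‖ < 1 := by
    rw [Complex.norm_real, Real.norm_of_nonneg (by positivity), div_lt_one (by positivity)]
    gcongr
  have h2 := ((hasSum_binomCoef σ hx).mul_left ((p : ℂ) ^ (-(2 * σ)))).mul_left
    (Complex.Gamma (2 * σ))
  have e : ∀ m : ℕ, ∫ t in Ioi (0 : ℝ), ((Real.exp (-(p * t)) : ℝ) : ℂ) * subordTerm ν σ m t =
      Complex.Gamma (2 * σ) * ((p : ℂ) ^ (-(2 * σ)) *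
        (binomCoef σ m * ((ν ^ 2 / p ^ 2 : ℝ) : ℂ) ^ m)) := by
    intro m
    have hre : 0 < (2 * σ + (2 * m : ℕ)).re := by
      simp
      positivity
    have hI := Complex.integral_cpow_mul_exp_neg_mul_Ioi hre (r := p) (by simpa using hp0)
    have : ∀ t ∈ Ioi (0 : ℝ), ((Real.exp (-(p * t)) : ℝ) : ℂ) * subordTerm ν σ m t =
        (besselCoef σ m * ((ν / 2 : ℝ) : ℂ) ^ (2 * m)) *
          ((t : ℂ) ^ (2 * σ + (2 * m : ℕ) - 1) * Complex.exp (-(p * t))) := by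
      intro t ht
      have htc : (t : ℂ) ≠ 0 := by exact_mod_cast (ne_of_gt ht)
      rw [show 2 * σ + ((2 * m : ℕ) : ℂ) - 1 = (2 * σ - 1) + ((2 * m : ℕ) : ℂ) by ring,
        Complex.cpow_add _ _ htc, Complex.cpow_natCast, subordTerm,
        show ν * t / 2 = ν / 2 * t by ring, Complex.ofReal_mul (ν / 2) t, mul_pow]
      push_cast
      ring
    rw [setIntegral_congr_fun measurableSet_Ioi this, integral_const_mul, hI]
    have hG := Gamma_mul_besselCoef hσ m
    have hpow : (1 / (p : ℂ)) ^ (2 * σ + (2 * m : ℕ)) =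
        (p : ℂ) ^ (-(2 * σ)) * ((p : ℂ) ^ (2 * m))⁻¹ := by
      have harg : (p : ℂ).arg ≠ Real.pi := by
        rw [Complex.arg_ofReal_of_nonneg hp0.le]
        exact Real.pi_ne_zero.symm
      rw [one_div, Complex.inv_cpow _ _ harg, Complex.cpow_add _ _ hpc, Complex.cpow_natCast,
        mul_inv, Complex.cpow_neg]
    rw [hpow]
    calc _ = (Complex.Gamma (2 * σ + (2 * m : ℕ)) * besselCoef σ m) * ((p : ℂ) ^ (-(2 * σ)) *
          (((ν / 2 : ℝ) : ℂ) ^ (2 * m) * ((p : ℂ) ^ (2 * m))⁻¹)) := by ring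
      _ = _ := by
        rw [hG, pow_mul, pow_mul]
        push_cast
        rw [div_pow, div_pow, div_pow]
        field_simp
        norm_num
        ring
  simp only [e] at h
  have h3 := mul_left_cancel₀ (Gamma_two_mul_ne_zero hσ) (h.unique h2)
  rw [h3]
  have h1 : (0 : ℝ) ≤ 1 - ν ^ 2 / p ^ 2 := by
    rw [sub_nonneg, div_le_one (by positivity)]
    gcongr
  rw [show p ^ 2 - ν ^ 2 = p ^ 2 * (1 - ν ^ 2 / p ^ 2) by field_simp, Complex.ofReal_mul,
    Complex.mul_cpow_ofReal_nonneg (by positivity) h1]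
  congr 1
  · rw [sq, Complex.ofReal_mul, Complex.mul_cpow_ofReal_nonneg hp0.le hp0.le,
      ← Complex.cpow_add _ _ hpc]
    congr 1
    ring
  · push_cast
    rfl

/-- Supplies the summable constants of a Weierstrass M-test, for a majorant `h` independent of σ. -/
theorem summable_integral_mul_subordTerm {ν : ℝ} (hν : 0 ≤ ν) {h : ℝ → ℝ} (hh : ∀ t > 0, 0 ≤ h t)
    (hi : IntegrableOn (fun t => h t * Real.exp (ν * t)) (Ioi 0))
    (hm : AEStronglyMeasurable h (volume.restrict (Ioi 0))) :
    (Summable fun m : ℕ => ∫ t in Ioi (0 : ℝ), h t * ((ν * t) ^ (2 * m) / ((2 * m).factorial : ℝ))) ∧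
    ∀ m : ℕ, IntegrableOn (fun t => h t * ((ν * t) ^ (2 * m) / ((2 * m).factorial : ℝ))) (Ioi 0) := by
  have hc : ∀ t : ℝ, HasSum (fun m : ℕ => h t * ((ν * t) ^ (2 * m) / ((2 * m).factorial : ℝ)))
      (h t * Real.cosh (ν * t)) := fun t => (Real.hasSum_cosh (ν * t)).mul_left _
  have hI : IntegrableOn (fun t => h t * Real.cosh (ν * t)) (Ioi 0) := by
    refine Integrable.mono' hi (hm.mul (by fun_prop)) ?_
    filter_upwards [ae_restrict_mem measurableSet_Ioi] with t ht
    have ht' : (0 : ℝ) < t := ht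
    have := hh t ht
    rw [Real.norm_of_nonneg (by positivity)]
    gcongr
    exact cosh_le_exp (by positivity)
  have hmeas : ∀ m : ℕ, AEStronglyMeasurable
      (fun t => h t * ((ν * t) ^ (2 * m) / ((2 * m).factorial : ℝ))) (volume.restrict (Ioi 0)) :=
    fun m => hm.mul (Continuous.aestronglyMeasurable (by fun_prop))
  have hnn : ∀ m : ℕ, ∀ t > 0, 0 ≤ h t * ((ν * t) ^ (2 * m) / ((2 * m).factorial : ℝ)) := by
    intro m t ht
    have := hh t ht
    positivity
  refine ⟨(hasSum_integral_of_dominated_convergence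
    (fun m t => h t * ((ν * t) ^ (2 * m) / ((2 * m).factorial : ℝ)))
    (f := fun t => h t * Real.cosh (ν * t)) hmeas ?_ ?_ ?_ ?_).summable, fun m => ?_⟩
  · intro m
    filter_upwards [ae_restrict_mem measurableSet_Ioi] with t ht
    rw [Real.norm_of_nonneg (hnn m t ht)]
  · exact Filter.Eventually.of_forall fun t => (hc t).summable
  · simp only [(hc _).tsum_eq]
    exact hI
  · exact Filter.Eventually.of_forall hc
  · refine Integrable.mono' hI (hmeas m) ?_
    filter_upwards [ae_restrict_mem measurableSet_Ioi] with t ht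
    rw [Real.norm_of_nonneg (hnn m t ht)]
    have := hh t ht
    exact (hc t).summable.le_tsum m (fun j _ => hnn j t ht) |>.trans_eq (hc t).tsum_eq

/-- The integral of an exponentially decaying function against the subordination density is
holomorphic in the parameter. -/
theorem differentiableOn_integral_mul_subord {ν : ℝ} (hν : 0 ≤ ν) {g : ℝ → ℂ} {C : ℝ}
    (hg : ContinuousOn g (Ioi 0)) (hb : ∀ t > 0, ‖g t‖ ≤ C * Real.exp (-((ν + 1) * t))) :
    DifferentiableOn ℂ (fun σ => ∫ t in Ioi (0 : ℝ), g t * subord ν σ t) {σ : ℂ | 0 < σ.re} := by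
  intro σ₀ hσ₀
  have hσ₀' : 0 < σ₀.re := hσ₀
  have hC : 0 ≤ C := by
    have := (norm_nonneg _).trans (hb 1 one_pos)
    exact nonneg_of_mul_nonneg_left this (Real.exp_pos _)
  have hgm : AEStronglyMeasurable g (volume.restrict (Ioi 0)) :=
    hg.aestronglyMeasurable measurableSet_Ioi
  -- Work in the strip Re σ₀ / 2 < Re σ < 2 Re σ₀. There t^(2 Re σ - 1) is at most t^(2a-1) +
  -- t^(2b-1), one power serving t ≤ 1 and the other t ≥ 1, so one majorant works for the whole
  -- strip.
  set a := σ₀.re / 2 with ha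
  set b := σ₀.re * 2 with hb'
  have hapos : 0 < a := by linarith
  have hbpos : 0 < b := by linarith
  have hgi : ∀ x : ℝ, 0 < x → IntegrableOn
      (fun t => C * Real.exp (-((ν + 1) * t)) * (t ^ (2 * x - 1) * Real.exp (ν * t))) (Ioi 0) := by
    intro x hx
    have := (integrableOn_exp_mul_weight (ν := ν) (p := ν + 1) (by linarith) hx).const_mul C
    refine this.congr (Filter.Eventually.of_forall fun t => ?_)
    simp only [Complex.norm_real, Real.norm_eq_abs, Real.abs_exp]
    ring
  set U : Set ℂ := {σ : ℂ | a < σ.re ∧ σ.re < b} with hU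
  have hUo : IsOpen U :=
    (isOpen_lt continuous_const Complex.continuous_re).inter
      (isOpen_lt Complex.continuous_re continuous_const)
  have hUσ : σ₀ ∈ U := ⟨by linarith, by linarith⟩
  have hUpos : ∀ σ ∈ U, 0 < σ.re := fun σ hσ => hapos.trans hσ.1
  set h : ℝ → ℝ := fun t => C * Real.exp (-((ν + 1) * t)) * (t ^ (2 * a - 1) + t ^ (2 * b - 1)) with hh
  have hhnn : ∀ t > 0, 0 ≤ h t := by
    intro t ht
    have : (0 : ℝ) < t := ht
    simp only [hh]
    positivity
  obtain ⟨hS, hSi⟩ := summable_integral_mul_subordTerm hν hhnn (by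
    refine ((hgi a hapos).add (hgi b hbpos)).congr (Filter.Eventually.of_forall fun t => ?_)
    simp only [hh, Pi.add_apply]
    ring) (Measurable.aestronglyMeasurable (by fun_prop))
  have hpt : ∀ σ ∈ U, ∀ t > 0, ‖g t‖ * t ^ (2 * σ.re - 1) ≤ h t := by
    intro σ hσ t ht
    have : t ^ (2 * σ.re - 1) ≤ t ^ (2 * a - 1) + t ^ (2 * b - 1) := by
      rcases le_total t 1 with h1 | h1
      · have := Real.rpow_le_rpow_of_exponent_ge ht h1 (show 2 * a - 1 ≤ 2 * σ.re - 1 by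
          linarith [hσ.1])
        have h2 : 0 ≤ t ^ (2 * b - 1) := by positivity
        linarith
      · have := Real.rpow_le_rpow_of_exponent_le h1 (show 2 * σ.re - 1 ≤ 2 * b - 1 by
          linarith [hσ.2])
        have h2 : 0 ≤ t ^ (2 * a - 1) := by positivity
        linarith
    simp only [hh]
    gcongr
    exact hb t ht
  -- Each term is a holomorphic coefficient times the Mellin transform of `g` at 2σ + 2m; the M-test
  -- passes holomorphy to the sum.
  have hD : DifferentiableOn ℂ (fun σ => ∑' m, ∫ t in Ioi (0 : ℝ), g t * subordTerm ν σ m t) U := by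
    refine Complex.differentiableOn_tsum_of_summable_norm hS (fun m => ?_) hUo fun m σ hσ => ?_
    · have hmel : ∀ σ ∈ U, ∫ t in Ioi (0 : ℝ), g t * subordTerm ν σ m t =
          besselCoef σ m * ((ν / 2 : ℝ) : ℂ) ^ (2 * m) * mellin g (2 * σ + (2 * m : ℕ)) := by
        intro σ hσ
        rw [mellin, ← integral_const_mul]
        refine setIntegral_congr_fun measurableSet_Ioi fun t ht => ?_
        have htc : (t : ℂ) ≠ 0 := by exact_mod_cast (ne_of_gt ht)
        simp only [smul_eq_mul]
        rw [show 2 * σ + ((2 * m : ℕ) : ℂ) - 1 = (2 * σ - 1) + ((2 * m : ℕ) : ℂ) by ring,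
          Complex.cpow_add _ _ htc, Complex.cpow_natCast, subordTerm,
          show ν * t / 2 = ν / 2 * t by ring, Complex.ofReal_mul (ν / 2) t, mul_pow]
        ring
      refine DifferentiableOn.congr ?_ hmel
      refine (((differentiableOn_besselCoef m).mono fun σ hσ => hUpos σ hσ).mul_const _).mul ?_
      intro σ hσ
      have : DifferentiableAt ℂ (mellin g) (2 * σ + (2 * m : ℕ)) := by
        -- Here `b := 0` records that `g` is bounded near 0, so the Mellin transform is holomorphic
        -- on the whole right half plane.
        refine mellin_differentiableAt_of_isBigO_rpow_exp (a := ν + 1) (b := 0) (by linarith)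
          (hg.locallyIntegrableOn measurableSet_Ioi) ?_ ?_ ?_
        · refine Asymptotics.IsBigO.of_bound C ?_
          filter_upwards [Filter.eventually_gt_atTop 0] with t ht
          refine (hb t ht).trans_eq ?_
          rw [Real.norm_eq_abs, Real.abs_exp]
          congr 2
          ring
        · refine Asymptotics.IsBigO.of_bound C ?_
          filter_upwards [self_mem_nhdsWithin] with t ht
          have ht' : (0 : ℝ) < t := ht
          refine (hb t ht).trans ?_
          simp only [neg_zero, Real.rpow_zero, norm_one]
          gcongr
          rw [Real.exp_le_one_iff]
          nlinarith
        · have := hUpos σ hσ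
          simp
          positivity
      exact (DifferentiableAt.comp (g := mellin g) (f := fun σ : ℂ => 2 * σ + ((2 * m : ℕ) : ℂ)) σ
        this (by fun_prop)).differentiableWithinAt
    · refine (norm_integral_le_integral_norm _).trans ?_
      have hle : ∀ᵐ t ∂(volume.restrict (Ioi (0 : ℝ))), ‖g t * subordTerm ν σ m t‖ ≤
          h t * ((ν * t) ^ (2 * m) / ((2 * m).factorial : ℝ)) := by
        filter_upwards [ae_restrict_mem measurableSet_Ioi] with t ht
        rw [norm_mul]
        have ht' : (0 : ℝ) < t := ht
        calc _ ≤ ‖g t‖ * (t ^ (2 * σ.re - 1) * ((ν * t) ^ (2 * m) / ((2 * m).factorial : ℝ))) := by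
              gcongr
              exact norm_subordTerm_le (hUpos σ hσ) m ht
          _ ≤ _ := by
              rw [← mul_assoc]
              gcongr
              exact hpt σ hσ t ht
      exact integral_mono_ae ((hSi m).mono' (hgm.mul
        (measurable_subordTerm ν σ m).aestronglyMeasurable) hle).norm (hSi m) hle
  have hE : ∀ σ ∈ U, ∫ t in Ioi (0 : ℝ), g t * subord ν σ t = (Complex.Gamma (2 * σ))⁻¹ *
      ∑' m, ∫ t in Ioi (0 : ℝ), g t * subordTerm ν σ m t := by
    intro σ hσ
    rw [(hasSum_integral_mul_subordTerm hν (hUpos σ hσ) hgm ?_).tsum_eq,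
      inv_mul_cancel_left₀ (Gamma_two_mul_ne_zero (hUpos σ hσ))]
    refine (hgi _ (hUpos σ hσ)).mono' (hgm.norm.mul
      (Measurable.aestronglyMeasurable (by fun_prop))) ?_
    filter_upwards [ae_restrict_mem measurableSet_Ioi] with t ht
    have ht' : (0 : ℝ) < t := ht
    rw [Real.norm_of_nonneg (by positivity)]
    gcongr
    exact hb t ht
  refine DifferentiableAt.differentiableWithinAt ?_
  refine DifferentiableOn.differentiableAt ?_ (hUo.mem_nhds hUσ)
  refine DifferentiableOn.congr ?_ hE
  refine DifferentiableOn.mul ?_ hD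
  exact (Complex.differentiable_one_div_Gamma.comp
    (by fun_prop : Differentiable ℂ fun σ : ℂ => 2 * σ)).differentiableOn

/-! ### The kernel -/

theorem nu_pos {n : ℕ} (hn : 3 ≤ n) : 0 < nu n := by
  have : (3 : ℝ) ≤ n := by exact_mod_cast hn
  unfold nu
  linarith

theorem area_pos {n : ℕ} (hn : 3 ≤ n) : 0 < area n := by
  have : (3 : ℝ) ≤ n := by exact_mod_cast hn
  have := Real.Gamma_pos_of_pos (show 0 < (n : ℝ) / 2 by linarith)
  have := Real.pi_pos
  unfold area
  positivity

theorem besselCoef_ofReal {s : ℝ} (hs : 0 < s) (m : ℕ) :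
    besselCoef s m = ((Real.Gamma (s + 1 / 2) /
      (Real.Gamma ((m : ℝ) + 1) * Real.Gamma ((m : ℝ) + (s - 1 / 2) + 1)) : ℝ) : ℂ) := by
  have h := Gamma_add_natCast (z := ((s + 1 / 2 : ℝ) : ℂ)) (by simp; linarith) m
  have hG : Real.Gamma (s + 1 / 2) ≠ 0 := (Real.Gamma_pos_of_pos (by linarith)).ne'
  have h2 : Real.Gamma ((m : ℝ) + (s - 1 / 2) + 1) =
      (∏ i ∈ Finset.range m, (s + 1 / 2 + (i : ℝ))) * Real.Gamma (s + 1 / 2) := by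
    rw [← Complex.ofReal_inj, Complex.ofReal_mul, ← Complex.Gamma_ofReal, ← Complex.Gamma_ofReal]
    have e : (((m : ℝ) + (s - 1 / 2) + 1 : ℝ) : ℂ) = ((s + 1 / 2 : ℝ) : ℂ) + (m : ℂ) := by
      push_cast
      ring
    rw [e, h]
    push_cast
    rfl
  rw [Real.Gamma_nat_eq_factorial, h2, besselCoef]
  have h3 : Real.Gamma (s + 1 / 2) / (m.factorial *
      ((∏ i ∈ Finset.range m, (s + 1 / 2 + (i : ℝ))) * Real.Gamma (s + 1 / 2))) =
      (m.factorial * ∏ i ∈ Finset.range m, (s + 1 / 2 + (i : ℝ)))⁻¹ := by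
    rw [← mul_assoc, div_mul_cancel_right₀ hG]
  rw [h3]
  push_cast
  rfl

/-- The constant in front of the integral representation of the kernel. -/
def kernelConst (n : ℕ) (s : ℝ) : ℝ :=
  (4 / ((n : ℝ) - 2)) ^ (s - 1 / 2) * (Real.Gamma (s + 1 / 2) / Real.Gamma (2 * s))

/-- Write t^(2s-1) as (2/ν)^(s-1/2) (νt/2)^(s-1/2) t^(s-1/2). The middle factor completes the Bessel
series of order s - 1/2, and 2/ν = 4/(n-2). -/
theorem subord_ofReal {n : ℕ} (hn : 3 ≤ n) {s : ℝ} (hs : 0 < s) {t : ℝ} (ht : 0 < t) :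
    subord (nu n) s t =
      ((kernelConst n s * (besselI (s - 1 / 2) (nu n * t) * t ^ (s - 1 / 2)) : ℝ) : ℂ) := by
  have hν := nu_pos hn
  have e4 : 4 / ((n : ℝ) - 2) = 2 / nu n := by
    unfold nu
    have : (3 : ℝ) ≤ n := by exact_mod_cast hn
    have : (n : ℝ) - 2 ≠ 0 := by linarith
    field_simp
    norm_num
  have hterm : ∀ m : ℕ, subordTerm (nu n) s m t = (((2 / nu n) ^ (s - 1 / 2) *
      Real.Gamma (s + 1 / 2) * ((nu n * t / 2) ^ (2 * (m : ℝ) + (s - 1 / 2)) /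
        (Real.Gamma ((m : ℝ) + 1) * Real.Gamma ((m : ℝ) + (s - 1 / 2) + 1)) * t ^ (s - 1 / 2)) : ℝ) : ℂ) := by
    intro m
    have h1 : (t : ℂ) ^ (2 * (s : ℂ) - 1) = ((t ^ (2 * s - 1) : ℝ) : ℂ) := by
      rw [Complex.ofReal_cpow ht.le]
      push_cast
      rfl
    have h2 : t ^ (2 * s - 1) = (2 / nu n) ^ (s - 1 / 2) * (nu n * t / 2) ^ (s - 1 / 2) *
        t ^ (s - 1 / 2) := by
      rw [← Real.mul_rpow (by positivity) (by positivity)]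
      rw [show 2 / nu n * (nu n * t / 2) = t by field_simp, ← Real.rpow_add ht]
      congr 1
      ring
    have h3 : (nu n * t / 2) ^ (2 * (m : ℝ) + (s - 1 / 2)) =
        (nu n * t / 2) ^ (2 * m) * (nu n * t / 2) ^ (s - 1 / 2) := by
      rw [Real.rpow_add (by positivity), ← Real.rpow_natCast (nu n * t / 2) (2 * m)]
      push_cast
      rfl
    rw [subordTerm, besselCoef_ofReal hs, h1, h2, h3, ← Complex.ofReal_pow, ← Complex.ofReal_mul,
      ← Complex.ofReal_mul]
    congr 1
    ring
  have hG : Complex.Gamma (2 * (s : ℂ)) = ((Real.Gamma (2 * s) : ℝ) : ℂ) := by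
    rw [← Complex.Gamma_ofReal]
    push_cast
    rfl
  unfold subord
  simp only [hterm]
  rw [← Complex.ofReal_tsum, hG, ← Complex.ofReal_inv, ← Complex.ofReal_mul, tsum_mul_left,
    tsum_mul_right, kernelConst, e4, besselI]
  congr 1
  ring

/-- The factor of the integrand of the kernel that depends on `τ`. -/
def kerPoisson (n : ℕ) (τ t : ℝ) : ℝ :=
  Real.exp (-t * nu n) * (poisson n (Real.exp (-t)) τ - 1 / area n)

theorem kernelConst_mul_kernelIntegrand {n : ℕ} (hn : 3 ≤ n) {s : ℝ} (hs : 0 < s) (τ : ℝ) {t : ℝ}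
    (ht : 0 < t) :
    ((kernelConst n s * kernelIntegrand n s τ t : ℝ) : ℂ) =
      (kerPoisson n τ t : ℂ) * subord (nu n) s t := by
  rw [subord_ofReal hn hs ht, ← Complex.ofReal_mul, kernelIntegrand, kerPoisson]
  congr 1
  ring

/-- The kernel `K_{-s}`. -/
def kernel (n : ℕ) (s τ : ℝ) : ℝ :=
  kernelConst n s * ∫ t in Ioi (0 : ℝ), kernelIntegrand n s τ t

/-- No condition on τ is needed: the two integrands agree pointwise up to the constant, and if they
are not integrable both integrals take the default value 0. -/
theorem kernel_eq {n : ℕ} (hn : 3 ≤ n) {s : ℝ} (hs : 0 < s) (τ : ℝ) :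
    (kernel n s τ : ℂ) = ∫ t in Ioi (0 : ℝ), (kerPoisson n τ t : ℂ) * subord (nu n) s t := by
  rw [kernel, ← integral_const_mul, ← integral_complex_ofReal]
  exact setIntegral_congr_fun measurableSet_Ioi fun t ht =>
    kernelConst_mul_kernelIntegrand hn hs τ ht

theorem kernelConst_pos {n : ℕ} (hn : 3 ≤ n) {s : ℝ} (hs : 0 < s) : 0 < kernelConst n s := by
  have : (3 : ℝ) ≤ n := by exact_mod_cast hn
  have h1 := Real.Gamma_pos_of_pos (show 0 < s + 1 / 2 by linarith)
  have h2 := Real.Gamma_pos_of_pos (show 0 < 2 * s by linarith)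
  have h3 : 0 < 4 / ((n : ℝ) - 2) := div_pos (by norm_num) (by linarith)
  unfold kernelConst
  positivity

theorem exp_neg_mem_Ico {t : ℝ} (ht : 0 < t) : Real.exp (-t) ∈ Ico (0 : ℝ) 1 :=
  ⟨(Real.exp_pos _).le, by rw [Real.exp_lt_one_iff]; linarith⟩

/-! ### Zonal expansion of the Poisson kernel and the Dirichlet series -/

theorem poisson_denom_pos {r τ : ℝ} (hr : r ∈ Ico (0 : ℝ) 1) (hτ : τ ∈ Icc (-1 : ℝ) 1) :
    0 < 1 - 2 * r * τ + r ^ 2 := by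
  nlinarith [mul_nonneg hr.1 (sub_nonneg.mpr hτ.2), mul_pos (sub_pos.mpr hr.2) (sub_pos.mpr hr.2)]

theorem hasSum_poisson {n : ℕ} (hn : 3 ≤ n) {r τ : ℝ} (hr : r ∈ Ico (0 : ℝ) 1)
    (hτ : τ ∈ Icc (-1 : ℝ) 1) :
    HasSum (fun k => 1 / area n * zonal (nu n) τ k * r ^ k) (poisson n r τ) := by
  have h := (hasSum_zonal (nu_pos hn).ne' hτ hr).mul_left (1 / area n)
  have e : nu n + 1 = (n : ℝ) / 2 := by
    unfold nu
    ring
  rw [e, Real.rpow_neg (poisson_denom_pos hr hτ).le] at h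
  have e2 : poisson n r τ = 1 / area n * ((1 - r ^ 2) *
      ((1 - 2 * r * τ + r ^ 2) ^ ((n : ℝ) / 2))⁻¹) := by
    unfold poisson
    field_simp
  rw [e2]
  refine Eq.mp (congrArg (fun f => HasSum f _) (funext fun k => ?_)) h
  ring

theorem hasSum_poisson_sub {n : ℕ} (hn : 3 ≤ n) {r τ : ℝ} (hr : r ∈ Ico (0 : ℝ) 1)
    (hτ : τ ∈ Icc (-1 : ℝ) 1) :
    HasSum (fun k => 1 / area n * zonal (nu n) τ (k + 1) * r ^ (k + 1))
      (poisson n r τ - 1 / area n) := by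
  have h := (hasSum_nat_add_iff' 1).mpr (hasSum_poisson hn hr hτ)
  simpa [zonal_zero (nu_pos hn).ne'] using h

theorem hasSum_kerPoisson {n : ℕ} (hn : 3 ≤ n) {τ t : ℝ} (ht : 0 < t) (hτ : τ ∈ Icc (-1 : ℝ) 1) :
    HasSum (fun k : ℕ => 1 / area n * zonal (nu n) τ (k + 1) *
      Real.exp (-(((k : ℝ) + 1 + nu n) * t))) (kerPoisson n τ t) := by
  have h := (hasSum_poisson_sub hn (exp_neg_mem_Ico ht) hτ).mul_left (Real.exp (-t * nu n))
  refine Eq.mp (congrArg (fun f => HasSum f _) (funext fun k => ?_)) h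
  rw [← Real.exp_nat_mul, mul_left_comm, ← Real.exp_add]
  congr 2
  push_cast
  ring

theorem eigen_succ (n k : ℕ) :
    eigen n (k + 1) = ((k : ℝ) + 1 + nu n) ^ 2 - nu n ^ 2 := by
  unfold eigen nu
  push_cast
  ring

theorem summable_zonal_mul {n : ℕ} (hn : 3 ≤ n) {τ : ℝ} (hτ : τ ∈ Icc (-1 : ℝ) 1) {x : ℝ}
    (hx : (n : ℝ) - 1 < x) :
    Summable fun k : ℕ => |zonal (nu n) τ (k + 1)| * (1 / ((k : ℝ) + 1)) ^ x := by
  have hp : (n : ℝ) - 2 - x < -1 := by linarith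
  have h := ((summable_nat_add_iff 1).mpr (Real.summable_nat_rpow.mpr hp)).mul_left (2 * 2 ^ (n - 2))
  refine Summable.of_nonneg_of_le (fun k => by positivity) (fun k => ?_) h
  have hk : (0 : ℝ) < k + 1 := by positivity
  have e : ((k + 1 : ℕ) : ℝ) ^ ((n : ℝ) - 2 - x) = ((k : ℝ) + 1) ^ (n - 2) * (1 / ((k : ℝ) + 1)) ^ x := by
    push_cast
    rw [Real.rpow_sub hk, one_div, Real.inv_rpow hk.le, ← Real.rpow_natCast ((k : ℝ) + 1) (n - 2),
      Nat.cast_sub (by omega)]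
    rfl
  rw [e, ← mul_assoc]
  gcongr
  refine (abs_zonal_le hn hτ (k + 1)).trans ?_
  rw [mul_assoc, ← mul_pow]
  gcongr
  push_cast
  linarith [(k.cast_nonneg : (0 : ℝ) ≤ k)]

/-- The Dirichlet series of the zeta function is the integral of the Poisson kernel against the
subordination density. -/
theorem hasSum_zetaTerm {n : ℕ} (hn : 3 ≤ n) {τ : ℝ} (hτ : τ ∈ Icc (-1 : ℝ) 1) {σ : ℂ}
    (hσ : ((n : ℝ) - 1) / 2 < σ.re) :
    HasSum (zetaTerm n τ σ) (∫ t in Ioi (0 : ℝ), (kerPoisson n τ t : ℂ) * subord (nu n) σ t) := by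
  have hn' : (3 : ℝ) ≤ n := by exact_mod_cast hn
  have hσ0 : 0 < σ.re := by linarith
  have hν := nu_pos hn
  set F : ℕ → ℝ → ℂ := fun k t => ((1 / area n * zonal (nu n) τ (k + 1) : ℝ) : ℂ) *
    (((Real.exp (-(((k : ℝ) + 1 + nu n) * t)) : ℝ) : ℂ) * subord (nu n) σ t) with hF
  have hp : ∀ k : ℕ, nu n < (k : ℝ) + 1 + nu n := fun k => by
    have := (k.cast_nonneg : (0 : ℝ) ≤ k)
    linarith
  have hFi : ∀ k, Integrable (F k) (volume.restrict (Ioi 0)) := fun k =>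
    (integrableOn_exp_mul_subord hν.le (hp k) hσ0).const_mul _
  -- The exponential growth e^(νt) of the density cancels the shift by ν, leaving an Euler integral
  -- of size (k+1)^(-2 Re σ). Against the zonal growth k^(n-2) this is summable exactly when 2 Re σ
  -- > n - 1.
  have hbound : ∀ k : ℕ, ∫ t in Ioi (0 : ℝ), ‖F k t‖ ≤
      (1 / area n * ‖Complex.Gamma (2 * σ)‖⁻¹ * Real.Gamma (2 * σ.re)) *
        (|zonal (nu n) τ (k + 1)| * (1 / ((k : ℝ) + 1)) ^ (2 * σ.re)) := by
    intro k
    have hk : (0 : ℝ) < (k : ℝ) + 1 := by positivity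
    have hI := Real.integral_rpow_mul_exp_neg_mul_Ioi (a := 2 * σ.re) (by linarith) hk
    calc _ ≤ ∫ t in Ioi (0 : ℝ), (1 / area n * |zonal (nu n) τ (k + 1)| * ‖Complex.Gamma (2 * σ)‖⁻¹) *
          (t ^ (2 * σ.re - 1) * Real.exp (-(((k : ℝ) + 1) * t))) := by
          refine setIntegral_mono_on (hFi k).norm
            ((integrableOn_rpow_mul_exp (by linarith) hk).const_mul _) measurableSet_Ioi
            fun t ht => ?_
          have ht' : (0 : ℝ) < t := ht
          have ha := area_pos hn
          simp only [hF]
          rw [norm_mul, norm_mul, Complex.norm_real, Complex.norm_real, Real.norm_eq_abs,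
            Real.norm_eq_abs, Real.abs_exp, abs_mul, abs_of_pos (by positivity : 0 < 1 / area n)]
          calc _ ≤ 1 / area n * |zonal (nu n) τ (k + 1)| * (Real.exp (-(((k : ℝ) + 1 + nu n) * t)) *
                (‖Complex.Gamma (2 * σ)‖⁻¹ * (t ^ (2 * σ.re - 1) * Real.exp (nu n * t)))) := by
                gcongr
                exact norm_subord_le hν.le hσ0 ht
            _ = _ := by
                rw [show -(((k : ℝ) + 1) * t) = -(((k : ℝ) + 1 + nu n) * t) + nu n * t by ring,
                  Real.exp_add]
                ring
      _ = _ := by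
          rw [integral_const_mul, hI]
          ring
  have hs : Summable fun k => ∫ t in Ioi (0 : ℝ), ‖F k t‖ :=
    Summable.of_nonneg_of_le (fun k => integral_nonneg fun t => norm_nonneg _) hbound
      ((summable_zonal_mul hn hτ (by linarith)).mul_left _)
  have h := hasSum_integral_of_summable_integral_norm hFi hs
  have e1 : ∀ k, ∫ t in Ioi (0 : ℝ), F k t = zetaTerm n τ σ k := by
    intro k
    rw [integral_const_mul, integral_exp_mul_subord hν.le (hp k) hσ0, zetaTerm, eigen_succ, zonal]
    push_cast
    ring
  have e2 : ∫ t in Ioi (0 : ℝ), ∑' k, F k t =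
      ∫ t in Ioi (0 : ℝ), (kerPoisson n τ t : ℂ) * subord (nu n) σ t := by
    refine setIntegral_congr_fun measurableSet_Ioi fun t ht => ?_
    have h := (Complex.hasSum_ofReal.mpr (hasSum_kerPoisson hn ht hτ)).mul_right (subord (nu n) σ t)
    rw [← h.tsum_eq]
    refine tsum_congr fun k => ?_
    simp only [hF]
    push_cast
    ring
  simp only [e1] at h
  rwa [e2] at h

/-! ### Bounds for the Poisson kernel -/

theorem summable_zonal_exp {n : ℕ} (hn : 3 ≤ n) {t : ℝ} (ht : 0 < t) :
    Summable fun k : ℕ => zonal (nu n) 1 (k + 1) * Real.exp (-t) ^ k := by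
  have h := (hasSum_zonal (nu_pos hn).ne' (τ := 1) (by norm_num) (exp_neg_mem_Ico ht)).summable
  have h2 := ((summable_nat_add_iff 1).mpr h).mul_right (Real.exp t)
  refine h2.congr fun k => ?_
  rw [pow_succ, mul_assoc, mul_assoc (Real.exp (-t) ^ k), ← Real.exp_add]
  simp

/-- For t ≥ 1 one factor e^(-t) comes out of e^(-(k+1)t), and what remains is bounded by the
convergent series at τ = 1, t = 1. -/
theorem abs_poisson_sub_le_of_one_le {n : ℕ} (hn : 3 ≤ n) : ∃ C : ℝ, 0 ≤ C ∧
    ∀ τ ∈ Icc (-1 : ℝ) 1, ∀ t : ℝ, 1 ≤ t →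
      |poisson n (Real.exp (-t)) τ - 1 / area n| ≤ C * Real.exp (-t) := by
  have ha := area_pos hn
  have hS := (summable_zonal_exp hn one_pos).mul_left (1 / area n)
  refine ⟨∑' k : ℕ, 1 / area n * (zonal (nu n) 1 (k + 1) * Real.exp (-1) ^ k), ?_, ?_⟩
  · refine tsum_nonneg fun k => ?_
    have := zonal_one_nonneg (nu_pos hn) (k + 1)
    positivity
  intro τ hτ t ht
  have ht0 : 0 < t := by linarith
  have h := hasSum_poisson_sub hn (exp_neg_mem_Ico ht0) hτ
  rw [← h.tsum_eq, ← Real.norm_eq_abs]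
  refine tsum_of_norm_bounded (hS.hasSum.mul_right _) fun k => ?_
  rw [Real.norm_eq_abs, abs_mul, abs_mul, abs_of_pos (by positivity : 0 < 1 / area n), abs_pow,
    Real.abs_exp, pow_succ, mul_assoc, mul_assoc, mul_assoc]
  gcongr
  · exact zonal_one_nonneg (nu_pos hn) (k + 1)
  · exact abs_zonal_le_one (nu_pos hn) hτ (k + 1)

/-- The denominator is (1 - r)² + 2r(1 - τ), and for t ≤ 1 both r ≥ 1/e and 1 - r ≥ t/e hold, so it
is at least e^(-2) (t² + 1 - τ). The numerator satisfies 1 - r² ≤ 2t. -/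
theorem abs_poisson_sub_le_of_le_one {n : ℕ} (hn : 3 ≤ n) : ∃ C : ℝ, 0 ≤ C ∧
    ∀ τ ∈ Icc (-1 : ℝ) 1, ∀ t : ℝ, 0 < t → t ≤ 1 →
      |poisson n (Real.exp (-t)) τ - 1 / area n| ≤
        C * (1 + t * (t ^ 2 + (1 - τ)) ^ (-((n : ℝ) / 2))) := by
  have ha := area_pos hn
  set A : ℝ := 2 / (area n * Real.exp (-2) ^ ((n : ℝ) / 2)) with hA
  have hA0 : 0 ≤ A := by positivity
  refine ⟨1 / area n + A, by positivity, fun τ hτ t ht ht1 => ?_⟩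
  have h1τ : 0 ≤ 1 - τ := by linarith [hτ.2]
  set r := Real.exp (-t) with hr
  have hrm := exp_neg_mem_Ico ht
  have hq : 0 < t ^ 2 + (1 - τ) := by positivity
  have hre : Real.exp (-1) ≤ r := Real.exp_le_exp.mpr (by linarith)
  have hr1 : t * r ≤ 1 - r := by
    have h := Real.add_one_le_exp t
    have : r * Real.exp t = 1 := by rw [hr, ← Real.exp_add]; simp
    nlinarith [hrm.1]
  have hr2 : 1 - r ^ 2 ≤ 2 * t := by
    have h := Real.add_one_le_exp (-t)
    nlinarith [hrm.1, hrm.2, sq_nonneg (1 - r)]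
  have hden : Real.exp (-2) * (t ^ 2 + (1 - τ)) ≤ 1 - 2 * r * τ + r ^ 2 := by
    have e2 : Real.exp (-2) = Real.exp (-1) * Real.exp (-1) := by
      rw [← Real.exp_add]
      norm_num
    have hpos := Real.exp_pos (-1)
    have h1 : Real.exp (-1) * t ≤ 1 - r := le_trans (by nlinarith) hr1
    have h2 : (Real.exp (-1) * t) ^ 2 ≤ (1 - r) ^ 2 := by
      gcongr
    have h3 : Real.exp (-1) ≤ 1 := Real.exp_le_one_iff.mpr (by norm_num)
    have h4 : Real.exp (-1) * Real.exp (-1) * (1 - τ) ≤ 2 * r * (1 - τ) := by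
      gcongr
      nlinarith
    rw [e2]
    nlinarith
  have hP0 : 0 ≤ poisson n r τ := by
    have := poisson_denom_pos hrm hτ
    have : 0 ≤ 1 - r ^ 2 := by nlinarith [hrm.1, hrm.2]
    unfold poisson
    positivity
  have hP : poisson n r τ ≤ A * (t * (t ^ 2 + (1 - τ)) ^ (-((n : ℝ) / 2))) := by
    have h5 : (Real.exp (-2) * (t ^ 2 + (1 - τ))) ^ ((n : ℝ) / 2) ≤
        (1 - 2 * r * τ + r ^ 2) ^ ((n : ℝ) / 2) := by
      gcongr
    rw [Real.mul_rpow (Real.exp_pos _).le hq.le] at h5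
    have hpq : 0 < (t ^ 2 + (1 - τ)) ^ ((n : ℝ) / 2) := by positivity
    calc poisson n r τ ≤ (2 * t) / (area n * (Real.exp (-2) ^ ((n : ℝ) / 2) *
          (t ^ 2 + (1 - τ)) ^ ((n : ℝ) / 2))) := by
          unfold poisson
          gcongr
      _ = _ := by
          rw [hA, Real.rpow_neg hq.le]
          field_simp
  have hX : 0 ≤ t * (t ^ 2 + (1 - τ)) ^ (-((n : ℝ) / 2)) := by positivity
  have h1a : 0 ≤ 1 / area n := by positivity
  rw [abs_le]
  constructor <;> nlinarith [mul_nonneg h1a hX]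

/-! ### Integrability and estimates of the kernel -/

/-- The singular part of the Poisson kernel near the boundary. -/
def peakWeight (n : ℕ) (q t : ℝ) : ℝ := t * (t ^ 2 + q) ^ (-((n : ℝ) / 2))

theorem exists_abs_poisson_sub_le {n : ℕ} (hn : 3 ≤ n) : ∃ C : ℝ, 0 ≤ C ∧
    ∀ τ ∈ Icc (-1 : ℝ) 1, ∀ t : ℝ, 0 < t →
      |poisson n (Real.exp (-t)) τ - 1 / area n| ≤
        C * (Real.exp (-t) + (Ioc (0 : ℝ) 1).indicator (peakWeight n (1 - τ)) t) := by
  obtain ⟨C₁, hC₁, h₁⟩ := abs_poisson_sub_le_of_one_le hn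
  obtain ⟨C₂, hC₂, h₂⟩ := abs_poisson_sub_le_of_le_one hn
  refine ⟨C₁ + C₂ * Real.exp 1, by positivity, fun τ hτ t ht => ?_⟩
  have hE := Real.exp_pos (-t)
  have he1 : 1 ≤ Real.exp 1 := Real.one_le_exp (by norm_num)
  rcases le_or_gt t 1 with h1 | h1
  · rw [indicator_of_mem (show t ∈ Ioc (0 : ℝ) 1 from ⟨ht, h1⟩)]
    refine (h₂ τ hτ t ht h1).trans ?_
    have hw : 0 ≤ peakWeight n (1 - τ) t := by
      have : 0 ≤ 1 - τ := by linarith [hτ.2]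
      unfold peakWeight
      positivity
    change C₂ * (1 + peakWeight n (1 - τ) t) ≤ _
    have h3 : 1 ≤ Real.exp 1 * Real.exp (-t) := by
      rw [← Real.exp_add]
      exact Real.one_le_exp (by linarith)
    calc C₂ * (1 + peakWeight n (1 - τ) t) ≤
          C₂ * (Real.exp 1 * Real.exp (-t) + Real.exp 1 * peakWeight n (1 - τ) t) := by
          gcongr
          nlinarith
      _ = C₂ * Real.exp 1 * (Real.exp (-t) + peakWeight n (1 - τ) t) := by ring
      _ ≤ _ := by
          gcongr
          linarith
  · rw [indicator_of_notMem (fun h => absurd h.2 (not_le.mpr h1)), add_zero]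
    refine (h₁ τ hτ t h1.le).trans ?_
    gcongr
    have : 0 ≤ C₂ * Real.exp 1 := by positivity
    linarith

theorem peakWeight_nonneg {n : ℕ} {q t : ℝ} (hq : 0 ≤ q) (ht : 0 < t) : 0 ≤ peakWeight n q t := by
  unfold peakWeight
  positivity

theorem peakWeight_le {n : ℕ} {q t : ℝ} (hq : 0 < q) (ht : 0 < t) :
    peakWeight n q t ≤ t * q ^ (-((n : ℝ) / 2)) := by
  unfold peakWeight
  gcongr t * ?_
  exact Real.rpow_le_rpow_of_nonpos hq (by nlinarith) (by simp; positivity)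

/-- Dropping q is the efficient bound when t² exceeds q, and it survives at q = 0. The primed
version drops t² instead. -/
theorem rpow_mul_peakWeight_le {n : ℕ} {q t x : ℝ} (hq : 0 ≤ q) (ht : 0 < t) :
    t ^ (x - 1) * peakWeight n q t ≤ t ^ (x - n) := by
  have h : (t ^ 2 + q) ^ (-((n : ℝ) / 2)) ≤ (t ^ 2) ^ (-((n : ℝ) / 2)) :=
    Real.rpow_le_rpow_of_nonpos (by positivity) (by linarith) (by simp; positivity)
  have h2 : (t ^ 2) ^ (-((n : ℝ) / 2)) = t ^ (-(n : ℝ)) := by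
    rw [← Real.rpow_natCast, ← Real.rpow_mul ht.le]
    congr 1
    push_cast
    ring
  calc t ^ (x - 1) * peakWeight n q t ≤ t ^ (x - 1) * (t * t ^ (-(n : ℝ))) := by
        unfold peakWeight
        rw [← h2]
        gcongr
    _ = _ := by
        rw [← mul_assoc, ← Real.rpow_add_one ht.ne', ← Real.rpow_add ht]
        congr 1
        ring

theorem rpow_mul_peakWeight_le' {n : ℕ} {q t x : ℝ} (hq : 0 < q) (ht : 0 < t) :
    t ^ (x - 1) * peakWeight n q t ≤ q ^ (-((n : ℝ) / 2)) * t ^ x := by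
  calc t ^ (x - 1) * peakWeight n q t ≤ t ^ (x - 1) * (t * q ^ (-((n : ℝ) / 2))) := by
        gcongr
        exact peakWeight_le hq ht
    _ = _ := by
        rw [← mul_assoc, ← Real.rpow_add_one ht.ne']
        ring_nf

theorem measurable_rpow_mul_peakWeight (n : ℕ) (q x : ℝ) :
    Measurable fun t : ℝ => t ^ (x - 1) * peakWeight n q t := by
  unfold peakWeight
  fun_prop

theorem integrableOn_Ioc_rpow {x b : ℝ} (hx : -1 < x) (hb : 0 ≤ b) :
    IntegrableOn (fun t : ℝ => t ^ x) (Ioc 0 b) :=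
  (intervalIntegrable_iff_integrableOn_Ioc_of_le hb).mp (intervalIntegral.intervalIntegrable_rpow' hx)

theorem integrableOn_peakWeight {n : ℕ} {q x : ℝ} (hx : 0 < x) (hq : 0 ≤ q)
    (h : 0 < q ∨ (n : ℝ) - 1 < x) :
    IntegrableOn (fun t : ℝ => t ^ (x - 1) * peakWeight n q t) (Ioc 0 1) := by
  have hnn : ∀ t ∈ Ioc (0 : ℝ) 1, ‖t ^ (x - 1) * peakWeight n q t‖ =
      t ^ (x - 1) * peakWeight n q t := fun t ht => by
    have h1 := peakWeight_nonneg (n := n) hq ht.1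
    have h2 : 0 < t := ht.1
    exact Real.norm_of_nonneg (by positivity)
  rcases h with h | h
  · refine Integrable.mono' ((integrableOn_Ioc_rpow (x := x) (by linarith) zero_le_one).const_mul
      (q ^ (-((n : ℝ) / 2)))) (measurable_rpow_mul_peakWeight n q x).aestronglyMeasurable ?_
    filter_upwards [ae_restrict_mem measurableSet_Ioc] with t ht
    rw [hnn t ht]
    exact rpow_mul_peakWeight_le' h ht.1
  · refine Integrable.mono' (integrableOn_Ioc_rpow (x := x - n) (by linarith) zero_le_one)
      (measurable_rpow_mul_peakWeight n q x).aestronglyMeasurable ?_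
    filter_upwards [ae_restrict_mem measurableSet_Ioc] with t ht
    rw [hnn t ht]
    exact rpow_mul_peakWeight_le hq ht.1

theorem continuousOn_kerPoisson {n : ℕ} {τ : ℝ} (hτ : τ ∈ Icc (-1 : ℝ) 1) (hn : 3 ≤ n) :
    ContinuousOn (kerPoisson n τ) (Ioi 0) := by
  have ha := area_pos hn
  unfold kerPoisson poisson
  refine ContinuousOn.mul (by fun_prop) (ContinuousOn.sub ?_ continuousOn_const)
  refine ContinuousOn.div (by fun_prop) ?_ ?_
  · refine continuousOn_const.mul (ContinuousOn.rpow_const (by fun_prop) fun t ht => Or.inl ?_)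
    exact (poisson_denom_pos (exp_neg_mem_Ico ht) hτ).ne'
  · intro t ht
    have := poisson_denom_pos (exp_neg_mem_Ico ht) hτ
    positivity

theorem abs_kerPoisson_mul_weight {n : ℕ} {τ t x : ℝ} :
    ‖(kerPoisson n τ t : ℂ)‖ * (t ^ (x - 1) * Real.exp (nu n * t)) =
      t ^ (x - 1) * |poisson n (Real.exp (-t)) τ - 1 / area n| := by
  rw [Complex.norm_real, kerPoisson, Real.norm_eq_abs, abs_mul, Real.abs_exp]
  have : Real.exp (-t * nu n) * Real.exp (nu n * t) = 1 := by
    rw [← Real.exp_add]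
    simp [mul_comm]
  linear_combination (t ^ (x - 1) * |poisson n (Real.exp (-t)) τ - 1 / area n|) * this

/-- The majorant of the integrand of the kernel, and its integral. -/
theorem exists_weight_bound {n : ℕ} (hn : 3 ≤ n) {x : ℝ} (hx : 0 < x) : ∃ C : ℝ, 0 ≤ C ∧
    ∀ τ ∈ Icc (-1 : ℝ) 1, (τ < 1 ∨ (n : ℝ) - 1 < x) →
      IntegrableOn (fun t => ‖(kerPoisson n τ t : ℂ)‖ * (t ^ (x - 1) * Real.exp (nu n * t))) (Ioi 0) ∧
      ∫ t in Ioi (0 : ℝ), ‖(kerPoisson n τ t : ℂ)‖ * (t ^ (x - 1) * Real.exp (nu n * t)) ≤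
        C * (1 + ∫ t in Ioc (0 : ℝ) 1, t ^ (x - 1) * peakWeight n (1 - τ) t) := by
  obtain ⟨C, hC, hb⟩ := exists_abs_poisson_sub_le hn
  -- Contribution of the regular part e^(-t), the same for all τ.
  set G := ∫ t in Ioi (0 : ℝ), t ^ (x - 1) * Real.exp (-(1 * t)) with hG
  have hG0 : 0 ≤ G := setIntegral_nonneg measurableSet_Ioi fun t ht => by
    have : (0 : ℝ) < t := ht
    positivity
  refine ⟨C * (1 + G), by positivity, fun τ hτ hor => ?_⟩
  have hq : 0 ≤ 1 - τ := by linarith [hτ.2]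
  have hIw := integrableOn_peakWeight (n := n) hx hq (hor.imp (fun h => by linarith) id)
  have hIw' : IntegrableOn ((Ioc (0 : ℝ) 1).indicator
      fun t => t ^ (x - 1) * peakWeight n (1 - τ) t) (Ioi 0) :=
    ((integrable_indicator_iff measurableSet_Ioc).mpr hIw).integrableOn
  have hIe := integrableOn_rpow_mul_exp hx one_pos
  have hI : IntegrableOn (fun t => C * (t ^ (x - 1) * Real.exp (-(1 * t)) +
      (Ioc (0 : ℝ) 1).indicator (fun t => t ^ (x - 1) * peakWeight n (1 - τ) t) t)) (Ioi 0) :=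
    (hIe.add hIw').const_mul C
  have hle : ∀ t ∈ Ioi (0 : ℝ), ‖(kerPoisson n τ t : ℂ)‖ * (t ^ (x - 1) * Real.exp (nu n * t)) ≤
      C * (t ^ (x - 1) * Real.exp (-(1 * t)) +
      (Ioc (0 : ℝ) 1).indicator (fun t => t ^ (x - 1) * peakWeight n (1 - τ) t) t) := by
    intro t ht
    have ht' : (0 : ℝ) < t := ht
    rw [abs_kerPoisson_mul_weight]
    calc _ ≤ t ^ (x - 1) * (C * (Real.exp (-t) +
          (Ioc (0 : ℝ) 1).indicator (peakWeight n (1 - τ)) t)) := by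
          gcongr
          exact hb τ hτ t ht
      _ = _ := by
          rw [one_mul]
          by_cases h : t ∈ Ioc (0 : ℝ) 1
          · rw [indicator_of_mem h, indicator_of_mem h]
            ring
          · rw [indicator_of_notMem h, indicator_of_notMem h]
            ring
  have hmeas : AEStronglyMeasurable (fun t => ‖(kerPoisson n τ t : ℂ)‖ *
      (t ^ (x - 1) * Real.exp (nu n * t))) (volume.restrict (Ioi 0)) := by
    refine AEStronglyMeasurable.mul ?_ (Measurable.aestronglyMeasurable (by fun_prop))
    exact (Complex.continuous_ofReal.comp_continuousOn
      (continuousOn_kerPoisson hτ hn)).norm.aestronglyMeasurable measurableSet_Ioi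
  have hInt : IntegrableOn (fun t => ‖(kerPoisson n τ t : ℂ)‖ *
      (t ^ (x - 1) * Real.exp (nu n * t))) (Ioi 0) := by
    refine Integrable.mono' hI hmeas ?_
    filter_upwards [ae_restrict_mem measurableSet_Ioi] with t ht
    have ht' : (0 : ℝ) < t := ht
    rw [Real.norm_of_nonneg (by positivity)]
    exact hle t ht
  refine ⟨hInt, (setIntegral_mono_on hInt hI measurableSet_Ioi hle).trans ?_⟩
  rw [integral_const_mul, integral_add hIe hIw', setIntegral_indicator measurableSet_Ioc,
    inter_eq_right.mpr (Ioc_subset_Ioi_self : Ioc (0 : ℝ) 1 ⊆ Ioi 0)]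
  set J := ∫ t in Ioc (0 : ℝ) 1, t ^ (x - 1) * peakWeight n (1 - τ) t with hJ
  have hJ0 : 0 ≤ J := setIntegral_nonneg measurableSet_Ioc fun t ht => by
    have h1 := peakWeight_nonneg (n := n) hq ht.1
    have h2 : 0 < t := ht.1
    positivity
  rw [← hG, mul_assoc]
  gcongr
  nlinarith

theorem integrableOn_kerPoisson_mul_subord {n : ℕ} (hn : 3 ≤ n) {s : ℝ} (hs : 0 < s) {τ : ℝ}
    (hτ : τ ∈ Icc (-1 : ℝ) 1) (h : τ < 1 ∨ ((n : ℝ) - 1) / 2 < s) :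
    IntegrableOn (fun t => (kerPoisson n τ t : ℂ) * subord (nu n) s t) (Ioi 0) := by
  obtain ⟨C, -, hC⟩ := exists_weight_bound hn (x := 2 * s) (by linarith)
  refine integrableOn_mul_subord (nu_pos hn).le (by simpa using hs) ?_
    (by simpa using (hC τ hτ (h.imp id fun h => by linarith)).1)
  exact (Complex.continuous_ofReal.comp_continuousOn
      (continuousOn_kerPoisson hτ hn)).aestronglyMeasurable measurableSet_Ioi

theorem integrableOn_kernelIntegrand {n : ℕ} (hn : 3 ≤ n) {s : ℝ} (hs : 0 < s) {τ : ℝ}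
    (hτ : τ ∈ Icc (-1 : ℝ) 1) (h : τ < 1 ∨ ((n : ℝ) - 1) / 2 < s) :
    IntegrableOn (kernelIntegrand n s τ) (Ioi 0) := by
  have h1 := (integrableOn_kerPoisson_mul_subord hn hs hτ h).re
  have h2 : IntegrableOn (fun t => kernelConst n s * kernelIntegrand n s τ t) (Ioi 0) := by
    refine IntegrableOn.congr_fun h1 (fun t ht => ?_) measurableSet_Ioi
    simp only [← kernelConst_mul_kernelIntegrand hn hs τ ht]
    exact Complex.ofReal_re _
  have h3 := h2.const_mul (kernelConst n s)⁻¹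
  refine IntegrableOn.congr_fun h3 (fun t ht => ?_) measurableSet_Ioi
  rw [inv_mul_cancel_left₀ (kernelConst_pos hn hs).ne']

/-- For τ < 1 the peak is at most t (1 - τ)^(-n/2), so the Poisson factor is O(e^(-(ν+1)t)) on the
whole half line and the integral is holomorphic on Re σ > 0. -/
theorem isMinakZeta_integral {n : ℕ} (hn : 3 ≤ n) {τ : ℝ} (hτ : τ ∈ Ico (-1 : ℝ) 1) :
    IsMinakZeta n τ
      (fun σ => ∫ t in Ioi (0 : ℝ), (kerPoisson n τ t : ℂ) * subord (nu n) σ t) := by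
  have hτ' : τ ∈ Icc (-1 : ℝ) 1 := ⟨hτ.1, hτ.2.le⟩
  obtain ⟨C, hC, hb⟩ := exists_abs_poisson_sub_le hn
  have hq : 0 < 1 - τ := by linarith [hτ.2]
  refine ⟨fun σ hσ => hasSum_zetaTerm hn hτ' hσ, ?_⟩
  refine differentiableOn_integral_mul_subord (nu_pos hn).le
    (C := C * (1 + (1 - τ) ^ (-((n : ℝ) / 2)) * Real.exp 1)) ?_ fun t ht => ?_
  · exact Complex.continuous_ofReal.comp_continuousOn (continuousOn_kerPoisson hτ' hn)
  -- The peak lives on t ≤ 1, where t ≤ 1 ≤ e^(1-t); the factor e turns it into a multiple of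
  -- e^(-t).
  · have hind : (Ioc (0 : ℝ) 1).indicator (peakWeight n (1 - τ)) t ≤
        (1 - τ) ^ (-((n : ℝ) / 2)) * Real.exp 1 * Real.exp (-t) := by
      by_cases h : t ∈ Ioc (0 : ℝ) 1
      · rw [indicator_of_mem h]
        refine (peakWeight_le hq ht).trans ?_
        rw [mul_comm, mul_assoc, ← Real.exp_add]
        gcongr
        exact h.2.trans (Real.one_le_exp (by linarith [h.2]))
      · rw [indicator_of_notMem h]
        positivity
    rw [Complex.norm_real, kerPoisson, Real.norm_eq_abs, abs_mul, Real.abs_exp,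
      show -((nu n + 1) * t) = -t * nu n + -t by ring, Real.exp_add]
    calc _ ≤ Real.exp (-t * nu n) * (C * (Real.exp (-t) +
          (1 - τ) ^ (-((n : ℝ) / 2)) * Real.exp 1 * Real.exp (-t))) := by
          gcongr
          exact (hb τ hτ' t ht).trans (by gcongr)
      _ = _ := by ring

theorem exists_abs_kernel_le {n : ℕ} (hn : 3 ≤ n) {s : ℝ} (hs : 0 < s) : ∃ C : ℝ, 0 < C ∧
    ∀ τ ∈ Icc (-1 : ℝ) 1, (τ < 1 ∨ ((n : ℝ) - 1) / 2 < s) →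
      |kernel n s τ| ≤ C * (1 + ∫ t in Ioc (0 : ℝ) 1, t ^ (2 * s - 1) * peakWeight n (1 - τ) t) := by
  obtain ⟨C, hC0, hC⟩ := exists_weight_bound hn (x := 2 * s) (by linarith)
  have hs' : 0 < (s : ℂ).re := by simpa using hs
  refine ⟨‖Complex.Gamma (2 * (s : ℂ))‖⁻¹ * C + 1, by positivity, fun τ hτ h => ?_⟩
  obtain ⟨hI, hle⟩ := hC τ hτ (h.imp id fun h => by linarith)
  have hJ0 : 0 ≤ ∫ t in Ioc (0 : ℝ) 1, t ^ (2 * s - 1) * peakWeight n (1 - τ) t :=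
    setIntegral_nonneg measurableSet_Ioc fun t ht => by
      have h1 := peakWeight_nonneg (n := n) (by linarith [hτ.2] : 0 ≤ 1 - τ) ht.1
      have h2 : 0 < t := ht.1
      positivity
  rw [← Real.norm_eq_abs, ← Complex.norm_real, kernel_eq hn hs]
  calc _ ≤ ∫ t in Ioi (0 : ℝ), ‖Complex.Gamma (2 * (s : ℂ))‖⁻¹ *
        (‖(kerPoisson n τ t : ℂ)‖ * (t ^ (2 * s - 1) * Real.exp (nu n * t))) := by
        refine norm_integral_le_of_norm_le (hI.const_mul _) ?_
        filter_upwards [ae_restrict_mem measurableSet_Ioi] with t ht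
        rw [norm_mul, mul_left_comm]
        gcongr
        exact norm_subord_le (nu_pos hn).le hs' ht
    _ ≤ ‖Complex.Gamma (2 * (s : ℂ))‖⁻¹ *
        (C * (1 + ∫ t in Ioc (0 : ℝ) 1, t ^ (2 * s - 1) * peakWeight n (1 - τ) t)) := by
        rw [integral_const_mul]
        gcongr
    _ ≤ _ := by nlinarith

/-! ### The singular integral above, below and at the critical exponent -/

theorem integral_peakWeight_le_of_gt {n : ℕ} {s q : ℝ} (hs : ((n : ℝ) - 1) / 2 < s) (hs0 : 0 < s)
    (hq : 0 ≤ q) : ∫ t in Ioc (0 : ℝ) 1, t ^ (2 * s - 1) * peakWeight n q t ≤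
      ∫ t in Ioc (0 : ℝ) 1, t ^ (2 * s - n) :=
  setIntegral_mono_on (integrableOn_peakWeight (by linarith) hq (Or.inr (by linarith)))
    (integrableOn_Ioc_rpow (by linarith) zero_le_one) measurableSet_Ioc
    fun _ ht => rpow_mul_peakWeight_le hq ht.1

theorem integral_Ioc_rpow {x d : ℝ} (hx : -1 < x) (hd : 0 < d) :
    ∫ t in Ioc (0 : ℝ) d, t ^ x = d ^ (x + 1) / (x + 1) := by
  rw [← intervalIntegral.integral_of_le hd.le, integral_rpow (Or.inl hx),
    Real.zero_rpow (by linarith), sub_zero]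

/-- Splitting of the singular integral at the distance to the singularity. -/
theorem integral_peakWeight_le_split {n : ℕ} {s d : ℝ} (hs0 : 0 < s) (hd : 0 < d) {S : Set ℝ}
    (hS : MeasurableSet S) (hS0 : S ⊆ Ioi 0) (hcover : Ioc 0 1 ⊆ Ioc 0 d ∪ S)
    (hint : IntegrableOn (fun t : ℝ => t ^ (2 * s - n)) S) :
    ∫ t in Ioc (0 : ℝ) 1, t ^ (2 * s - 1) * peakWeight n (d ^ 2) t ≤
      d ^ (-(n : ℝ)) * (d ^ (2 * s + 1) / (2 * s + 1)) + ∫ t in S, t ^ (2 * s - n) := by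
  have hd2 : 0 < d ^ 2 := by positivity
  have hdn : (d ^ 2) ^ (-((n : ℝ) / 2)) = d ^ (-(n : ℝ)) := by
    rw [← Real.rpow_natCast, ← Real.rpow_mul hd.le]
    congr 1
    push_cast
    ring
  have h1 : IntegrableOn (fun t : ℝ => d ^ (-(n : ℝ)) * t ^ (2 * s)) (Ioc 0 d) :=
    (integrableOn_Ioc_rpow (by linarith) hd.le).const_mul _
  have i1 : IntegrableOn ((Ioc (0 : ℝ) d).indicator fun t : ℝ => d ^ (-(n : ℝ)) * t ^ (2 * s))
      (Ioi 0) := ((integrable_indicator_iff measurableSet_Ioc).mpr h1).integrableOn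
  have i2 : IntegrableOn (S.indicator fun t : ℝ => t ^ (2 * s - n)) (Ioi 0) :=
    ((integrable_indicator_iff hS).mpr hint).integrableOn
  have hnn : ∀ t ∈ Ioi (0 : ℝ), 0 ≤ (Ioc (0 : ℝ) d).indicator (fun t : ℝ => d ^ (-(n : ℝ)) * t ^ (2 * s)) t +
      S.indicator (fun t : ℝ => t ^ (2 * s - n)) t := fun t ht => by
    have ht' : (0 : ℝ) < t := ht
    refine add_nonneg (indicator_apply_nonneg fun _ => by positivity)
      (indicator_apply_nonneg fun _ => by positivity)
  have hsub : Ioc (0 : ℝ) 1 ⊆ Ioi 0 := fun t ht => ht.1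
  -- Up to d the bound d^(-n) t^(2s) is used, on `S` the bound t^(2s-n). The set `S` is left free so
  -- that it can be (d, ∞) when t^(2s-n) is integrable there and a bounded interval in the critical
  -- case.
  calc _ ≤ ∫ t in Ioc (0 : ℝ) 1, ((Ioc (0 : ℝ) d).indicator (fun t : ℝ => d ^ (-(n : ℝ)) * t ^ (2 * s)) t +
          S.indicator (fun t : ℝ => t ^ (2 * s - n)) t) := by
        refine setIntegral_mono_on (integrableOn_peakWeight (by linarith) hd2.le (Or.inl hd2))
          ((i1.add i2).mono_set hsub) measurableSet_Ioc fun t ht => ?_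
        have ht' : (0 : ℝ) < t := ht.1
        rcases hcover ht with h | h
        · rw [indicator_of_mem h]
          have h2 := rpow_mul_peakWeight_le' (n := n) (x := 2 * s) hd2 ht'
          rw [hdn] at h2
          have : 0 ≤ S.indicator (fun t : ℝ => t ^ (2 * s - n)) t :=
            indicator_apply_nonneg fun _ => by positivity
          linarith
        · rw [indicator_of_mem h]
          have h2 := rpow_mul_peakWeight_le (n := n) (x := 2 * s) hd2.le ht'
          have : 0 ≤ (Ioc (0 : ℝ) d).indicator (fun t : ℝ => d ^ (-(n : ℝ)) * t ^ (2 * s)) t :=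
            indicator_apply_nonneg fun _ => by positivity
          linarith
    _ ≤ ∫ t in Ioi (0 : ℝ), ((Ioc (0 : ℝ) d).indicator (fun t : ℝ => d ^ (-(n : ℝ)) * t ^ (2 * s)) t +
          S.indicator (fun t : ℝ => t ^ (2 * s - n)) t) := by
        refine setIntegral_mono_set (i1.add i2) ?_ (Filter.Eventually.of_forall hsub)
        filter_upwards [ae_restrict_mem measurableSet_Ioi] with t ht using hnn t ht
    _ = _ := by
        rw [integral_add i1 i2, setIntegral_indicator measurableSet_Ioc, setIntegral_indicator hS,
          inter_eq_right.mpr (Ioc_subset_Ioi_self : Ioc (0 : ℝ) d ⊆ Ioi 0), inter_eq_right.mpr hS0,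
          integral_const_mul, integral_Ioc_rpow (by linarith) hd]

theorem integral_peakWeight_le_of_lt {n : ℕ} {s d : ℝ} (hs : s < ((n : ℝ) - 1) / 2) (hs0 : 0 < s)
    (hd : 0 < d) : ∫ t in Ioc (0 : ℝ) 1, t ^ (2 * s - 1) * peakWeight n (d ^ 2) t ≤
      (1 / (2 * s + 1) + 1 / ((n : ℝ) - 1 - 2 * s)) * d ^ (-((n : ℝ) - 1 - 2 * s)) := by
  have hlt : 2 * s - n < -1 := by linarith
  refine (integral_peakWeight_le_split hs0 hd measurableSet_Ioi (Ioi_subset_Ioi hd.le)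
    (fun t ht => ?_) (integrableOn_Ioi_rpow_of_lt hlt hd)).trans_eq ?_
  · rcases le_or_gt t d with h | h
    · exact Or.inl ⟨ht.1, h⟩
    · exact Or.inr h
  · rw [integral_Ioi_rpow_of_lt hlt hd, mul_div_assoc', ← Real.rpow_add hd]
    rw [show -(n : ℝ) + (2 * s + 1) = -((n : ℝ) - 1 - 2 * s) by ring,
      show 2 * s - n + 1 = -((n : ℝ) - 1 - 2 * s) by ring]
    have : (n : ℝ) - 1 - 2 * s ≠ 0 := by linarith
    field_simp

/-- Here 2s - n = -1: the part below d is scale invariant and the part above gives the logarithm.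
The endpoint is max d 1 because d = √(1 - τ) may exceed 1. -/
theorem integral_peakWeight_le_of_eq {n : ℕ} {s d : ℝ} (hs : s = ((n : ℝ) - 1) / 2) (hs0 : 0 < s)
    (hd : 0 < d) : ∫ t in Ioc (0 : ℝ) 1, t ^ (2 * s - 1) * peakWeight n (d ^ 2) t ≤
      1 / (2 * s + 1) + Real.log (max d 1 / d) := by
  have he : 2 * s - n = -1 := by
    rw [hs]
    ring
  have hd1 : d ≤ max d 1 := le_max_left _ _
  have hi : IntegrableOn (fun t : ℝ => t ^ (2 * s - n)) (Ioc d (max d 1)) := by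
    rw [he]
    refine (ContinuousOn.integrableOn_Icc (fun t ht => ?_)).mono_set Ioc_subset_Icc_self
    exact (Real.continuousAt_rpow_const _ _ (Or.inl (hd.trans_le ht.1).ne')).continuousWithinAt
  refine (integral_peakWeight_le_split hs0 hd measurableSet_Ioc (fun t ht => hd.trans ht.1)
    (fun t ht => ?_) hi).trans_eq ?_
  · rcases le_or_gt t d with h | h
    · exact Or.inl ⟨ht.1, h⟩
    · exact Or.inr ⟨h, ht.2.trans (le_max_right _ _)⟩
  · rw [he, mul_div_assoc', ← Real.rpow_add hd, show -(n : ℝ) + (2 * s + 1) = 0 by linarith,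
      Real.rpow_zero, ← intervalIntegral.integral_of_le hd1]
    simp only [Real.rpow_neg_one]
    rw [integral_inv_of_pos hd (hd.trans_le hd1)]

theorem dot_mem_Icc {n : ℕ} (x y : Sph n) : dot x y ∈ Icc (-1 : ℝ) 1 := by
  have h := abs_real_inner_le_norm (x : EuclideanSpace ℝ (Fin n)) y
  simp only [norm_eq_of_mem_sphere, mul_one] at h
  exact abs_le.mp h

theorem dot_lt_one {n : ℕ} {x y : Sph n} (h : x ≠ y) : dot x y < 1 := by
  exact (inner_lt_one_iff_real_of_norm_eq_one (norm_eq_of_mem_sphere x)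
    (norm_eq_of_mem_sphere y)).mpr fun h' => h (Subtype.ext h')

theorem exists_abs_kernel_le_kernelBound {n : ℕ} (hn : 3 ≤ n) {s : ℝ} (hs : 0 < s) :
    ∃ c : ℝ, 0 < c ∧ ∀ x y : Sph n, x ≠ y → |kernel n s (dot x y)| ≤ c * kernelBound n s x y := by
  obtain ⟨C, hC0, hC⟩ := exists_abs_kernel_le hn hs
  have hn' : (3 : ℝ) ≤ n := by exact_mod_cast hn
  rcases lt_trichotomy s (((n : ℝ) - 1) / 2) with h | h | h
  · set a := (n : ℝ) - 1 - 2 * s with ha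
    have ha0 : 0 < a := by linarith
    set B := 1 / (2 * s + 1) + 1 / a with hB
    have hB0 : 0 < B := by positivity
    have hpi := Real.pi_pos
    refine ⟨C * (Real.pi ^ a * (1 + B)), by positivity, fun x y hxy => ?_⟩
    have hlt := dot_lt_one hxy
    have hm := dot_mem_Icc x y
    set d := √(1 - dot x y) with hd
    have hd0 : 0 < d := Real.sqrt_pos.mpr (by linarith)
    have hd2 : 1 - dot x y = d ^ 2 := (Real.sq_sqrt (by linarith)).symm
    have hJ := integral_peakWeight_le_of_lt (n := n) h hs hd0
    have hθ0 : 0 < geoDist x y := Real.arccos_pos.mpr hlt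
    have hθπ : geoDist x y ≤ Real.pi := Real.arccos_le_pi _
    -- The inequality 1 - cos θ ≥ (2/π²) θ² on [0, π] compares the chordal quantity d with θ, in the
    -- form θ ≤ πd.
    have hcos := Real.cos_le_one_sub_mul_cos_sq (x := geoDist x y)
      (by rwa [abs_of_pos hθ0])
    rw [geoDist, Real.cos_arccos hm.1 hm.2, ← geoDist] at hcos
    have hθd : geoDist x y ≤ Real.pi * d := by
      refine le_of_sq_le_sq ?_ (by positivity)
      have h3 : 2 / Real.pi ^ 2 * geoDist x y ^ 2 ≤ d ^ 2 := by linarith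
      rw [div_mul_eq_mul_div, div_le_iff₀ (by positivity)] at h3
      nlinarith [sq_nonneg (geoDist x y)]
    have h1 : d ^ (-a) ≤ Real.pi ^ a * (1 / geoDist x y ^ a) := by
      rw [Real.rpow_neg hd0.le, ← div_eq_mul_one_div, ← Real.div_rpow hpi.le hθ0.le,
        ← Real.inv_rpow hd0.le]
      gcongr
      rw [inv_eq_one_div, div_le_div_iff₀ hd0 hθ0]
      linarith
    -- As θ ≤ π, the power of 1/θ is bounded below, which absorbs the bounded part of the kernel
    -- estimate.
    have h2 : 1 ≤ Real.pi ^ a * (1 / geoDist x y ^ a) := by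
      rw [← div_eq_mul_one_div, ← Real.div_rpow hpi.le hθ0.le]
      exact Real.one_le_rpow ((one_le_div hθ0).mpr hθπ) ha0.le
    have hk := hC _ hm (Or.inl hlt)
    rw [hd2] at hk
    rw [kernelBound, if_pos h, mul_assoc]
    refine hk.trans ?_
    gcongr
    nlinarith
  -- Since 1 - x · y ≤ 2, `L` is a positive lower bound for the logarithmic right-hand side; the
  -- term 2/L absorbs the additive constants 1 + 1/(2s+1) ≤ 2.
  · set L := Real.log (1 + 2 ^ (-(n : ℝ) / 2)) with hL
    have hL0 : 0 < L := Real.log_pos (by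
      have : (0 : ℝ) < 2 ^ (-(n : ℝ) / 2) := by positivity
      linarith)
    refine ⟨C * (2 / L + 1), by positivity, fun x y hxy => ?_⟩
    have hlt := dot_lt_one hxy
    have hm := dot_mem_Icc x y
    set d := √(1 - dot x y) with hd
    have hd0 : 0 < d := Real.sqrt_pos.mpr (by linarith)
    have hd2 : 1 - dot x y = d ^ 2 := (Real.sq_sqrt (by linarith)).symm
    have hJ := integral_peakWeight_le_of_eq (n := n) h hs hd0
    have hk := hC _ hm (Or.inl hlt)
    rw [hd2] at hk
    rw [kernelBound, if_neg (by linarith), if_pos h, mul_assoc]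
    refine hk.trans ?_
    gcongr
    have h1 : L ≤ Real.log (1 + (1 - dot x y) ^ (-(n : ℝ) / 2)) := by
      have h0 : 0 < 1 - dot x y := by linarith
      refine Real.log_le_log (by positivity) ?_
      gcongr 1 + ?_
      refine Real.rpow_le_rpow_of_nonpos h0 (by linarith [hm.1]) ?_
      linarith
    have h2 : 1 / (2 * s + 1) ≤ 1 := by
      rw [div_le_one (by positivity)]
      linarith
    have h3 : Real.log (max d 1 / d) ≤ Real.log (1 + (1 - dot x y) ^ (-(n : ℝ) / 2)) := by
      rcases le_total d 1 with h5 | h5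
      · rw [max_eq_right h5]
        refine Real.log_le_log (by positivity) ?_
        have : 1 / d ≤ (1 - dot x y) ^ (-(n : ℝ) / 2) := by
          rw [hd2, ← Real.rpow_natCast, ← Real.rpow_mul hd0.le, one_div, ← Real.rpow_neg_one]
          refine Real.rpow_le_rpow_of_exponent_ge hd0 h5 ?_
          push_cast
          linarith
        linarith
      · rw [max_eq_left h5, div_self hd0.ne', Real.log_one]
        linarith
    have h4 : 2 ≤ 2 / L * Real.log (1 + (1 - dot x y) ^ (-(n : ℝ) / 2)) := by
      rw [div_mul_eq_mul_div, le_div_iff₀ hL0]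
      linarith
    linarith
  · set I := ∫ t in Ioc (0 : ℝ) 1, t ^ (2 * s - (n : ℝ)) with hI
    have hI0 : 0 ≤ I := setIntegral_nonneg measurableSet_Ioc fun t ht => by
      have : 0 < t := ht.1
      positivity
    refine ⟨C * (1 + I), by positivity, fun x y hxy => ?_⟩
    have hm := dot_mem_Icc x y
    have hk := hC _ hm (Or.inr h)
    rw [kernelBound, if_neg (by linarith), if_neg (by linarith), mul_one]
    refine hk.trans ?_
    gcongr
    exact integral_peakWeight_le_of_gt h hs (by linarith [hm.2])

/-! ### Zonal harmonic polynomials -/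

section ZonalPolynomials

open MvPolynomial

theorem polyLaplacian_apply (n : ℕ) (p : MvPolynomial (Fin n) ℝ) :
    polyLaplacian n p = ∑ i, pderiv i (pderiv i p) := by
  simp [polyLaplacian]

theorem polyLaplacian_mul (n : ℕ) (p q : MvPolynomial (Fin n) ℝ) :
    polyLaplacian n (p * q) =
      polyLaplacian n p * q + 2 * ∑ i, pderiv i p * pderiv i q + p * polyLaplacian n q := by
  simp only [polyLaplacian_apply, Finset.sum_mul, Finset.mul_sum, ← Finset.sum_add_distrib]
  refine Finset.sum_congr rfl fun i _ => ?_
  simp only [pderiv_mul, map_add]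
  ring

/-- The linear form `y ↦ a · y`. -/
def linForm {n : ℕ} (a : Fin n → ℝ) : MvPolynomial (Fin n) ℝ := ∑ i, C (a i) * X i

/-- The quadratic form `y ↦ y · y`. -/
def sqForm (n : ℕ) : MvPolynomial (Fin n) ℝ := ∑ i, X i * X i

/-- The derivative in the direction `a`. -/
def dirDeriv {n : ℕ} (a : Fin n → ℝ) (p : MvPolynomial (Fin n) ℝ) : MvPolynomial (Fin n) ℝ :=
  ∑ i, C (a i) * pderiv i p

theorem pderiv_linForm {n : ℕ} (a : Fin n → ℝ) (i : Fin n) : pderiv i (linForm a) = C (a i) := by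
  simp [linForm, pderiv_X, Pi.single_apply]

theorem pderiv_sqForm (n : ℕ) (i : Fin n) : pderiv i (sqForm n) = 2 * X i := by
  simp only [sqForm, map_sum, pderiv_mul, pderiv_X, Pi.single_apply]
  simp [Finset.sum_add_distrib]
  ring

theorem polyLaplacian_linForm_mul {n : ℕ} (a : Fin n → ℝ) (p : MvPolynomial (Fin n) ℝ) :
    polyLaplacian n (linForm a * p) = 2 * dirDeriv a p + linForm a * polyLaplacian n p := by
  rw [polyLaplacian_mul]
  simp [polyLaplacian_apply n (linForm a), pderiv_linForm, dirDeriv]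

theorem polyLaplacian_sqForm_mul {n k : ℕ} {p : MvPolynomial (Fin n) ℝ} (hp : p.IsHomogeneous k) :
    polyLaplacian n (sqForm n * p) =
      C (2 * n + 4 * k : ℝ) * p + sqForm n * polyLaplacian n p := by
  have h2 : polyLaplacian n (sqForm n) = C (2 * n : ℝ) := by
    have : ∀ i : Fin n, pderiv i (2 * X i : MvPolynomial (Fin n) ℝ) = 2 := fun i => by
      rw [pderiv_mul]
      have : pderiv i (2 : MvPolynomial (Fin n) ℝ) = 0 := by
        rw [← map_ofNat C 2, pderiv_C]
      simp [this]
    simp only [polyLaplacian_apply, pderiv_sqForm, this]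
    simp only [Finset.sum_const, Finset.card_univ, Fintype.card_fin, nsmul_eq_mul, map_mul,
      map_natCast, map_ofNat]
    ring
  have h3 := hp.sum_X_mul_pderiv
  rw [polyLaplacian_mul, h2]
  simp only [pderiv_sqForm, mul_assoc, ← Finset.mul_sum, h3, nsmul_eq_mul]
  simp only [map_add, map_mul, map_natCast, map_ofNat]
  ring

theorem dirDeriv_mul {n : ℕ} (a : Fin n → ℝ) (p q : MvPolynomial (Fin n) ℝ) :
    dirDeriv a (p * q) = dirDeriv a p * q + p * dirDeriv a q := by
  simp only [dirDeriv, Finset.sum_mul, Finset.mul_sum, ← Finset.sum_add_distrib, pderiv_mul]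
  exact Finset.sum_congr rfl fun i _ => by ring

theorem dirDeriv_C_mul {n : ℕ} (a : Fin n → ℝ) (c : ℝ) (p : MvPolynomial (Fin n) ℝ) :
    dirDeriv a (C c * p) = C c * dirDeriv a p := by
  simp only [dirDeriv, Finset.mul_sum, pderiv_C_mul]
  exact Finset.sum_congr rfl fun i _ => by ring

theorem dirDeriv_sub {n : ℕ} (a : Fin n → ℝ) (p q : MvPolynomial (Fin n) ℝ) :
    dirDeriv a (p - q) = dirDeriv a p - dirDeriv a q := by
  simp only [dirDeriv, map_sub, mul_sub, Finset.sum_sub_distrib]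

theorem dirDeriv_linForm {n : ℕ} {a : Fin n → ℝ} (ha : ∑ i, a i * a i = 1) :
    dirDeriv a (linForm a) = 1 := by
  simp only [dirDeriv, pderiv_linForm, ← C_mul, ← map_sum, ha, C_1]

theorem dirDeriv_sqForm {n : ℕ} (a : Fin n → ℝ) : dirDeriv a (sqForm n) = 2 * linForm a := by
  simp only [dirDeriv, pderiv_sqForm, linForm, Finset.mul_sum]
  exact Finset.sum_congr rfl fun i _ => by ring

/-- The solid zonal harmonic `|y| ^ k * C_k^ν(a · y / |y|)`, for a unit vector `a`. -/
def zonalPoly {n : ℕ} (ν : ℝ) (a : Fin n → ℝ) : ℕ → MvPolynomial (Fin n) ℝ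
  | 0 => 1
  | 1 => C (2 * ν) * linForm a
  | k + 2 => C (1 / ((k : ℝ) + 2)) * (C (2 * ((k : ℝ) + 1 + ν)) * (linForm a * zonalPoly ν a (k + 1))
      - C ((k : ℝ) + 2 * ν) * (sqForm n * zonalPoly ν a k))

theorem linForm_isHomogeneous {n : ℕ} (a : Fin n → ℝ) : (linForm a).IsHomogeneous 1 :=
  IsHomogeneous.sum _ _ _ fun _ _ => isHomogeneous_C_mul_X _ _

theorem sqForm_isHomogeneous (n : ℕ) : (sqForm n).IsHomogeneous 2 :=
  IsHomogeneous.sum _ _ _ fun i _ => (isHomogeneous_X ℝ i).mul (isHomogeneous_X ℝ i)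

theorem zonalPoly_isHomogeneous {n : ℕ} (ν : ℝ) (a : Fin n → ℝ) (k : ℕ) :
    (zonalPoly ν a k).IsHomogeneous k := by
  induction k using Nat.twoStepInduction with
  | zero => exact isHomogeneous_one _ _
  | one => exact (linForm_isHomogeneous a).C_mul _
  | more k ih1 ih2 =>
    rw [zonalPoly]
    refine IsHomogeneous.C_mul (IsHomogeneous.sub (IsHomogeneous.C_mul ?_ _)
      (IsHomogeneous.C_mul ?_ _)) _
    · exact (show k + 2 = 1 + (k + 1) by ring) ▸ (linForm_isHomogeneous a).mul ih2
    · exact (show k + 2 = 2 + k by ring) ▸ (sqForm_isHomogeneous n).mul ih1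

theorem C_mul_zonalPoly_add_two {n : ℕ} (ν : ℝ) (a : Fin n → ℝ) (k : ℕ) :
    C ((k : ℝ) + 2) * zonalPoly ν a (k + 2) =
      C (2 * ((k : ℝ) + 1 + ν)) * (linForm a * zonalPoly ν a (k + 1))
      - C ((k : ℝ) + 2 * ν) * (sqForm n * zonalPoly ν a k) := by
  have hk : (k : ℝ) + 2 ≠ 0 := by positivity
  rw [zonalPoly, ← mul_assoc, ← C_mul, mul_one_div_cancel hk, C_1, one_mul]

/-- Coefficient form of ∂_a G = r(r∂_r + 2ν)G for G = (1 - 2r a·y + r²|y|²)^(-ν), proved here from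
the recurrence. It evaluates the cross term that appears when the Laplacian is applied to that
recurrence. -/
theorem dirDeriv_zonalPoly {n : ℕ} (ν : ℝ) {a : Fin n → ℝ} (ha : ∑ i, a i * a i = 1) (k : ℕ) :
    dirDeriv a (zonalPoly ν a (k + 1)) = C ((k : ℝ) + 2 * ν) * zonalPoly ν a k := by
  induction k using Nat.twoStepInduction with
  | zero =>
    change dirDeriv a (C (2 * ν) * linForm a) = C (((0 : ℕ) : ℝ) + 2 * ν) * 1
    rw [dirDeriv_C_mul, dirDeriv_linForm ha]
    simp
  | one =>
    have h := congrArg (dirDeriv a) (C_mul_zonalPoly_add_two ν a 0)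
    rw [dirDeriv_C_mul, dirDeriv_sub, dirDeriv_C_mul, dirDeriv_C_mul, dirDeriv_mul, dirDeriv_mul,
      dirDeriv_linForm ha, dirDeriv_sqForm, zonalPoly, zonalPoly, dirDeriv_C_mul,
      dirDeriv_linForm ha] at h
    have h1 : dirDeriv a 1 = 0 := by simp [dirDeriv]
    have h2 : (C (2 : ℝ) : MvPolynomial (Fin n) ℝ) ≠ 0 := by simp
    rw [h1] at h
    apply mul_left_cancel₀ h2
    rw [zonalPoly]
    simp only [map_add, map_mul, map_ofNat, map_one, Nat.cast_zero, Nat.cast_one,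
      zero_add] at h ⊢
    linear_combination h
  | more k ih1 ih2 =>
    have h := congrArg (dirDeriv a) (C_mul_zonalPoly_add_two ν a (k + 1))
    rw [dirDeriv_C_mul, dirDeriv_sub, dirDeriv_C_mul, dirDeriv_C_mul, dirDeriv_mul, dirDeriv_mul,
      dirDeriv_linForm ha, dirDeriv_sqForm, ih1, ih2] at h
    have h0 := C_mul_zonalPoly_add_two ν a k
    have h2 : (C (((k + 1 : ℕ) : ℝ) + 2 : ℝ) : MvPolynomial (Fin n) ℝ) ≠ 0 := by
      rw [Ne, C_eq_zero]
      positivity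
    apply mul_left_cancel₀ h2
    push_cast at h h0 ⊢
    simp only [map_add, map_mul, map_natCast, map_ofNat, map_one] at h h0 ⊢
    linear_combination h - ((k : MvPolynomial (Fin n) ℝ) + 1 + 2 * C ν) * h0
  
/-- In the recurrence, Δ of the linear-form term gives 2∂_a Z_(k+1) = 2(k+2ν) Z_k and Δ of the |y|²
term gives (2n+4k) Z_k. They cancel because 2n + 4k = 4(k+1+ν), the only place where the value of ν
matters. -/
theorem polyLaplacian_zonalPoly {n : ℕ} {a : Fin n → ℝ} (ha : ∑ i, a i * a i = 1)
    (k : ℕ) : polyLaplacian n (zonalPoly (nu n) a k) = 0 := by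
  induction k using Nat.twoStepInduction with
  | zero => simp [zonalPoly, polyLaplacian_apply]
  | one => simp [zonalPoly, polyLaplacian_apply, pderiv_linForm]
  | more k ih1 ih2 =>
    rw [zonalPoly, ← smul_eq_C_mul, ← smul_eq_C_mul, ← smul_eq_C_mul, map_smul, map_sub, map_smul,
      map_smul, polyLaplacian_linForm_mul, polyLaplacian_sqForm_mul (zonalPoly_isHomogeneous _ a k),
      ih1, ih2, dirDeriv_zonalPoly _ ha, smul_eq_C_mul, smul_eq_C_mul, smul_eq_C_mul]
    have : (2 * n + 4 * k : ℝ) = 4 * (k + 1 + nu n) := by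
      unfold nu
      ring
    rw [this]
    simp only [map_add, map_mul, map_natCast, map_ofNat, map_one]
    ring

theorem eval_zonalPoly {n : ℕ} (ν : ℝ) (a y : Fin n → ℝ) (hy : ∑ i, y i * y i = 1) (k : ℕ) :
    eval y (zonalPoly ν a k) = gegenbauer ν (∑ i, a i * y i) k := by
  have hl : eval y (linForm a) = ∑ i, a i * y i := by simp [linForm]
  have hs : eval y (sqForm n) = 1 := by simp [sqForm, hy]
  induction k using Nat.twoStepInduction with
  | zero => simp [zonalPoly, gegenbauer]
  | one => simp [zonalPoly, gegenbauer, hl]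
  | more k ih1 ih2 =>
    rw [zonalPoly, gegenbauer]
    simp only [eval_mul, eval_C, map_sub, hl, hs, ih1, ih2]
    field_simp

theorem sum_mul_self_eq_one {n : ℕ} (y : Sph n) :
    ∑ i, (y : EuclideanSpace ℝ (Fin n)) i * (y : EuclideanSpace ℝ (Fin n)) i = 1 := by
  have h := EuclideanSpace.real_norm_sq_eq (y : EuclideanSpace ℝ (Fin n))
  rw [norm_eq_of_mem_sphere] at h
  simp only [← sq, ← h, one_pow]

theorem dot_eq_sum {n : ℕ} (x y : Sph n) :
    dot x y = ∑ i, (x : EuclideanSpace ℝ (Fin n)) i * (y : EuclideanSpace ℝ (Fin n)) i := by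
  rw [dot, PiLp.inner_apply]
  simp [mul_comm]

theorem zonal_mem_SH {n : ℕ} (x : Sph n) (k : ℕ) :
    (fun y => zonal (nu n) (dot x y) k) ∈ SH n k := by
  have ha := sum_mul_self_eq_one x
  refine ⟨C (((k : ℝ) + nu n) / nu n) *
    zonalPoly (nu n) (fun i => (x : EuclideanSpace ℝ (Fin n)) i) k, ⟨?_, ?_⟩, ?_⟩
  · exact (zonalPoly_isHomogeneous _ _ _).C_mul _
  · rw [SetLike.mem_coe, LinearMap.mem_ker, ← smul_eq_C_mul, map_smul,
      polyLaplacian_zonalPoly ha, smul_zero]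
  · ext y
    change eval _ _ = _
    rw [eval_mul, eval_C, eval_zonalPoly _ _ _ (sum_mul_self_eq_one y), ← dot_eq_sum, zonal]

/-! ### Infinitesimal rotations on polynomials -/

/-- The infinitesimal rotation in the plane `(i, j)`, on polynomials. -/
def polyRot {n : ℕ} (i j : Fin n) (p : MvPolynomial (Fin n) ℝ) : MvPolynomial (Fin n) ℝ :=
  X i * pderiv j p - X j * pderiv i p

/-- The Casimir identity. -/
theorem sum_polyRot_polyRot {n k : ℕ} {p : MvPolynomial (Fin n) ℝ} (hp : p.IsHomogeneous k)
    (hΔ : polyLaplacian n p = 0) :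
    ∑ i, ∑ j, polyRot i j (polyRot i j p) = C (-2 * eigen n k) * p := by
  have hE := hp.sum_X_mul_pderiv
  have hEC : ∑ i, X i * pderiv i p = C (k : ℝ) * p := by rw [hE, nsmul_eq_mul, map_natCast]
  rw [polyLaplacian_apply] at hΔ
  -- Euler's identity applied twice gives S = k(k-1)p. Expanding the squared rotations leaves only
  -- first-order Euler terms, S and multiples of Δp = 0. The sum runs over ordered pairs, hence the
  -- factor 2 in the eigenvalue.
  set S := ∑ i : Fin n, ∑ j : Fin n, X i * X j * pderiv i (pderiv j p) with hS
  have hS' : S = ((k : MvPolynomial (Fin n) ℝ) * k - k) * p := by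
    have h : ∀ i : Fin n, X i * pderiv i (∑ j : Fin n, X j * pderiv j p) =
        X i * pderiv i p + ∑ j : Fin n, X i * X j * pderiv i (pderiv j p) := by
      intro i
      simp only [map_sum, pderiv_mul, Finset.sum_add_distrib, mul_add, pderiv_X, Pi.single_apply]
      simp [Finset.mul_sum, mul_assoc]
    have h2 := Finset.sum_congr (rfl : (Finset.univ : Finset (Fin n)) = Finset.univ)
      fun i _ => h i
    rw [Finset.sum_add_distrib, hEC, ← hS] at h2
    simp only [pderiv_C_mul, mul_left_comm (X _) (C _), ← Finset.mul_sum, hEC] at h2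
    simp only [map_natCast] at h2
    linear_combination -h2
  have hterm : ∀ i j : Fin n, polyRot i j (polyRot i j p) =
      (if i = j then X i * pderiv i p else 0) + (if i = j then X i * pderiv i p else 0)
      + X i * X i * pderiv j (pderiv j p) + X j * X j * pderiv i (pderiv i p)
      - X i * pderiv i p - X j * pderiv j p
      - X j * X i * pderiv j (pderiv i p) - X i * X j * pderiv i (pderiv j p) := by
    intro i j
    simp only [polyRot, map_sub, pderiv_mul, pderiv_X_self]
    by_cases hij : i = j
    · subst hij
      simp
      ring
    · rw [pderiv_X_of_ne hij, pderiv_X_of_ne (Ne.symm hij), if_neg hij]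
      ring
  simp only [hterm, Finset.sum_add_distrib, Finset.sum_sub_distrib]
  have e1 : ∑ i : Fin n, ∑ j : Fin n, X j * X i * pderiv j (pderiv i p) = S := by
    rw [Finset.sum_comm]
  have e2 : ∑ i : Fin n, ∑ j : Fin n, X i * X i * pderiv j (pderiv j p) = 0 := by
    simp only [← Finset.mul_sum, hΔ, mul_zero, Finset.sum_const_zero]
  have e3 : ∑ i : Fin n, ∑ j : Fin n, X j * X j * pderiv i (pderiv i p) = 0 := by
    rw [Finset.sum_comm]
    exact e2
  rw [e1, e2, e3, ← hS, hS']
  simp only [Finset.sum_ite_eq, Finset.mem_univ, if_true, Finset.sum_const, Finset.card_univ,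
    Fintype.card_fin, ← Finset.smul_sum, hE, eigen]
  simp only [nsmul_eq_mul]
  simp only [map_add, map_sub, map_mul, map_neg, map_natCast, map_ofNat]
  ring

end ZonalPolynomials

/-! ### Rotations of the sphere -/

/-- The map of the sphere induced by a linear isometry. -/
def sphMap {n : ℕ} (f : EuclideanSpace ℝ (Fin n) ≃ₗᵢ[ℝ] EuclideanSpace ℝ (Fin n)) (y : Sph n) :
    Sph n :=
  ⟨f y, by rw [mem_sphere_zero_iff_norm, f.norm_map, norm_eq_of_mem_sphere]⟩

theorem continuous_sphMap {n : ℕ}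
    (f : EuclideanSpace ℝ (Fin n) ≃ₗᵢ[ℝ] EuclideanSpace ℝ (Fin n)) : Continuous (sphMap f) :=
  (f.continuous.comp continuous_subtype_val).subtype_mk _

-- The surface measure of a set is a multiple of the Lebesgue measure of the cone over it, and a
-- linear isometry carries cones to cones and preserves Lebesgue measure.
open Pointwise in
theorem measurePreserving_sphMap {n : ℕ}
    (f : EuclideanSpace ℝ (Fin n) ≃ₗᵢ[ℝ] EuclideanSpace ℝ (Fin n)) :
    MeasurePreserving (sphMap f) (surf n) (surf n) := by
  refine ⟨(continuous_sphMap f).measurable, Measure.ext fun s hs => ?_⟩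
  rw [Measure.map_apply (continuous_sphMap f).measurable hs, surf,
    Measure.toSphere_apply' _ ((continuous_sphMap f).measurable hs), Measure.toSphere_apply' _ hs]
  congr 1
  have e : (Ioo (0 : ℝ) 1 • (Subtype.val '' (sphMap f ⁻¹' s)) : Set (EuclideanSpace ℝ (Fin n))) =
      f.toMeasurableEquiv ⁻¹' (Ioo (0 : ℝ) 1 • (Subtype.val '' s)) := by
    ext X
    simp only [mem_preimage, Set.mem_smul, mem_image]
    constructor
    · rintro ⟨r, hr, _, ⟨y, hy, rfl⟩, rfl⟩
      exact ⟨r, hr, _, ⟨sphMap f y, hy, rfl⟩, by simp [sphMap]⟩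
    · rintro ⟨r, hr, _, ⟨y, hy, rfl⟩, h⟩
      refine ⟨r, hr, _, ⟨sphMap f.symm y, ?_, rfl⟩, ?_⟩
      · have : sphMap f (sphMap f.symm y) = y := Subtype.ext (by simp [sphMap])
        exact (congrArg (· ∈ s) this).mpr hy
      · apply f.injective
        simpa [sphMap] using h
  rw [e]
  exact f.measurePreserving.measure_preimage_equiv _

theorem integral_comp_sphMap {n : ℕ}
    (f : EuclideanSpace ℝ (Fin n) ≃ₗᵢ[ℝ] EuclideanSpace ℝ (Fin n)) {g : Sph n → ℝ}
    (hg : Continuous g) : ∫ y, g (sphMap f y) ∂(surf n) = ∫ y, g y ∂(surf n) := by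
  have h := measurePreserving_sphMap f
  rw [← integral_map h.measurable.aemeasurable hg.aestronglyMeasurable, h.map_eq]

/-- The velocity field of the rotations in the plane `(i, j)`. -/
def rotVec {n : ℕ} (i j : Fin n) (y : EuclideanSpace ℝ (Fin n)) : EuclideanSpace ℝ (Fin n) :=
  y i • EuclideanSpace.single j (1 : ℝ) - y j • EuclideanSpace.single i (1 : ℝ)

/-- The rotation by the angle `θ` in the plane `(i, j)`. -/
def planeRot {n : ℕ} (i j : Fin n) (θ : ℝ) :
    EuclideanSpace ℝ (Fin n) →ₗ[ℝ] EuclideanSpace ℝ (Fin n) where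
  toFun y := y + (((Real.cos θ - 1) * y i - Real.sin θ * y j) • EuclideanSpace.single i (1 : ℝ) +
    ((Real.cos θ - 1) * y j + Real.sin θ * y i) • EuclideanSpace.single j (1 : ℝ))
  map_add' x y := by
    simp only [PiLp.add_apply]
    module
  map_smul' c y := by
    simp only [PiLp.smul_apply, smul_eq_mul, RingHom.id_apply]
    module

theorem planeRot_apply {n : ℕ} (i j : Fin n) (θ : ℝ) (y : EuclideanSpace ℝ (Fin n)) :
    planeRot i j θ y = y + (((Real.cos θ - 1) * y i - Real.sin θ * y j) •
      EuclideanSpace.single i (1 : ℝ) +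
      ((Real.cos θ - 1) * y j + Real.sin θ * y i) • EuclideanSpace.single j (1 : ℝ)) := rfl

theorem norm_planeRot {n : ℕ} {i j : Fin n} (hij : i ≠ j) (θ : ℝ) (y : EuclideanSpace ℝ (Fin n)) :
    ‖planeRot i j θ y‖ = ‖y‖ := by
  rw [← sq_eq_sq₀ (norm_nonneg _) (norm_nonneg _), planeRot_apply, norm_add_sq_real,
    norm_add_sq_real]
  simp only [inner_add_right, inner_smul_right, inner_smul_left, norm_smul,
    EuclideanSpace.inner_single_right, PiLp.norm_single, mul_pow, Real.norm_eq_abs,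
    sq_abs]
  simp [hij]
  linear_combination (y.ofLp i ^ 2 + y.ofLp j ^ 2) * Real.sin_sq_add_cos_sq θ

/-- The rotation by the angle `θ` in the plane `(i, j)`, as an isometry. -/
def rotIso {n : ℕ} {i j : Fin n} (hij : i ≠ j) (θ : ℝ) :
    EuclideanSpace ℝ (Fin n) ≃ₗᵢ[ℝ] EuclideanSpace ℝ (Fin n) :=
  LinearIsometry.toLinearIsometryEquiv ⟨planeRot i j θ, norm_planeRot hij θ⟩ rfl

theorem planeRot_zero {n : ℕ} (i j : Fin n) (y : EuclideanSpace ℝ (Fin n)) :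
    planeRot i j 0 y = y := by
  simp [planeRot_apply]

theorem hasDerivAt_planeRot {n : ℕ} {i j : Fin n} (hij : i ≠ j) (y : EuclideanSpace ℝ (Fin n))
    (θ : ℝ) : HasDerivAt (fun θ => planeRot i j θ y) (rotVec i j (planeRot i j θ y)) θ := by
  simp only [planeRot_apply]
  have h1 : HasDerivAt (fun θ => (Real.cos θ - 1) * y i - Real.sin θ * y j)
      (-Real.sin θ * y i - Real.cos θ * y j) θ :=
    (((Real.hasDerivAt_cos θ).sub_const 1).mul_const _).sub ((Real.hasDerivAt_sin θ).mul_const _)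
  have h2 : HasDerivAt (fun θ => (Real.cos θ - 1) * y j + Real.sin θ * y i)
      (-Real.sin θ * y j + Real.cos θ * y i) θ :=
    (((Real.hasDerivAt_cos θ).sub_const 1).mul_const _).add ((Real.hasDerivAt_sin θ).mul_const _)
  have h := ((h1.smul_const (EuclideanSpace.single i (1 : ℝ))).add
    (h2.smul_const (EuclideanSpace.single j (1 : ℝ)))).const_add y
  convert! h using 1
  simp only [rotVec]
  have e1 : (EuclideanSpace.single i (1 : ℝ) : EuclideanSpace ℝ (Fin n)) j = 0 := by
    simp [hij.symm]
  have e2 : (EuclideanSpace.single j (1 : ℝ) : EuclideanSpace ℝ (Fin n)) i = 0 := by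
    simp [hij]
  have e3 : (EuclideanSpace.single i (1 : ℝ) : EuclideanSpace ℝ (Fin n)) i = 1 := by simp
  have e4 : (EuclideanSpace.single j (1 : ℝ) : EuclideanSpace ℝ (Fin n)) j = 1 := by simp
  simp only [PiLp.add_apply, PiLp.smul_apply, e1, e2, e3, e4, smul_eq_mul]
  module

/-! ### Smooth functions on the sphere and derivatives along rotations -/

theorem radialExt_coe {n : ℕ} (u : Sph n → ℝ) (y : Sph n) :
    radialExt u (y : EuclideanSpace ℝ (Fin n)) = u y := by
  have h : (y : EuclideanSpace ℝ (Fin n)) ≠ 0 := ne_zero_of_mem_unit_sphere y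
  rw [radialExt, dif_neg h]
  congr 1
  exact Subtype.ext (by simp)

/-- The radial projection to the sphere. -/
def normalize {n : ℕ} (X : EuclideanSpace ℝ (Fin n)) (h : X ≠ 0) : Sph n :=
  ⟨‖X‖⁻¹ • X, by
    rw [mem_sphere_zero_iff_norm, norm_smul, norm_inv, norm_norm,
      inv_mul_cancel₀ (norm_ne_zero_iff.mpr h)]⟩

theorem radialExt_of_ne {n : ℕ} (u : Sph n → ℝ) {X : EuclideanSpace ℝ (Fin n)} (h : X ≠ 0) :
    radialExt u X = u (normalize X h) := by
  rw [radialExt, dif_neg h]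
  rfl

theorem contDiffOn_normalize (n : ℕ) :
    ContDiffOn ℝ (⊤ : ℕ∞) (fun X : EuclideanSpace ℝ (Fin n) => ‖X‖⁻¹ • X) {0}ᶜ := fun _ hX =>
  (((contDiffAt_norm ℝ hX).inv (norm_ne_zero_iff.mpr hX)).smul contDiffAt_id).contDiffWithinAt

/-- The radial extension is `F` composed with the smooth radial projection, so any extension smooth
off the origin suffices. -/
theorem SmoothOnSphere.of_contDiffOn {n : ℕ} {u : Sph n → ℝ} {F : EuclideanSpace ℝ (Fin n) → ℝ}
    (hF : ContDiffOn ℝ (⊤ : ℕ∞) F {0}ᶜ) (h : ∀ y : Sph n, F y = u y) : SmoothOnSphere u := by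
  refine ContDiffOn.congr (hF.comp (contDiffOn_normalize n) fun X hX => ?_) fun X hX => ?_
  · exact ne_zero_of_mem_unit_sphere (normalize X hX)
  · rw [radialExt_of_ne u hX, ← h]
    rfl

theorem SmoothOnSphere.continuous {n : ℕ} {u : Sph n → ℝ} (hu : SmoothOnSphere u) :
    Continuous u := by
  have h : u = radialExt u ∘ ((↑) : Sph n → EuclideanSpace ℝ (Fin n)) :=
    funext fun y => (radialExt_coe u y).symm
  rw [h]
  exact hu.continuousOn.comp_continuous continuous_subtype_val
    fun y => ne_zero_of_mem_unit_sphere y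

theorem SmoothOnSphere.mul {n : ℕ} {u v : Sph n → ℝ} (hu : SmoothOnSphere u)
    (hv : SmoothOnSphere v) : SmoothOnSphere (fun y => u y * v y) :=
  .of_contDiffOn (ContDiffOn.mul hu hv) fun y => by rw [radialExt_coe, radialExt_coe]

theorem SmoothOnSphere.sum {n : ℕ} {ι : Type*} {s : Finset ι} {u : ι → Sph n → ℝ}
    (hu : ∀ i ∈ s, SmoothOnSphere (u i)) : SmoothOnSphere (fun y => ∑ i ∈ s, u i y) :=
  .of_contDiffOn (ContDiffOn.sum hu) fun y => by simp only [radialExt_coe]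

theorem smoothOnSphere_restrictPoly {n : ℕ} (p : MvPolynomial (Fin n) ℝ) :
    SmoothOnSphere (restrictPoly n p) := by
  refine .of_contDiffOn (F := fun X => MvPolynomial.eval (fun i => X i) p) ?_ fun y => rfl
  induction p using MvPolynomial.induction_on with
  | C a => simpa using contDiffOn_const
  | add p q hp hq => simpa using hp.add hq
  | mul_X p i hp =>
    simp only [map_mul, MvPolynomial.eval_X]
    exact hp.mul ((EuclideanSpace.proj i : EuclideanSpace ℝ (Fin n) →L[ℝ] ℝ).contDiff.contDiffOn)

theorem SmoothOnSphere.differentiableAt {n : ℕ} {u : Sph n → ℝ} (hu : SmoothOnSphere u)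
    (y : Sph n) : DifferentiableAt ℝ (radialExt u) (y : EuclideanSpace ℝ (Fin n)) :=
  (hu.contDiffAt (isOpen_compl_singleton.mem_nhds (ne_zero_of_mem_unit_sphere y))).differentiableAt
    (by simp)

/-- The derivative of a function on the sphere along the rotations in the plane `(i, j)`. -/
def rotDeriv {n : ℕ} (i j : Fin n) (u : Sph n → ℝ) (y : Sph n) : ℝ :=
  fderiv ℝ (radialExt u) (y : EuclideanSpace ℝ (Fin n)) (rotVec i j y)

theorem SmoothOnSphere.comp_rotDeriv {n : ℕ} {u : Sph n → ℝ} (hu : SmoothOnSphere u) (i j : Fin n) :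
    SmoothOnSphere (rotDeriv i j u) := by
  refine .of_contDiffOn (F := fun X => fderiv ℝ (radialExt u) X (rotVec i j X)) ?_ fun y => rfl
  refine ContDiffOn.clm_apply (hu.fderiv_of_isOpen isOpen_compl_singleton (by simp)) ?_
  refine ContDiff.contDiffOn ?_
  unfold rotVec
  exact ((EuclideanSpace.proj i : EuclideanSpace ℝ (Fin n) →L[ℝ] ℝ).contDiff.smul contDiff_const).sub
    ((EuclideanSpace.proj j : EuclideanSpace ℝ (Fin n) →L[ℝ] ℝ).contDiff.smul contDiff_const)

theorem SmoothOnSphere.hasDerivAt_rot {n : ℕ} {u : Sph n → ℝ} (hu : SmoothOnSphere u) {i j : Fin n}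
    (hij : i ≠ j) (y : Sph n) (θ : ℝ) :
    HasDerivAt (fun θ => u (sphMap (rotIso hij θ) y))
      (rotDeriv i j u (sphMap (rotIso hij θ) y)) θ := by
  have h1 := (hu.differentiableAt (sphMap (rotIso hij θ) y)).hasFDerivAt
  have h2 := h1.comp_hasDerivAt θ (hasDerivAt_planeRot hij y θ)
  refine h2.congr_of_eventuallyEq (Filter.Eventually.of_forall fun θ => ?_)
  exact (radialExt_coe u (sphMap (rotIso hij θ) y)).symm

theorem sphMap_rotIso_zero {n : ℕ} {i j : Fin n} (hij : i ≠ j) (y : Sph n) :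
    sphMap (rotIso hij 0) y = y := Subtype.ext (planeRot_zero i j y)

theorem rotDeriv_self {n : ℕ} (i : Fin n) (u : Sph n → ℝ) (y : Sph n) : rotDeriv i i u y = 0 := by
  simp [rotDeriv, rotVec]

instance (n : ℕ) : IsFiniteMeasure (surf n) := by
  unfold surf
  infer_instance

theorem Continuous.exists_abs_le_sph {n : ℕ} {u : Sph n → ℝ} (hu : Continuous u) :
    ∃ M : ℝ, 0 ≤ M ∧ ∀ y, |u y| ≤ M := by
  obtain ⟨M, hM⟩ := (isCompact_range hu.abs).bddAbove
  exact ⟨max M 0, le_max_right _ _, fun y => (hM ⟨y, rfl⟩).trans (le_max_left _ _)⟩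

/-- The integral of `u` composed with the rotation by θ does not depend on θ; differentiate at θ = 0
under the integral sign. -/
theorem SmoothOnSphere.integral_rotDeriv {n : ℕ} {u : Sph n → ℝ} (hu : SmoothOnSphere u)
    (i j : Fin n) : ∫ y, rotDeriv i j u y ∂(surf n) = 0 := by
  by_cases hij : i = j
  · subst hij
    simp [rotDeriv_self]
  obtain ⟨M, -, hM⟩ := Continuous.exists_abs_le_sph (hu.comp_rotDeriv i j).continuous
  have hc := hu.continuous
  have h := hasDerivAt_integral_of_dominated_loc_of_deriv_le (μ := surf n) (𝕜 := ℝ)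
    (F := fun θ y => u (sphMap (rotIso hij θ) y))
    (F' := fun θ y => rotDeriv i j u (sphMap (rotIso hij θ) y)) (x₀ := 0) (s := univ)
    (bound := fun _ => M) Filter.univ_mem
    (Filter.Eventually.of_forall fun θ => (hc.comp (continuous_sphMap _)).aestronglyMeasurable)
    (integrable_of_continuous (hc.comp (continuous_sphMap _)))
    (((hu.comp_rotDeriv i j).continuous.comp (continuous_sphMap _)).aestronglyMeasurable)
    (Filter.Eventually.of_forall fun y θ _ => hM _) (integrable_const M)
    (Filter.Eventually.of_forall fun y θ _ => hu.hasDerivAt_rot hij y θ)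
  have h2 := h.2
  simp only [integral_comp_sphMap _ hc, sphMap_rotIso_zero] at h2
  exact h2.unique (hasDerivAt_const _ _)

theorem rotDeriv_mul {n : ℕ} {u v : Sph n → ℝ} (hu : SmoothOnSphere u)
    (hv : SmoothOnSphere v) (i j : Fin n) (y : Sph n) :
    rotDeriv i j (fun y => u y * v y) y = rotDeriv i j u y * v y + u y * rotDeriv i j v y := by
  have e : radialExt (fun y => u y * v y) = fun X => radialExt u X * radialExt v X := by
    ext X
    by_cases h : X = 0
    · simp [radialExt, h]
    · simp only [radialExt_of_ne _ h]
  unfold rotDeriv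
  rw [e, fderiv_fun_mul (hu.differentiableAt y) (hv.differentiableAt y)]
  simp only [radialExt_coe, add_apply, smul_apply, smul_eq_mul]
  ring

theorem integral_rotDeriv_mul {n : ℕ} {u v : Sph n → ℝ} (hu : SmoothOnSphere u)
    (hv : SmoothOnSphere v) (i j : Fin n) :
    ∫ y, rotDeriv i j u y * v y ∂(surf n) = -∫ y, u y * rotDeriv i j v y ∂(surf n) := by
  have h := (hu.mul hv).integral_rotDeriv i j
  simp only [rotDeriv_mul hu hv] at h
  rw [integral_add (integrable_of_continuous ((hu.comp_rotDeriv i j).mul hv).continuous)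
    (integrable_of_continuous (hu.mul (hv.comp_rotDeriv i j)).continuous)] at h
  linarith

theorem hasDerivAt_eval {n : ℕ} (p : MvPolynomial (Fin n) ℝ) {c : ℝ → Fin n → ℝ} {c' : Fin n → ℝ}
    {θ : ℝ} (hc : ∀ i, HasDerivAt (fun θ => c θ i) (c' i) θ) :
    HasDerivAt (fun θ => MvPolynomial.eval (c θ) p)
      (∑ i, MvPolynomial.eval (c θ) (MvPolynomial.pderiv i p) * c' i) θ := by
  classical
  induction p using MvPolynomial.induction_on with
  | C a => simpa using hasDerivAt_const θ a
  | add p q hp hq =>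
    simp only [map_add, add_mul, Finset.sum_add_distrib]
    exact hp.fun_add hq
  | mul_X p l hp =>
    have h := hp.mul (hc l)
    simp only [map_mul, MvPolynomial.eval_X, MvPolynomial.pderiv_mul, MvPolynomial.pderiv_X,
      map_add, add_mul, Finset.sum_add_distrib]
    refine h.congr_deriv ?_
    rw [Finset.sum_mul]
    congr 1
    · exact Finset.sum_congr rfl fun i _ => by ring
    · rw [Finset.sum_eq_single l]
      · simp
      · intro i _ hi
        simp [Pi.single_eq_of_ne (Ne.symm hi)]
      · simp

/-- Both sides are the derivative at θ = 0 along the rotation orbit, one computed with the radial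
extension and the other with the polynomial itself. -/
theorem rotDeriv_restrictPoly {n : ℕ} (i j : Fin n) (p : MvPolynomial (Fin n) ℝ) :
    rotDeriv i j (restrictPoly n p) = restrictPoly n (polyRot i j p) := by
  ext y
  by_cases hij : i = j
  · subst hij
    rw [rotDeriv_self, polyRot, sub_self, map_zero]
    rfl
  have h1 := (smoothOnSphere_restrictPoly p).hasDerivAt_rot hij y 0
  have h2 : ∀ l : Fin n, HasDerivAt (fun θ => (planeRot i j θ (y : EuclideanSpace ℝ (Fin n))) l)
      (rotVec i j (planeRot i j 0 (y : EuclideanSpace ℝ (Fin n))) l) 0 := fun l =>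
    (EuclideanSpace.proj l : EuclideanSpace ℝ (Fin n) →L[ℝ] ℝ).hasFDerivAt.comp_hasDerivAt 0
      (hasDerivAt_planeRot hij (y : EuclideanSpace ℝ (Fin n)) 0)
  have h3 := hasDerivAt_eval p (c := fun θ l => (planeRot i j θ (y : EuclideanSpace ℝ (Fin n))) l) h2
  have h4 := h1.unique h3
  rw [sphMap_rotIso_zero] at h4
  rw [h4, planeRot_zero]
  change _ = MvPolynomial.eval _ (polyRot i j p)
  simp only [rotVec, polyRot, map_sub, map_mul, MvPolynomial.eval_X, PiLp.sub_apply,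
    PiLp.smul_apply, PiLp.single_apply, smul_eq_mul, mul_sub, Finset.sum_sub_distrib]
  simp [mul_comm]

/-! ### Symmetry of the Laplacian and orthogonality of degrees -/

/-- Twice the spherical Laplacian. -/
def sphLap {n : ℕ} (u : Sph n → ℝ) (y : Sph n) : ℝ :=
  ∑ i, ∑ j, rotDeriv i j (rotDeriv i j u) y

theorem SmoothOnSphere.comp_sphLap {n : ℕ} {u : Sph n → ℝ} (hu : SmoothOnSphere u) :
    SmoothOnSphere (sphLap u) :=
  .sum fun i _ => .sum fun j _ => (hu.comp_rotDeriv i j).comp_rotDeriv i j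

theorem smoothOnSphere_of_mem_SH {n k : ℕ} {p : Sph n → ℝ} (hp : p ∈ SH n k) :
    SmoothOnSphere p := by
  obtain ⟨p, -, rfl⟩ := hp
  exact smoothOnSphere_restrictPoly p

theorem sphLap_of_mem_SH {n k : ℕ} {p : Sph n → ℝ} (hp : p ∈ SH n k) (y : Sph n) :
    sphLap p y = -2 * eigen n k * p y := by
  obtain ⟨p, ⟨h1, h2⟩, rfl⟩ := hp
  have h := sum_polyRot_polyRot h1 h2
  have h3 := congrFun (congrArg (restrictPoly n) h) y
  rw [← MvPolynomial.smul_eq_C_mul, map_smul] at h3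
  simp only [map_sum, Finset.sum_apply, ← rotDeriv_restrictPoly] at h3
  exact h3

theorem integral_sphLap_mul {n : ℕ} {u v : Sph n → ℝ} (hu : SmoothOnSphere u)
    (hv : SmoothOnSphere v) :
    ∫ y, sphLap u y * v y ∂(surf n) = ∫ y, u y * sphLap v y ∂(surf n) := by
  simp only [sphLap, Finset.sum_mul, Finset.mul_sum]
  have e : ∀ i j, ∫ y, rotDeriv i j (rotDeriv i j u) y * v y ∂(surf n) =
      ∫ y, u y * rotDeriv i j (rotDeriv i j v) y ∂(surf n) := fun i j => by
    rw [integral_rotDeriv_mul (hu.comp_rotDeriv i j) hv,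
      integral_rotDeriv_mul hu (hv.comp_rotDeriv i j), neg_neg]
  have c1 : ∀ i j, Integrable (fun y => rotDeriv i j (rotDeriv i j u) y * v y) (surf n) :=
    fun i j => integrable_of_continuous (((hu.comp_rotDeriv i j).comp_rotDeriv i j).mul hv).continuous
  have c2 : ∀ i j, Integrable (fun y => u y * rotDeriv i j (rotDeriv i j v) y) (surf n) :=
    fun i j => integrable_of_continuous (hu.mul ((hv.comp_rotDeriv i j).comp_rotDeriv i j)).continuous
  rw [integral_finsetSum _ fun i _ => integrable_finsetSum _ fun j _ => c1 i j,
    integral_finsetSum _ fun i _ => integrable_finsetSum _ fun j _ => c2 i j]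
  refine Finset.sum_congr rfl fun i _ => ?_
  rw [integral_finsetSum _ fun j _ => c1 i j, integral_finsetSum _ fun j _ => c2 i j]
  exact Finset.sum_congr rfl fun j _ => e i j

theorem integral_mul_sphLap_of_mem_SH {n k : ℕ} {p u : Sph n → ℝ} (hp : p ∈ SH n k)
    (hu : SmoothOnSphere u) :
    ∫ y, p y * sphLap u y ∂(surf n) = -2 * eigen n k * ∫ y, p y * u y ∂(surf n) := by
  rw [← integral_sphLap_mul (smoothOnSphere_of_mem_SH hp) hu, ← integral_const_mul]
  simp only [sphLap_of_mem_SH hp, mul_assoc]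

theorem integral_mul_sphLap_iterate {n k : ℕ} {p u : Sph n → ℝ} (hp : p ∈ SH n k)
    (hu : SmoothOnSphere u) (N : ℕ) : SmoothOnSphere (sphLap^[N] u) ∧
    ∫ y, p y * (sphLap^[N] u) y ∂(surf n) =
      (-2 * eigen n k) ^ N * ∫ y, p y * u y ∂(surf n) := by
  induction N with
  | zero => simpa using hu
  | succ N ih =>
    rw [Function.iterate_succ_apply']
    exact ⟨ih.1.comp_sphLap, by rw [integral_mul_sphLap_of_mem_SH hp ih.1, ih.2, pow_succ]; ring⟩

/-- Eigenfunctions of a symmetric operator with distinct eigenvalues: λ_k - λ_j = (k - j)(k + j + n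
- 2). -/
theorem integral_mul_of_mem_SH_of_ne {n j k : ℕ} (hn : 3 ≤ n) (hjk : j ≠ k) {p q : Sph n → ℝ}
    (hp : p ∈ SH n j) (hq : q ∈ SH n k) : ∫ y, p y * q y ∂(surf n) = 0 := by
  have h := integral_mul_sphLap_of_mem_SH hp (smoothOnSphere_of_mem_SH hq)
  have e : ∫ y, p y * sphLap q y ∂(surf n) = -2 * eigen n k * ∫ y, p y * q y ∂(surf n) := by
    rw [← integral_const_mul]
    simp only [sphLap_of_mem_SH hq, mul_left_comm]
  rw [e] at h
  have hn' : (3 : ℝ) ≤ n := by exact_mod_cast hn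
  have hne : eigen n k - eigen n j ≠ 0 := by
    have : eigen n k - eigen n j = ((k : ℝ) - j) * (k + j + n - 2) := by
      unfold eigen
      ring
    rw [this]
    have hk : (0 : ℝ) ≤ k := k.cast_nonneg
    have hj : (0 : ℝ) ≤ j := j.cast_nonneg
    refine mul_ne_zero (sub_ne_zero.mpr (by exact_mod_cast hjk.symm)) (by linarith)
  have h0 : (eigen n k - eigen n j) * ∫ y, p y * q y ∂(surf n) = 0 := by linarith
  exact (mul_eq_zero.mp h0).resolve_left hne

/-! ### The Poisson integral and the reproducing property -/

theorem surf_real_univ {n : ℕ} (hn : 3 ≤ n) : (surf n).real univ = area n := by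
  have hn' : (3 : ℝ) ≤ n := by exact_mod_cast hn
  have hne : Nonempty (Fin n) := ⟨⟨0, by omega⟩⟩
  have hG := Real.Gamma_pos_of_pos (show 0 < (n : ℝ) / 2 by linarith)
  rw [surf, Measure.toSphere_real_apply_univ, Measure.real, EuclideanSpace.volume_ball]
  simp only [Fintype.card_fin, finrank_euclideanSpace, ENNReal.ofReal_one, one_pow, one_mul]
  rw [Real.Gamma_add_one (by linarith), ENNReal.toReal_ofReal (by positivity), area,
    Real.sqrt_eq_rpow, ← Real.rpow_natCast, ← Real.rpow_mul Real.pi_pos.le,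
    show (1 / 2 : ℝ) * n = (n : ℝ) / 2 by ring]
  field_simp

theorem continuous_dot {n : ℕ} (x : Sph n) : Continuous fun y : Sph n => dot x y := by
  unfold dot
  fun_prop

theorem continuous_zonal_dot {n : ℕ} (x : Sph n) (k : ℕ) :
    Continuous fun y : Sph n => zonal (nu n) (dot x y) k :=
  continuous_of_mem_SH (zonal_mem_SH x k)

theorem continuous_poisson_dot {n : ℕ} (hn : 3 ≤ n) (x : Sph n) {r : ℝ} (hr : r ∈ Ico (0 : ℝ) 1) :
    Continuous fun y : Sph n => poisson n r (dot x y) := by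
  have hd := continuous_dot x
  have ha := area_pos hn
  have hpos : ∀ y : Sph n, 0 < 1 - 2 * r * dot x y + r ^ 2 := fun y =>
    poisson_denom_pos hr (dot_mem_Icc x y)
  unfold poisson
  refine Continuous.div (by fun_prop) ?_ fun y => ?_
  · exact continuous_const.mul (Continuous.rpow_const (by fun_prop) fun y => Or.inl (hpos y).ne')
  · have := hpos y
    positivity

theorem poisson_nonneg {n : ℕ} (hn : 3 ≤ n) {r τ : ℝ} (hr : r ∈ Ico (0 : ℝ) 1)
    (hτ : τ ∈ Icc (-1 : ℝ) 1) : 0 ≤ poisson n r τ := by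
  have ha := area_pos hn
  have := poisson_denom_pos hr hτ
  have : 0 ≤ 1 - r ^ 2 := by nlinarith [hr.1, hr.2]
  unfold poisson
  positivity

/-- The convolution with the zonal harmonic of degree `k`. -/
def zonalProj {n : ℕ} (u : Sph n → ℝ) (x : Sph n) (k : ℕ) : ℝ :=
  1 / area n * ∫ y, zonal (nu n) (dot x y) k * u y ∂(surf n)

theorem hasSum_integral_poisson {n : ℕ} (hn : 3 ≤ n) {u : Sph n → ℝ} (hu : Continuous u)
    (x : Sph n) {r : ℝ} (hr : r ∈ Ico (0 : ℝ) 1) :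
    HasSum (fun k => zonalProj u x k * r ^ k) (∫ y, poisson n r (dot x y) * u y ∂(surf n)) := by
  obtain ⟨M, hM0, hM⟩ := Continuous.exists_abs_le_sph hu
  have ha := area_pos hn
  have hr0 := hr.1
  have hS := ((hasSum_zonal (nu_pos hn).ne' (τ := 1) (by norm_num) hr).summable.mul_left
    (1 / area n)).mul_right M
  have h := hasSum_integral_of_dominated_convergence (μ := surf n)
    (F := fun k y => 1 / area n * zonal (nu n) (dot x y) k * r ^ k * u y)
    (f := fun y => poisson n r (dot x y) * u y)
    (fun k _ => 1 / area n * (zonal (nu n) 1 k * r ^ k) * M)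
    (fun k => ((continuous_const.mul (continuous_zonal_dot x k)).mul continuous_const).mul
      hu |>.aestronglyMeasurable)
    (fun k => Filter.Eventually.of_forall fun y => by
      have h1 := abs_zonal_le_one (nu_pos hn) (dot_mem_Icc x y) k
      rw [Real.norm_eq_abs, abs_mul, abs_mul, abs_mul, abs_of_pos (by positivity : 0 < 1 / area n),
        abs_of_nonneg (by positivity : 0 ≤ r ^ k), mul_assoc (1 / area n)]
      have := zonal_one_nonneg (nu_pos hn) k
      gcongr
      exact hM y)
    (Filter.Eventually.of_forall fun _ => hS) (integrable_const _)
    (Filter.Eventually.of_forall fun y => (hasSum_poisson hn hr (dot_mem_Icc x y)).mul_right (u y))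
  refine Eq.mp (congrArg (fun f => HasSum f _) (funext fun k => ?_)) h
  rw [zonalProj, mul_assoc, mul_comm _ (r ^ k), ← mul_assoc, ← integral_const_mul]
  congr 1
  ext y
  ring

theorem zonalProj_of_mem_SH_of_ne {n j k : ℕ} (hn : 3 ≤ n) {p : Sph n → ℝ} (hp : p ∈ SH n k)
    (hjk : j ≠ k) (x : Sph n) : zonalProj p x j = 0 := by
  rw [zonalProj, integral_mul_of_mem_SH_of_ne hn hjk (zonal_mem_SH x j) hp, mul_zero]

/-- Orthogonality kills every degree but k in the zonal expansion of the kernel. -/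
theorem integral_poisson_of_mem_SH {n k : ℕ} (hn : 3 ≤ n) {p : Sph n → ℝ} (hp : p ∈ SH n k)
    (x : Sph n) {r : ℝ} (hr : r ∈ Ico (0 : ℝ) 1) :
    ∫ y, poisson n r (dot x y) * p y ∂(surf n) = zonalProj p x k * r ^ k := by
  refine (hasSum_integral_poisson hn (continuous_of_mem_SH hp) x hr).unique
    (hasSum_single k fun j hj => ?_)
  rw [zonalProj_of_mem_SH_of_ne hn hp hj, zero_mul]

theorem one_mem_SH {n : ℕ} (hn : 3 ≤ n) (x : Sph n) : (fun _ => 1 : Sph n → ℝ) ∈ SH n 0 := by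
  simpa only [zonal_zero (nu_pos hn).ne'] using zonal_mem_SH x 0

theorem zonalProj_zero {n : ℕ} (hn : 3 ≤ n) (u : Sph n → ℝ) (x : Sph n) :
    zonalProj u x 0 = 1 / area n * ∫ y, u y ∂(surf n) := by
  simp [zonalProj, zonal_zero (nu_pos hn).ne']

theorem integral_poisson {n : ℕ} (hn : 3 ≤ n) (x : Sph n) {r : ℝ} (hr : r ∈ Ico (0 : ℝ) 1) :
    ∫ y, poisson n r (dot x y) ∂(surf n) = 1 := by
  have h := integral_poisson_of_mem_SH hn (one_mem_SH hn x) x hr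
  have ha := area_pos hn
  rw [zonalProj_zero hn] at h
  simpa [surf_real_univ hn, ha.ne'] using h

/-- The Poisson kernel is nonnegative, has mass one, and tends to 0 uniformly away from x as r → 1.
-/
theorem tendsto_integral_poisson {n : ℕ} (hn : 3 ≤ n) {p : Sph n → ℝ} (hp : Continuous p)
    (x : Sph n) : Filter.Tendsto (fun r => ∫ y, poisson n r (dot x y) * p y ∂(surf n))
      (nhdsWithin 1 (Iio 1)) (nhds (p x)) := by
  have ha := area_pos hn
  have hev : ∀ᶠ r in nhdsWithin (1 : ℝ) (Iio 1), r ∈ Ico (1 / 2 : ℝ) 1 :=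
    Ico_mem_nhdsLT (by norm_num)
  have hev0 : ∀ᶠ r in nhdsWithin (1 : ℝ) (Iio 1), r ∈ Ico (0 : ℝ) 1 :=
    hev.mono fun r hr => ⟨by linarith [hr.1], hr.2⟩
  refine tendsto_integral_peak_smul_of_integrable_of_tendsto (μ := surf n) (x₀ := x)
    (φ := fun r y => poisson n r (dot x y)) (t := univ) MeasurableSet.univ Filter.univ_mem
    (measure_ne_top _ _) ?_ ?_ ?_ ?_ (integrable_of_continuous hp) hp.continuousAt
  · exact hev0.mono fun r hr y => poisson_nonneg hn hr (dot_mem_Icc x y)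
  · intro U hU hxU
    obtain ⟨δ, hδ, hUδ⟩ : ∃ δ : ℝ, 0 < δ ∧ ∀ y ∈ Uᶜ, δ ≤ 1 - dot x y := by
      have hc : IsCompact Uᶜ := hU.isClosed_compl.isCompact
      rcases (Uᶜ).eq_empty_or_nonempty with he | hne
      · exact ⟨1, one_pos, by simp [he]⟩
      · obtain ⟨z, hz, hmin⟩ := hc.exists_isMinOn hne
          (continuous_const.sub (continuous_dot x) : Continuous fun y => 1 - dot x y).continuousOn
        refine ⟨1 - dot x z, ?_, fun y hy => hmin hy⟩
        have := dot_lt_one (x := x) (y := z) fun h => hz (h ▸ hxU)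
        linarith
    rw [Metric.tendstoUniformlyOn_iff]
    intro ε hε
    have hlim : Filter.Tendsto (fun r : ℝ => (1 - r ^ 2) / (area n * δ ^ ((n : ℝ) / 2)))
        (nhdsWithin 1 (Iio 1)) (nhds 0) := by
      have : Filter.Tendsto (fun r : ℝ => (1 - r ^ 2) / (area n * δ ^ ((n : ℝ) / 2)))
          (nhds 1) (nhds ((1 - 1 ^ 2) / (area n * δ ^ ((n : ℝ) / 2)))) :=
        Continuous.tendsto (by fun_prop) 1
      simp only [one_pow, sub_self, zero_div] at this
      exact this.mono_left nhdsWithin_le_nhds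
    filter_upwards [hev, hev0, hlim.eventually_lt_const hε] with r hr hr0 hrε y hy
    have hm := dot_mem_Icc x y
    simp only [Pi.zero_apply]
    rw [dist_comm, Real.dist_0_eq_abs, abs_of_nonneg (poisson_nonneg hn hr0 hm)]
    refine lt_of_le_of_lt ?_ hrε
    -- The denominator is at least 2r(1 - x · y) ≥ 2rδ; restricting to r ≥ 1/2 removes the factor.
    have h1 : δ ≤ 1 - 2 * r * dot x y + r ^ 2 := by
      have h2 := hUδ y hy
      nlinarith [hr.1, sq_nonneg (1 - r)]
    have h2 : 0 ≤ 1 - r ^ 2 := by nlinarith [hr.1, hr.2]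
    unfold poisson
    gcongr
  · simp only [setIntegral_univ]
    refine tendsto_const_nhds.congr' ?_
    filter_upwards [hev0] with r hr
    rw [integral_poisson hn x hr]
  · exact hev0.mono fun r hr => (continuous_poisson_dot hn x hr).aestronglyMeasurable

/-- The Poisson integral of `p` is its zonal projection times r^k, and it also tends to p(x) as r →
1. -/
theorem zonalProj_of_mem_SH {n k : ℕ} (hn : 3 ≤ n) {p : Sph n → ℝ} (hp : p ∈ SH n k) (x : Sph n) :
    zonalProj p x k = p x := by
  have h1 := tendsto_integral_poisson hn (continuous_of_mem_SH hp) x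
  have h2 : Filter.Tendsto (fun r : ℝ => zonalProj p x k * r ^ k) (nhdsWithin 1 (Iio 1))
      (nhds (zonalProj p x k * 1 ^ k)) :=
    (Continuous.tendsto (by fun_prop) 1).mono_left nhdsWithin_le_nhds
  rw [one_pow, mul_one] at h2
  refine tendsto_nhds_unique (h2.congr' ?_) h1
  have hev : ∀ᶠ r in nhdsWithin (1 : ℝ) (Iio 1), r ∈ Ico (0 : ℝ) 1 := Ico_mem_nhdsLT one_pos
  filter_upwards [hev] with r hr
  rw [integral_poisson_of_mem_SH hn hp x hr]

/-- The projection to the spherical harmonics of degree `k` is a zonal convolution. -/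
theorem proj_eq_zonalProj {n k d : ℕ} (hn : 3 ≤ n) {Y : Fin d → Sph n → ℝ} (hY : IsONB n k Y)
    {u : Sph n → ℝ} (hu : Continuous u) (x : Sph n) : proj Y u x = zonalProj u x k := by
  have ha := area_pos hn
  have hYm : ∀ l, Y l ∈ SH n k := fun l => by
    rw [← hY.span_eq]
    exact Submodule.subset_span ⟨l, rfl⟩
  have hYc : ∀ l, Continuous (Y l) := fun l => continuous_of_mem_SH (hYm l)
  have hz := zonal_mem_SH x k
  rw [← hY.span_eq, Submodule.mem_span_range_iff_exists_fun] at hz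
  obtain ⟨c, hc⟩ := hz
  have hc' : ∀ y, zonal (nu n) (dot x y) k = ∑ l, c l * Y l y := fun y => by
    rw [← congrFun hc y]
    simp
  have hexp : ∀ v : Sph n → ℝ, Continuous v →
      zonalProj v x k = 1 / area n * ∑ l, c l * ∫ y, Y l y * v y ∂(surf n) := by
    intro v hv
    rw [zonalProj]
    simp only [hc', Finset.sum_mul, mul_assoc]
    have hi : ∀ l, Integrable (fun y => c l * (Y l y * v y)) (surf n) := fun l =>
      (integrable_of_continuous ((hYc l).mul hv)).const_mul (c l)
    rw [integral_finsetSum _ fun l _ => hi l]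
    simp only [integral_const_mul]
  -- The addition theorem: reproducing Y_m at x shows that the zonal function has coordinates ω
  -- Y_m(x) in the given basis.
  have hcl : ∀ m, 1 / area n * c m = Y m x := by
    intro m
    rw [← zonalProj_of_mem_SH hn (hYm m) x, hexp _ (hYc m)]
    simp [hY.orthonormal]
  rw [hexp u hu, proj, Finset.mul_sum]
  refine Finset.sum_congr rfl fun l _ => ?_
  rw [← hcl l, coeff]
  simp only [mul_comm (u _)]
  ring

theorem abs_zonalProj_le {n : ℕ} (hn : 3 ≤ n) {u : Sph n → ℝ} {M : ℝ}
    (hM : ∀ y, |u y| ≤ M) (x : Sph n) (k : ℕ) :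
    |zonalProj u x k| ≤ 2 * ((k : ℝ) + 1) ^ (n - 2) * M := by
  have ha := area_pos hn
  have h : ‖∫ y, zonal (nu n) (dot x y) k * u y ∂(surf n)‖ ≤
      2 * ((k : ℝ) + 1) ^ (n - 2) * M * (surf n).real univ := by
    refine norm_integral_le_of_norm_le_const (Filter.Eventually.of_forall fun y => ?_)
    rw [norm_mul, Real.norm_eq_abs, Real.norm_eq_abs]
    gcongr
    · exact abs_zonal_le hn (dot_mem_Icc x y) k
    · exact hM y
  rw [surf_real_univ hn, Real.norm_eq_abs] at h
  rw [zonalProj, abs_mul, abs_of_pos (by positivity : 0 < 1 / area n), one_div_mul_eq_div,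
    div_le_iff₀ ha]
  exact h

theorem le_eigen_succ {n : ℕ} (hn : 3 ≤ n) (k : ℕ) : ((k : ℝ) + 1) ^ 2 ≤ eigen n (k + 1) := by
  have hn' : (3 : ℝ) ≤ n := by exact_mod_cast hn
  have hk : (0 : ℝ) ≤ k := k.cast_nonneg
  unfold eigen
  push_cast
  nlinarith

/-- Rapid decay of the harmonic components of a smooth function. -/
theorem summable_abs_zonalProj {n : ℕ} (hn : 3 ≤ n) {u : Sph n → ℝ} (hu : SmoothOnSphere u)
    (x : Sph n) : Summable fun k => |zonalProj u x (k + 1)| := by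
  -- Applying the Laplacian n times divides the component by at least (k+1)^(2n), which amply beats
  -- the growth (k+1)^(n-2) of the zonal bound and leaves (k+1)^(-2).
  obtain ⟨M, hM0, hM⟩ := Continuous.exists_abs_le_sph
    (integral_mul_sphLap_iterate (one_mem_SH hn x) hu n).1.continuous
  have hs : Summable fun k : ℕ => (2 * 2 ^ (n - 2) * M) * (1 / ((k + 1 : ℕ) : ℝ) ^ 2) :=
    ((summable_nat_add_iff 1).mpr (Real.summable_one_div_nat_pow.mpr one_lt_two)).mul_left _
  refine Summable.of_nonneg_of_le (fun k => abs_nonneg _) (fun k => ?_) hs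
  have h := (integral_mul_sphLap_iterate (zonal_mem_SH x (k + 1)) hu n).2
  have h1 : zonalProj (sphLap^[n] u) x (k + 1) =
      (-2 * eigen n (k + 1)) ^ n * zonalProj u x (k + 1) := by
    rw [zonalProj, h, zonalProj]
    ring
  have h2 := abs_zonalProj_le hn hM x (k + 1)
  have hk : (1 : ℝ) ≤ (k : ℝ) + 1 := by linarith [(k.cast_nonneg : (0 : ℝ) ≤ k)]
  have he := le_eigen_succ hn k
  have h3 : (((k : ℝ) + 1) ^ 2) ^ n ≤ |(-2 * eigen n (k + 1)) ^ n| := by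
    have he0 : 0 ≤ eigen n (k + 1) := le_trans (by positivity) he
    rw [abs_pow, abs_mul, abs_of_nonneg he0]
    gcongr
    norm_num
    linarith
  have h4 : ((k : ℝ) + 1) ^ (n - 2) * ((k : ℝ) + 1) ^ 2 ≤ (((k : ℝ) + 1) ^ 2) ^ n := by
    rw [← pow_add, ← pow_mul]
    exact pow_le_pow_right₀ hk (by omega)
  have h5 : 2 * (((k + 1 : ℕ) : ℝ) + 1) ^ (n - 2) * M ≤
      (2 * 2 ^ (n - 2) * M) * ((k : ℝ) + 1) ^ (n - 2) := by
    have : (((k + 1 : ℕ) : ℝ) + 1) ^ (n - 2) ≤ (2 * ((k : ℝ) + 1)) ^ (n - 2) := by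
      gcongr
      push_cast
      linarith
    rw [mul_pow] at this
    nlinarith
  rw [h1, abs_mul] at h2
  push_cast
  rw [mul_one_div, le_div_iff₀ (by positivity)]
  have hp : 0 < ((k : ℝ) + 1) ^ (n - 2) := by positivity
  refine le_of_mul_le_mul_right ?_ hp
  calc |zonalProj u x (k + 1)| * ((k : ℝ) + 1) ^ 2 * ((k : ℝ) + 1) ^ (n - 2)
      = (((k : ℝ) + 1) ^ (n - 2) * ((k : ℝ) + 1) ^ 2) * |zonalProj u x (k + 1)| := by ring
    _ ≤ |(-2 * eigen n (k + 1)) ^ n| * |zonalProj u x (k + 1)| := by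
        gcongr
        exact h4.trans h3
    _ ≤ _ := h2.trans h5

/-! ### The spherical convolution -/

/-- The real part of the subordination density. -/
def subordRe (ν s t : ℝ) : ℝ := (subord ν s t).re

theorem subord_eq_ofReal {n : ℕ} (hn : 3 ≤ n) {s : ℝ} (hs : 0 < s) {t : ℝ} (ht : 0 < t) :
    subord (nu n) s t = (subordRe (nu n) s t : ℂ) := by
  rw [subordRe, subord_ofReal hn hs ht, Complex.ofReal_re]

theorem measurable_subordRe (ν s : ℝ) : Measurable (subordRe ν s) :=
  Complex.measurable_re.comp (measurable_subord ν s)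

theorem abs_subordRe_le {n : ℕ} (hn : 3 ≤ n) {s : ℝ} (hs : 0 < s) {t : ℝ} (ht : 0 < t) :
    |subordRe (nu n) s t| ≤
      ‖Complex.Gamma (2 * (s : ℂ))‖⁻¹ * (t ^ (2 * s - 1) * Real.exp (nu n * t)) :=
  (Complex.abs_re_le_norm _).trans (norm_subord_le (nu_pos hn).le (by simpa using hs) ht)

theorem kernel_eq_subordRe {n : ℕ} (hn : 3 ≤ n) {s : ℝ} (hs : 0 < s) (τ : ℝ) :
    kernel n s τ = ∫ t in Ioi (0 : ℝ), kerPoisson n τ t * subordRe (nu n) s t := by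
  rw [← Complex.ofReal_inj, kernel_eq hn hs, ← integral_complex_ofReal]
  refine setIntegral_congr_fun measurableSet_Ioi fun t ht => ?_
  rw [subord_eq_ofReal hn hs ht, Complex.ofReal_mul]

theorem integral_exp_mul_subordRe {n : ℕ} (hn : 3 ≤ n) {s : ℝ} (hs : 0 < s) (k : ℕ) :
    ∫ t in Ioi (0 : ℝ), Real.exp (-(((k : ℝ) + 1 + nu n) * t)) * subordRe (nu n) s t =
      eigen n (k + 1) ^ (-s) := by
  have hp : nu n < (k : ℝ) + 1 + nu n := by linarith [(k.cast_nonneg : (0 : ℝ) ≤ k)]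
  have h := integral_exp_mul_subord (nu_pos hn).le hp (σ := s) (by simpa using hs)
  have he : 0 ≤ eigen n (k + 1) := le_trans (by positivity) (le_eigen_succ hn k)
  rw [← eigen_succ, ← Complex.ofReal_neg, ← Complex.ofReal_cpow he] at h
  rw [← Complex.ofReal_inj, ← h, ← integral_complex_ofReal]
  refine setIntegral_congr_fun measurableSet_Ioi fun t ht => ?_
  rw [subord_eq_ofReal hn hs ht, Complex.ofReal_mul]

theorem norm_exp_mul_subordRe_le {n : ℕ} (hn : 3 ≤ n) {s : ℝ} (hs : 0 < s) {k t : ℝ}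
    (ht : 0 < t) : ‖Real.exp (-((k + nu n) * t)) * subordRe (nu n) s t‖ ≤
      ‖Complex.Gamma (2 * (s : ℂ))‖⁻¹ * (t ^ (2 * s - 1) * Real.exp (-(k * t))) := by
  rw [norm_mul, Real.norm_eq_abs, Real.norm_eq_abs, Real.abs_exp]
  calc _ ≤ Real.exp (-((k + nu n) * t)) *
        (‖Complex.Gamma (2 * (s : ℂ))‖⁻¹ * (t ^ (2 * s - 1) * Real.exp (nu n * t))) := by
        gcongr
        exact abs_subordRe_le hn hs ht
    _ = _ := by
        rw [show -(k * t) = -((k + nu n) * t) + nu n * t by ring, Real.exp_add]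
        ring

theorem integrableOn_exp_mul_subordRe {n : ℕ} (hn : 3 ≤ n) {s : ℝ} (hs : 0 < s) {k : ℝ}
    (hk : 0 < k) :
    IntegrableOn (fun t => Real.exp (-((k + nu n) * t)) * subordRe (nu n) s t) (Ioi 0) := by
  refine Integrable.mono' ((integrableOn_rpow_mul_exp (a := 2 * s) (by linarith) hk).const_mul
    ‖Complex.Gamma (2 * (s : ℂ))‖⁻¹)
    ((Measurable.mul (by fun_prop) (measurable_subordRe _ _)).aestronglyMeasurable) ?_
  filter_upwards [ae_restrict_mem measurableSet_Ioi] with t ht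
  exact norm_exp_mul_subordRe_le hn hs ht

theorem integral_norm_exp_mul_subordRe_le {n : ℕ} (hn : 3 ≤ n) {s : ℝ} (hs : 0 < s) {k : ℝ}
    (hk : 1 ≤ k) :
    ∫ t in Ioi (0 : ℝ), ‖Real.exp (-((k + nu n) * t)) * subordRe (nu n) s t‖ ≤
      ‖Complex.Gamma (2 * (s : ℂ))‖⁻¹ *
        ∫ t in Ioi (0 : ℝ), t ^ (2 * s - 1) * Real.exp (-(1 * t)) := by
  rw [← integral_const_mul]
  refine setIntegral_mono_on (integrableOn_exp_mul_subordRe hn hs (by linarith)).norm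
    ((integrableOn_rpow_mul_exp (a := 2 * s) (by linarith) one_pos).const_mul _)
    measurableSet_Ioi fun t ht => ?_
  have ht' : (0 : ℝ) < t := ht
  refine (norm_exp_mul_subordRe_le hn hs ht).trans ?_
  gcongr

/-- The Poisson kernel minus its mean is integrable on the sphere with exponential decay. -/
theorem exists_integral_abs_poisson_sub_le {n : ℕ} (hn : 3 ≤ n) : ∃ C : ℝ, 0 ≤ C ∧
    ∀ (x : Sph n) (t : ℝ), 0 < t →
      ∫ y, |poisson n (Real.exp (-t)) (dot x y) - 1 / area n| ∂(surf n) ≤ C * Real.exp (-t) := by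
  obtain ⟨C, hC, h⟩ := abs_poisson_sub_le_of_one_le hn
  have ha := area_pos hn
  refine ⟨C * area n + 2 * Real.exp 1, by positivity, fun x t ht => ?_⟩
  have hr := exp_neg_mem_Ico ht
  have hE := Real.exp_pos (-t)
  have hi := integrable_of_continuous (continuous_poisson_dot hn x hr)
  have hi2 : Integrable (fun _ : Sph n => 1 / area n) (surf n) := integrable_const _
  rcases le_total 1 t with h1 | h1
  · calc _ ≤ ∫ y, C * Real.exp (-t) ∂(surf n) :=
          integral_mono (hi.sub hi2).abs (integrable_const _)
            fun y => h _ (dot_mem_Icc x y) t h1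
      _ = C * area n * Real.exp (-t) := by
          rw [integral_const, surf_real_univ hn, smul_eq_mul]
          ring
      _ ≤ _ := by
          gcongr
          have := Real.exp_pos 1
          linarith
  -- For small t positivity and unit mass of the Poisson kernel bound the L¹ norm by 2, although the
  -- kernel itself blows up at x.
  · calc _ ≤ ∫ y, (poisson n (Real.exp (-t)) (dot x y) + 1 / area n) ∂(surf n) := by
          refine integral_mono (hi.sub hi2).abs (hi.add hi2) fun y => ?_
          have h0 := poisson_nonneg hn hr (dot_mem_Icc x y)
          have h2 : 0 ≤ 1 / area n := by positivity
          simp only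
          rw [abs_le]
          constructor <;> linarith
      _ = 2 := by
          rw [integral_add hi hi2, integral_poisson hn x hr, integral_const, surf_real_univ hn,
            smul_eq_mul, mul_one_div_cancel ha.ne']
          norm_num
      _ ≤ 2 * (Real.exp 1 * Real.exp (-t)) := by
          rw [← Real.exp_add]
          have := Real.one_le_exp (show 0 ≤ 1 + -t by linarith)
          linarith
      _ ≤ _ := by
          have : 0 ≤ C * area n * Real.exp (-t) := by positivity
          nlinarith

theorem measurable_kerPoisson_dot {n : ℕ} (x : Sph n) :
    Measurable fun z : Sph n × ℝ => kerPoisson n (dot x z.1) z.2 := by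
  have hd : Measurable fun z : Sph n × ℝ => dot x z.1 :=
    (continuous_dot x).measurable.comp measurable_fst
  unfold kerPoisson poisson
  refine Measurable.mul (by fun_prop) (Measurable.sub_const (Measurable.div (by fun_prop) ?_) _)
  refine Measurable.const_mul (Measurable.pow_const ?_ _) _
  fun_prop

/-- Mean zero makes the subtracted constant harmless and removes the term of degree 0, so the sum
starts at degree 1. -/
theorem integral_kerPoisson_mul {n : ℕ} (hn : 3 ≤ n) {u : Sph n → ℝ} (hu : Continuous u)
    (hmean : ∫ y, u y ∂(surf n) = 0) (x : Sph n) {t : ℝ} (ht : 0 < t) :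
    HasSum (fun k : ℕ => zonalProj u x (k + 1) * Real.exp (-(((k : ℝ) + 1 + nu n) * t)))
      (∫ y, kerPoisson n (dot x y) t * u y ∂(surf n)) := by
  have hr := exp_neg_mem_Ico ht
  have h := (hasSum_nat_add_iff' 1).mpr (hasSum_integral_poisson hn hu x hr)
  simp only [Finset.sum_range_one, zonalProj_zero hn, hmean, mul_zero, zero_mul, sub_zero] at h
  have h2 := h.mul_left (Real.exp (-t * nu n))
  have e : ∫ y, kerPoisson n (dot x y) t * u y ∂(surf n) = Real.exp (-t * nu n) *
      ∫ y, poisson n (Real.exp (-t)) (dot x y) * u y ∂(surf n) := by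
    have hi : Integrable (fun y => poisson n (Real.exp (-t)) (dot x y) * u y) (surf n) :=
      integrable_of_continuous ((continuous_poisson_dot hn x hr).mul hu)
    have : ∫ y, poisson n (Real.exp (-t)) (dot x y) * u y ∂(surf n) =
        ∫ y, (poisson n (Real.exp (-t)) (dot x y) * u y - 1 / area n * u y) ∂(surf n) := by
      rw [integral_sub hi ((integrable_of_continuous hu).const_mul _), integral_const_mul, hmean,
        mul_zero, sub_zero]
    rw [this, ← integral_const_mul]
    congr 1
    ext y
    rw [kerPoisson]
    ring
  rw [e]
  refine Eq.mp (congrArg (fun f => HasSum f _) (funext fun k => ?_)) h2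
  rw [← Real.exp_nat_mul, mul_left_comm, ← Real.exp_add]
  congr 2
  push_cast
  ring

theorem continuous_kerPoisson_dot {n : ℕ} (hn : 3 ≤ n) (x : Sph n) {t : ℝ} (ht : 0 < t) :
    Continuous fun y : Sph n => kerPoisson n (dot x y) t :=
  continuous_const.mul ((continuous_poisson_dot hn x (exp_neg_mem_Ico ht)).sub continuous_const)

/-- Integrating in y first leaves a multiple of t^(2s-1) e^(-t), the factors e^(νt) and e^(-νt)
cancelling. This is integrable for every s > 0, and it yields integrability of the kernel without
the pointwise estimates. -/
theorem integrable_prod_kerPoisson {n : ℕ} (hn : 3 ≤ n) {s : ℝ} (hs : 0 < s) {u : Sph n → ℝ}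
    (hu : Continuous u) (x : Sph n) :
    Integrable (Function.uncurry fun (y : Sph n) (t : ℝ) =>
      kerPoisson n (dot x y) t * subordRe (nu n) s t * u y)
      ((surf n).prod (volume.restrict (Ioi 0))) := by
  obtain ⟨M, hM0, hM⟩ := Continuous.exists_abs_le_sph hu
  obtain ⟨C, hC0, hC⟩ := exists_integral_abs_poisson_sub_le hn
  have hmeas : AEStronglyMeasurable (Function.uncurry fun (y : Sph n) (t : ℝ) =>
      kerPoisson n (dot x y) t * subordRe (nu n) s t * u y)
      ((surf n).prod (volume.restrict (Ioi 0))) :=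
    (((measurable_kerPoisson_dot x).mul ((measurable_subordRe _ _).comp measurable_snd)).mul
      (hu.measurable.comp measurable_fst)).aestronglyMeasurable
  have hcont : ∀ {t : ℝ}, 0 < t → Continuous fun y : Sph n =>
      kerPoisson n (dot x y) t * subordRe (nu n) s t * u y := fun ht =>
    ((continuous_kerPoisson_dot hn x ht).mul continuous_const).mul hu
  rw [integrable_prod_iff' hmeas]
  constructor
  · filter_upwards [ae_restrict_mem measurableSet_Ioi] with t ht
    exact integrable_of_continuous (hcont ht)
  · have hI := (integrableOn_rpow_mul_exp (a := 2 * s) (by linarith) one_pos).const_mul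
      (C * M * ‖Complex.Gamma (2 * (s : ℂ))‖⁻¹)
    refine Integrable.mono' hI hmeas.norm.prod_swap.integral_prod_right' ?_
    filter_upwards [ae_restrict_mem measurableSet_Ioi] with t ht
    have ht' : (0 : ℝ) < t := ht
    rw [Real.norm_of_nonneg (integral_nonneg fun y => norm_nonneg _)]
    have hr := exp_neg_mem_Ico ht'
    have hci : Continuous fun y : Sph n =>
        |poisson n (Real.exp (-t)) (dot x y) - 1 / area n| :=
      ((continuous_poisson_dot hn x hr).sub continuous_const).abs
    calc ∫ y, ‖kerPoisson n (dot x y) t * subordRe (nu n) s t * u y‖ ∂(surf n) ≤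
        ∫ y, Real.exp (-t * nu n) * |subordRe (nu n) s t| * M *
          |poisson n (Real.exp (-t)) (dot x y) - 1 / area n| ∂(surf n) := by
          refine integral_mono (integrable_of_continuous (hcont ht)).norm
            ((integrable_of_continuous hci).const_mul _) fun y => ?_
          simp only [norm_mul, Real.norm_eq_abs, kerPoisson, Real.abs_exp]
          calc _ ≤ Real.exp (-t * nu n) * |poisson n (Real.exp (-t)) (dot x y) - 1 / area n| *
                |subordRe (nu n) s t| * M := by
                gcongr
                exact hM y
            _ = _ := by ring
      _ ≤ Real.exp (-t * nu n) * (‖Complex.Gamma (2 * (s : ℂ))‖⁻¹ *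
          (t ^ (2 * s - 1) * Real.exp (nu n * t))) * M * (C * Real.exp (-t)) := by
          rw [integral_const_mul]
          gcongr
          · exact abs_subordRe_le hn hs ht
          · exact hC x t ht
      _ = _ := by
          have : Real.exp (-t * nu n) * Real.exp (nu n * t) = 1 := by
            rw [← Real.exp_add]
            simp [mul_comm]
          rw [one_mul]
          linear_combination (‖Complex.Gamma (2 * (s : ℂ))‖⁻¹ * t ^ (2 * s - 1) * M * C *
            Real.exp (-t)) * this

/-- Valid for every y, including y = x where the t-integral may diverge: pulling out a constant
respects the default value 0 of a divergent integral. -/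
theorem integral_kerPoisson_mul_eq_kernel {n : ℕ} (hn : 3 ≤ n) {s : ℝ} (hs : 0 < s)
    (u : Sph n → ℝ) (x y : Sph n) :
    ∫ t in Ioi (0 : ℝ), kerPoisson n (dot x y) t * subordRe (nu n) s t * u y =
      kernel n s (dot x y) * u y := by
  rw [integral_mul_const, kernel_eq_subordRe hn hs]

theorem integrable_kernel_mul {n : ℕ} (hn : 3 ≤ n) {s : ℝ} (hs : 0 < s) {u : Sph n → ℝ}
    (hu : Continuous u) (x : Sph n) :
    Integrable (fun y => kernel n s (dot x y) * u y) (surf n) := by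
  have h := (integrable_prod_kerPoisson hn hs hu x).integral_prod_left
  simpa only [Function.uncurry, integral_kerPoisson_mul_eq_kernel hn hs] using h

/-- By Fubini the convolution is the t-integral of the Poisson integral of `u` against the density.
Expanding in degrees, each Laplace transform gives λ_k^(-s), and summability of the components of
`u` permits the exchange for all s > 0. -/
theorem hasSum_integral_kernel_mul {n : ℕ} (hn : 3 ≤ n) {s : ℝ} (hs : 0 < s) {u : Sph n → ℝ}
    (hu : SmoothOnSphere u) (hmean : ∫ y, u y ∂(surf n) = 0) (x : Sph n) :
    HasSum (fun k => eigen n (k + 1) ^ (-s) * zonalProj u x (k + 1))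
      (∫ y, kernel n s (dot x y) * u y ∂(surf n)) := by
  have hswap := integral_integral_swap (integrable_prod_kerPoisson hn hs hu.continuous x)
  simp only [integral_kerPoisson_mul_eq_kernel hn hs] at hswap
  set F : ℕ → ℝ → ℝ := fun k t => zonalProj u x (k + 1) *
    (Real.exp (-(((k : ℝ) + 1 + nu n) * t)) * subordRe (nu n) s t) with hF
  have hk : ∀ k : ℕ, (1 : ℝ) ≤ (k : ℝ) + 1 := fun k => by
    linarith [(k.cast_nonneg : (0 : ℝ) ≤ k)]
  have hFi : ∀ k, Integrable (F k) (volume.restrict (Ioi 0)) := fun k =>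
    (integrableOn_exp_mul_subordRe hn hs (by linarith [hk k])).const_mul _
  have hFs : Summable fun k => ∫ t in Ioi (0 : ℝ), ‖F k t‖ := by
    refine Summable.of_nonneg_of_le (fun k => integral_nonneg fun t => norm_nonneg _)
      (fun k => ?_) ((summable_abs_zonalProj hn hu x).mul_right
        (‖Complex.Gamma (2 * (s : ℂ))‖⁻¹ *
          ∫ t in Ioi (0 : ℝ), t ^ (2 * s - 1) * Real.exp (-(1 * t))))
    simp only [hF]
    simp only [norm_mul (zonalProj u x (k + 1))]
    rw [integral_const_mul, Real.norm_eq_abs]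
    gcongr
    exact integral_norm_exp_mul_subordRe_le hn hs (hk k)
  have h := hasSum_integral_of_summable_integral_norm hFi hFs
  have e1 : ∀ k, ∫ t in Ioi (0 : ℝ), F k t = eigen n (k + 1) ^ (-s) * zonalProj u x (k + 1) := by
    intro k
    rw [integral_const_mul, integral_exp_mul_subordRe hn hs, mul_comm]
  have e2 : ∫ t in Ioi (0 : ℝ), ∑' k, F k t =
      ∫ t in Ioi (0 : ℝ), ∫ y, kerPoisson n (dot x y) t * subordRe (nu n) s t * u y ∂(surf n) := by
    refine setIntegral_congr_fun measurableSet_Ioi fun t ht => ?_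
    have h1 := (integral_kerPoisson_mul hn hu.continuous hmean x ht).mul_right
      (subordRe (nu n) s t)
    have h2 : ∫ y, kerPoisson n (dot x y) t * subordRe (nu n) s t * u y ∂(surf n) =
        (∫ y, kerPoisson n (dot x y) t * u y ∂(surf n)) * subordRe (nu n) s t := by
      rw [← integral_mul_const]
      congr 1
      ext y
      ring
    rw [h2, ← h1.tsum_eq]
    exact tsum_congr fun k => by simp only [hF]; ring
  simp only [e1] at h
  rwa [e2, ← hswap] at h

end FracSphere

end

/-- Fractional integrals on the sphere. For `n ≥ 3` and `s > 0` there are a kernel `K`, a function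
of `x · y`, and a constant depending only on `n` and `s` such that: `K` is the value at `s` of the
Minakshisundaram zeta function; `K` has the integral representation through the Poisson kernel and
the modified Bessel function, with an absolutely convergent integral; `K` satisfies the pointwise
estimates; and the negative power of the spherical Laplacian of any smooth function of mean zero is
its spherical convolution with `K`. -/
theorem theorem5p1 (n : ℕ) (hn : 3 ≤ n) (s : ℝ) (hs : 0 < s) :
    ∃ K : ℝ → ℝ,
      -- the kernel is the Minakshisundaram zeta function
      (∀ τ ∈ Set.Ico (-1 : ℝ) 1, ∃ Z : ℂ → ℂ,
        FracSphere.IsMinakZeta n τ Z ∧ Z (s : ℂ) = ((K τ : ℝ) : ℂ)) ∧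
      (((n : ℝ) - 1) / 2 < s → ∀ τ ∈ Set.Icc (-1 : ℝ) 1,
        HasSum (FracSphere.zetaTerm n τ (s : ℂ)) ((K τ : ℝ) : ℂ)) ∧
      -- the integral representation
      (∀ τ ∈ Set.Icc (-1 : ℝ) 1, (τ < 1 ∨ ((n : ℝ) - 1) / 2 < s) →
        IntegrableOn (FracSphere.kernelIntegrand n s τ) (Set.Ioi 0) ∧
        K τ = (4 / ((n : ℝ) - 2)) ^ (s - 1 / 2) * (Real.Gamma (s + 1 / 2) / Real.Gamma (2 * s)) *
          ∫ t in Set.Ioi (0 : ℝ), FracSphere.kernelIntegrand n s τ t) ∧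
      -- the estimates
      (∃ c : ℝ, 0 < c ∧ ∀ x y : FracSphere.Sph n, x ≠ y →
        |K (FracSphere.dot x y)| ≤ c * FracSphere.kernelBound n s x y) ∧
      -- the spherical convolution
      (∀ (d : ℕ → ℕ) (Y : ∀ k, Fin (d k) → FracSphere.Sph n → ℝ),
        (∀ k, FracSphere.IsONB n k (Y k)) →
        ∀ u : FracSphere.Sph n → ℝ, FracSphere.SmoothOnSphere u →
          ∫ y, u y ∂(FracSphere.surf n) = 0 →
          ∀ x : FracSphere.Sph n,
            Summable (FracSphere.negPowTerm Y s u x) ∧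
            Integrable (fun y => K (FracSphere.dot x y) * u y) (FracSphere.surf n) ∧
            FracSphere.negPow Y s u x =
              ∫ y, K (FracSphere.dot x y) * u y ∂(FracSphere.surf n)) := by
  -- The kernel is taken to be the right-hand side of the integral representation, so that formula
  -- is definitional and the zeta function is what has to be identified with it.
  refine ⟨FracSphere.kernel n s, ?_, ?_, ?_, FracSphere.exists_abs_kernel_le_kernelBound hn hs, ?_⟩
  · intro τ hτ
    exact ⟨_, FracSphere.isMinakZeta_integral hn hτ, (FracSphere.kernel_eq hn hs τ).symm⟩
  · intro h τ hτ
    rw [FracSphere.kernel_eq hn hs]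
    exact FracSphere.hasSum_zetaTerm hn hτ (by simpa using h)
  · intro τ hτ h
    exact ⟨FracSphere.integrableOn_kernelIntegrand hn hs hτ h, rfl⟩
  · intro d Y hY u hu hmean x
    have hterm : FracSphere.negPowTerm Y s u x = fun k =>
        FracSphere.eigen n (k + 1) ^ (-s) * FracSphere.zonalProj u x (k + 1) := funext fun k => by
      rw [FracSphere.negPowTerm, FracSphere.proj_eq_zonalProj hn (hY (k + 1)) hu.continuous]
    have h := FracSphere.hasSum_integral_kernel_mul hn hs hu hmean x
    rw [← hterm] at h
    exact ⟨h.summable, FracSphere.integrable_kernel_mul hn hs hu.continuous x, h.tsum_eq⟩
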